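/- Let $T=\mathbb R$ or $T=\mathbb R\setminus\{0\}$. Let $\mathcal Y$ be a Borel right process with state space $T$, symmetric with respect to a locally finite Borel measure $m$ on $T$, with finite potential densities $u=\{u(x,y),x,y\in T\}$ with respect to $m$, i.e. $E^x\int_0^\infty h(\mathcal Y_t)\,dt=\int_T u(x,y)h(y)\,dm(y)$ for all $x\in T$ and all measurable $h\ge 0$. Assume that $u$ is the restriction to $T\times T$ of a continuous function on $\mathbb R\times\mathbb R$, also denoted by $u$, and that $\eta=\{\eta(x),x\in\mathbb R\}$ is a mean zero Gaussian process with covariance $u$. Set $$\sigma^2(x,y)=E(\eta(x)-\eta(y))^2=u(x,x)+u(y,y)-2u(x,y).$$ Let $f,g$ be finite excessive functions for $\mathcal Y$ (that is, non-negative measurable functions with $E^x f(\mathcal Y_t)\uparrow f(x)$ as $t\downarrow0$ for all $x\in T$, and similarly for $g$). Let $k\ge1$ be an integer and let $X=\{X(t),t\in T\}$ be a $k/2$-permanental process with kernel $u_{g,f}(x,y)=u(x,y)+g(x)f(y)$, that is, a non-negative process such that $$E\, e^{-\sum_{i=1}^n s_iX(t_i)}=\det\bigl(I+(u_{g,f}(t_i,t_j))_{i,j}\,\mathrm{diag}(s_1,\dots,s_n)\bigr)^{-k/2}$$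 for all $n$, all $t_1,\dots,t_n\in T$ and all $s_1,\dots,s_n>0$. Fix $d\in T$ with $u(d,d)>0$, and write $\Delta_d(\delta)=[d-\delta,d+\delta]$. Assume that $f,g\in C^1(\Delta_d(\delta))$ for some $\delta>0$, and that there is a continuous increasing function $\varphi$ on $[0,\infty)$ with $\varphi(0)=0$ such that for some $\delta>0$ and constants $c_1,c_2,c_3>0$, $$c_2\,\varphi(|x-y|)\le\sigma^2(x,y)\le c_3\,\varphi(|x-y|)\quad\text{for all }x,y\in\Delta_d(\delta),$$ $$u(x,x)-u(x,y)\ge c_1\,\varphi(|x-y|)\quad\text{for all }x,y\in\Delta_d(\delta)\text{ with }x\ge y,$$ and $x=O(\varphi(x))$ as $x\downarrow0$. Fix $0<\theta<1$ and $0<q<1$. For $n\ge 1$ let $m(n)=n+1-[n^q]$, $t_0=0$ and $t_j=\theta^{n+1-j}$ for $j=1,\dots,m(n)$ (so $t_j$ depends on $n$). Assume that one, or both, of the following hold: (i) $\displaystyle\lim_{n\to\infty}\ \sup_{0\le j\ne k\le m(n)}\frac{m(n)\,|t_k-t_j|}{\varphi(|t_k-t_j|)}=0$; (ii) $f,g\in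 C^2(\Delta_d(\delta))$ for some $\delta>0$, and $f'(d)=g'(d)=0$. For $e\in\{1,-1\}$ consider the condition $$(\mathrm H_e)\qquad\text{for all }\epsilon>0:\quad P\Bigl(\sup_{1\le j\le m(n)}\frac{\eta(d+e\,t_j)-\eta(d)}{(2\sigma^2(d+e\,t_j,d)\log\log(1/t_j))^{1/2}}\ge1-\epsilon\Bigr)\ge1-\epsilon\quad\text{for all sufficiently large }n.$$ If $(\mathrm H_{1})$ holds, then $$\limsup_{t\downarrow0}\frac{|X(d+t)-X(d)|}{(2\sigma^2(d+t,d)\log\log(1/t))^{1/2}}\ \ge\ \sqrt2\,X(d)^{1/2}\qquad\text{a.s.}$$ If $(\mathrm H_{-1})$ holds, then $$\limsup_{t\uparrow0}\frac{|X(d+t)-X(d)|}{(2\sigma^2(d+t,d)\log\log(1/|t|))^{1/2}}\ \ge\ \sqrt2\,X(d)^{1/2}\qquad\text{a.s.}$$ -/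

import Mathlib

open MeasureTheory ProbabilityTheory Filter Topology Set
open scoped NNReal ENNReal

noncomputable section

/-! ### Borel right processes -/

/-- The Borel `σ`-algebra on the one-point compactification. -/
instance OnePoint.instMeasurableSpaceBorel (S : Type*) [TopologicalSpace S] :
    MeasurableSpace (OnePoint S) := borel _

instance OnePoint.instBorelSpaceBorel (S : Type*) [TopologicalSpace S] :
    BorelSpace (OnePoint S) := ⟨rfl⟩

/-- The extension by `0` at the cemetery of a nonnegative function on the state space. -/
def zeroExt {S : Type*} (h : S → ℝ≥0∞) : OnePoint S → ℝ≥0∞ := fun z => z.elim 0 h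

/-- A Borel right process `(Ω, 𝓕, 𝓕_t, Y_t, θ_t, P^x)` with (locally compact) state space `S`.
The cemetery state is the point `∞` of the one-point compactification of `S`. The strong Markov
property at constant times is the simple Markov property. -/
structure BorelRightProcess (S : Type*) [TopologicalSpace S] (Ω : Type*)
    [mΩ : MeasurableSpace Ω] where
  /-- the filtration `𝓕_t` -/
  filt : Filtration ℝ≥0 mΩ
  /-- the paths `Y_t` -/
  Y : ℝ≥0 → Ω → OnePoint S
  /-- the shift operators `θ_t` -/
  shift : ℝ≥0 → Ω → Ω
  /-- the laws `P^x` -/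
  P : OnePoint S → Measure Ω
  isProbabilityMeasure : ∀ x, IsProbabilityMeasure (P x)
  filt_rightContinuous : filt.IsRightContinuous
  adapted : ∀ t, Measurable[filt t] (Y t)
  path_rightContinuous : ∀ ω t, ContinuousWithinAt (fun s => Y s ω) (Ici t) t
  cemetery_absorbing : ∀ ω s t, s ≤ t → Y s ω = OnePoint.infty → Y t ω = OnePoint.infty
  shift_spec : ∀ s t ω, Y t (shift s ω) = Y (s + t) ω
  start : ∀ x, ∀ᵐ ω ∂(P x), Y 0 ω = x
  borel_semigroup : ∀ t (B : Set (OnePoint S)), MeasurableSet B →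
    Measurable fun x => P x (Y t ⁻¹' B)
  strong_markov : ∀ (x : OnePoint S) (τ : Ω → WithTop ℝ≥0) (hτ : IsStoppingTime filt τ)
    (A : Set Ω), MeasurableSet[hτ.measurableSpace] A →
    ∀ (s : ℝ≥0) (h : OnePoint S → ℝ≥0∞), Measurable h →
      ∫⁻ ω in A ∩ {ω | τ ω ≠ ⊤}, h (Y ((τ ω).untopD 0 + s) ω) ∂(P x) =
        ∫⁻ ω in A ∩ {ω | τ ω ≠ ⊤}, (∫⁻ ω', h (Y s ω') ∂(P (Y ((τ ω).untopD 0) ω))) ∂(P x)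

namespace BorelRightProcess

variable {S : Type*} [TopologicalSpace S] {Ω : Type*} [MeasurableSpace Ω]

/-- The transition semigroup `P_t h (x) = E^x (h (Y_t))`, with `h = 0` at the cemetery. -/
def semigroup (𝒴 : BorelRightProcess S Ω) (t : ℝ≥0) (h : S → ℝ≥0∞) (x : S) : ℝ≥0∞ :=
  ∫⁻ ω, zeroExt h (𝒴.Y t ω) ∂(𝒴.P x)

/-- The process is symmetric with respect to `m`. -/
def IsSymmetric [MeasurableSpace S] (𝒴 : BorelRightProcess S Ω) (m : Measure S) : Prop :=
  ∀ (t : ℝ≥0) (h₁ h₂ : S → ℝ≥0∞), Measurable h₁ → Measurable h₂ →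
    ∫⁻ x, 𝒴.semigroup t h₁ x * h₂ x ∂m = ∫⁻ x, h₁ x * 𝒴.semigroup t h₂ x ∂m

/-- `u` is a (finite, nonnegative) `0`-potential density of the process with respect to `m`:
`E^x ∫₀^∞ h (Y_t) dt = ∫ u (x, y) h (y) dm (y)`. -/
def HasPotentialDensity [MeasurableSpace S] (𝒴 : BorelRightProcess S Ω) (m : Measure S)
    (u : S → S → ℝ) : Prop :=
  (∀ x y, 0 ≤ u x y) ∧
  ∀ (x : S) (h : S → ℝ≥0∞), Measurable h →
    ∫⁻ ω, (∫⁻ t : ℝ in Ioi 0, zeroExt h (𝒴.Y t.toNNReal ω)) ∂(𝒴.P x) =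
      ∫⁻ y, ENNReal.ofReal (u x y) * h y ∂m

/-- `f` is a finite excessive function: `f` is nonnegative and measurable, and
`E^x (f (Y_t)) ↑ f (x)` as `t ↓ 0`, for all `x`. -/
def IsFiniteExcessive [MeasurableSpace S] (𝒴 : BorelRightProcess S Ω) (f : S → ℝ) : Prop :=
  (∀ x, 0 ≤ f x) ∧ Measurable f ∧
  ∀ x, Antitone (fun t => 𝒴.semigroup t (fun y => ENNReal.ofReal (f y)) x) ∧
    Tendsto (fun t => 𝒴.semigroup t (fun y => ENNReal.ofReal (f y)) x) (𝓝[>] 0)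
      (𝓝 (ENNReal.ofReal (f x)))

end BorelRightProcess

/-! ### Permanental processes -/

/-- `X = {X (t), t ∈ T}` is an `α`-permanental process with kernel `K`: it is nonnegative and
`E exp (- ∑ sᵢ X (tᵢ)) = det (I + K(t) S(s)) ^ (-α)` for all `t₁, …, tₙ ∈ T` and
`s₁, …, sₙ > 0`. -/
def IsPermanentalProcess {Ω : Type*} [MeasurableSpace Ω] (T : Set ℝ) (K : ℝ → ℝ → ℝ) (α : ℝ)
    (X : ℝ → Ω → ℝ) (μ : Measure Ω) : Prop :=
  (∀ t ∈ T, Measurable (X t)) ∧ (∀ t ∈ T, ∀ᵐ ω ∂μ, 0 ≤ X t ω) ∧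
  ∀ (n : ℕ) (t : Fin n → ℝ) (s : Fin n → ℝ), (∀ i, t i ∈ T) → (∀ i, 0 < s i) →
    ∫ ω, Real.exp (-∑ i, s i * X (t i) ω) ∂μ =
      1 / (1 + Matrix.of (fun i j => K (t i) (t j)) * Matrix.diagonal s).det ^ α

/-! ### The Gaussian process and the regularity conditions -/

/-- `η` is a mean zero Gaussian process on `ℝ` with covariance `u`. -/
def IsCenteredGaussianWithCov {Ω : Type*} [MeasurableSpace Ω] (η : ℝ → Ω → ℝ) (μ : Measure Ω)
    (u : ℝ → ℝ → ℝ) : Prop :=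
  IsGaussianProcess η μ ∧ (∀ x, ∫ ω, η x ω ∂μ = 0) ∧ ∀ x y, ∫ ω, η x ω * η y ω ∂μ = u x y

/-- The increment variance `σ²(x, y) = E (η (x) - η (y))²` of a Gaussian process with
covariance `u`. -/
def incVar (u : ℝ → ℝ → ℝ) (x y : ℝ) : ℝ := u x x + u y y - 2 * u x y

/-- The regularity conditions on the covariance `u` at `d`, with gauge function `φ`. -/
structure IsRegularAt (u : ℝ → ℝ → ℝ) (d : ℝ) (φ : ℝ → ℝ) : Prop where
  continuousOn : ContinuousOn φ (Ici 0)
  monotoneOn : MonotoneOn φ (Ici 0)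
  map_zero : φ 0 = 0
  comparable : ∃ δ > 0, ∃ c₁ > 0, ∃ c₂ > 0, ∃ c₃ > 0,
    (∀ x ∈ Icc (d - δ) (d + δ), ∀ y ∈ Icc (d - δ) (d + δ),
      c₂ * φ |x - y| ≤ incVar u x y ∧ incVar u x y ≤ c₃ * φ |x - y|) ∧
    (∀ x ∈ Icc (d - δ) (d + δ), ∀ y ∈ Icc (d - δ) (d + δ), y ≤ x →
      c₁ * φ |x - y| ≤ u x x - u x y)
  isBigO : (fun x : ℝ => x) =O[𝓝[>] 0] φ

/-- `m(n) = n + 1 - [n ^ q]`. -/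
def meshLen (q : ℝ) (n : ℕ) : ℕ := n + 1 - ⌊(n : ℝ) ^ q⌋₊

/-- `t_0 = 0` and `t_j = θ ^ (n + 1 - j)` for `1 ≤ j ≤ m(n)`. -/
def meshPt (θ : ℝ) (n j : ℕ) : ℝ := if j = 0 then 0 else θ ^ (n + 1 - j)

/-- For every `ε > 0` and all sufficiently large `n`, the probability that
`sup_{1 ≤ j ≤ m(n)} (η (t'_j) - η (d)) / (2 σ²(t'_j, d) log log (1 / t_j)) ^ (1/2) ≥ 1 - ε`
is at least `1 - ε`, where `t'_j = d + e t_j` (`e = 1`: to the right of `d`, `e = -1`: to the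
left). -/
def LILAlongMesh {Ω : Type*} [MeasurableSpace Ω] (η : ℝ → Ω → ℝ) (μ : Measure Ω)
    (u : ℝ → ℝ → ℝ) (d θ q e : ℝ) : Prop :=
  ∀ ε > 0, ∀ᶠ n : ℕ in atTop,
    1 - ε ≤ μ.real {ω | 1 - ε ≤ ⨆ j : Finset.Icc 1 (meshLen q n),
      (η (d + e * meshPt θ n j) ω - η d ω) /
        √(2 * incVar u (d + e * meshPt θ n j) d * Real.log (Real.log (1 / meshPt θ n j)))}

/-- `lim_{n → ∞} sup_{0 ≤ j ≠ k ≤ m(n)} m(n) |t_k - t_j| / φ (|t_k - t_j|) = 0`. -/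
def MeshCondition (φ : ℝ → ℝ) (θ q : ℝ) : Prop :=
  Tendsto (fun n : ℕ => ⨆ p : {p : Fin (meshLen q n + 1) × Fin (meshLen q n + 1) // p.1 ≠ p.2},
      (meshLen q n : ℝ) * |meshPt θ n p.1.2 - meshPt θ n p.1.1| /
        φ |meshPt θ n p.1.2 - meshPt θ n p.1.1|)
    atTop (𝓝 0)

end

/-! Everything is read off the finitely many points `d` and `d + e t_j`, `1 ≤ j ≤ m(n)`, where `u`
becomes a matrix `U`. By the domination principle (`sum_potentialDensity_le`), a charge whose
potential lies below a continuous supermedian function wherever the charge is positive has its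
potential below that function everywhere. Hence `U` is invertible (`charge_eq_zero`), `A = U⁻¹` has
nonpositive off-diagonal entries and nonnegative row sums, and `f = U a`, `g = U b` with `a, b ≥ 0`
(`isInverseMPair`, `inv_mulVec_nonneg`).

For diagonal `S ≥ 0` one has det(1 + (U + g fᵀ) S) = det(1 + U S) (1 + aᵀ U b - aᵀ (A + S)⁻¹ b)
(`det_rank_one`), and the entries of (A + S)⁻¹ are Laplace transforms of positive measures in `S`.
Expanding negative powers shows that the law of `X` on the mesh and the law obtained by freezing `f`
and `g` at `d` have a common component of mass close to 1 (`measure_le_add_of_laplace`). The frozen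
kernel is the covariance `u + f(d) g(d)`, so the frozen law is that of half the sum of squares of
`k` independent Gaussian vectors. The missing mass is controlled by the bound 2(m(n) + 1) for the
sum of |A_ij| σ²(x_i, x_j) (`gaussianSquares_le_add`). It tends to 0 because `f` and `g` are
continuous at `d` and their oscillation on the mesh is o(σ² / m(n)), which is what (i) or (ii)
provides.

For Gaussian squares y_j = Σ_i z_ij² / 2 one has y_j - y_0 ≥ Σ_i z_i0 (z_ij - z_i0). Replacing z_ij
by its residual in the regression on z_i0 changes the increment by O(σ²) = o(σ). The residuals are
independent of the z_i0, so given the latter the sum is distributed as √(2 y_0) times a single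
Gaussian residual, which inherits the iterated logarithm bound assumed for `η`
(`measure_residual_le_gaussianSquares`). Transferred to `X`, this says that for every ε and all
large n, with probability at least 1 - ε, some mesh increment of `X` is at least (1 - ε)√(2 X(d)) -
ε times the normalization. Borel–Cantelli with ε = 2⁻ⁱ concludes (`ae_le_limsup_of_LILAlongMesh`).
-/

noncomputable section

/-! ### Laplace transforms of measures on the nonnegative orthant -/

section Laplace

variable {ι : Type*} [Fintype ι]

/-- The Laplace transform of a measure on the nonnegative orthant. -/
def laplace (μ : Measure (ι → ℝ≥0)) (s : ι → ℝ≥0) : ℝ≥0∞ :=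
  ∫⁻ x, ENNReal.ofReal (Real.exp (-∑ i, (s i : ℝ) * x i)) ∂μ

/-- `F` is the Laplace transform of an s-finite measure on the nonnegative orthant. -/
def IsLaplace (F : (ι → ℝ≥0) → ℝ≥0∞) : Prop :=
  ∃ μ : Measure (ι → ℝ≥0), SFinite μ ∧ ∀ s, laplace μ s = F s

lemma measurable_laplace_kernel (s : ι → ℝ≥0) :
    Measurable fun x : ι → ℝ≥0 => ENNReal.ofReal (Real.exp (-∑ i, (s i : ℝ) * x i)) := by
  fun_prop

lemma laplace_add (μ ν : Measure (ι → ℝ≥0)) (s : ι → ℝ≥0) :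
    laplace (μ + ν) s = laplace μ s + laplace ν s := lintegral_add_measure _ _ _

lemma laplace_zero_right (μ : Measure (ι → ℝ≥0)) : laplace μ 0 = μ univ := by
  simp [laplace]

lemma laplace_conv (μ ν : Measure (ι → ℝ≥0)) [SFinite μ] [SFinite ν] (s : ι → ℝ≥0) :
    laplace (μ.conv ν) s = laplace μ s * laplace ν s := by
  rw [laplace, Measure.lintegral_conv (measurable_laplace_kernel s)]
  have : ∀ x y : ι → ℝ≥0, ENNReal.ofReal (Real.exp (-∑ i, (s i : ℝ) * (x + y) i)) =
      ENNReal.ofReal (Real.exp (-∑ i, (s i : ℝ) * x i)) *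
        ENNReal.ofReal (Real.exp (-∑ i, (s i : ℝ) * y i)) := by
    intro x y
    rw [← ENNReal.ofReal_mul (Real.exp_pos _).le, ← Real.exp_add]
    congr 2
    simp only [Pi.add_apply, NNReal.coe_add, mul_add, Finset.sum_add_distrib]
    ring
  simp_rw [this]
  simp_rw [lintegral_const_mul _ (measurable_laplace_kernel s)]
  rw [lintegral_mul_const _ (measurable_laplace_kernel s)]
  rfl

namespace IsLaplace

variable {F G : (ι → ℝ≥0) → ℝ≥0∞}

lemma congr (hF : IsLaplace F) (h : ∀ s, F s = G s) : IsLaplace G := by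
  obtain rfl : F = G := funext h
  exact hF

lemma const (c : ℝ≥0∞) : IsLaplace fun _ : ι → ℝ≥0 => c := by
  refine ⟨c • Measure.dirac 0, inferInstance, fun s => ?_⟩
  rw [laplace, lintegral_smul_measure, lintegral_dirac' _ (measurable_laplace_kernel s)]
  simp

lemma add (hF : IsLaplace F) (hG : IsLaplace G) : IsLaplace fun s => F s + G s := by
  obtain ⟨μ, _, hμ⟩ := hF
  obtain ⟨ν, _, hν⟩ := hG
  exact ⟨μ + ν, inferInstance, fun s => by rw [laplace_add, hμ, hν]⟩

lemma mul (hF : IsLaplace F) (hG : IsLaplace G) : IsLaplace fun s => F s * G s := by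
  obtain ⟨μ, _, hμ⟩ := hF
  obtain ⟨ν, _, hν⟩ := hG
  refine ⟨μ.conv ν, ?_, fun s => by rw [laplace_conv, hμ, hν]⟩
  unfold Measure.conv
  infer_instance

lemma pow (hF : IsLaplace F) (n : ℕ) : IsLaplace fun s => F s ^ n := by
  induction n with
  | zero => simpa using const 1
  | succ n ih => simpa [pow_succ] using ih.mul hF

lemma tsum {F : ℕ → (ι → ℝ≥0) → ℝ≥0∞} (hF : ∀ n, IsLaplace (F n)) :
    IsLaplace fun s => ∑' n, F n s := by
  choose μ h hμ using hF
  refine ⟨Measure.sum μ, inferInstance, fun s => ?_⟩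
  rw [laplace, lintegral_sum_measure]
  exact tsum_congr fun n => hμ n s

lemma sum {κ : Type*} (t : Finset κ) {F : κ → (ι → ℝ≥0) → ℝ≥0∞} (hF : ∀ n, IsLaplace (F n)) :
    IsLaplace fun s => ∑ n ∈ t, F n s := by
  classical
  induction t using Finset.induction_on with
  | empty => simpa using const 0
  | insert a t ha ih => simpa [Finset.sum_insert ha] using (hF a).add ih

/-- This is the transform of the density e^{-at} carried by the `i`-th half-axis, the building block
of the Neumann series of (A + S)⁻¹. -/
lemma inv_add_apply [DecidableEq ι] {a : ℝ} (ha : 0 < a) (i : ι) :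
    IsLaplace fun s => ENNReal.ofReal (a + s i)⁻¹ := by
  let e : ℝ → ι → ℝ≥0 := fun t => Pi.single i t.toNNReal
  have he : Measurable e := by
    refine measurable_pi_lambda _ fun j => ?_
    by_cases hj : j = i
    · subst hj
      simpa [e] using measurable_real_toNNReal
    · simp [e, hj]
  refine ⟨((volume.restrict (Ioi 0)).withDensity
    fun t => ENNReal.ofReal (Real.exp (-(a * t)))).map e, inferInstance, fun s => ?_⟩
  rw [laplace, lintegral_map (measurable_laplace_kernel s) he,
    lintegral_withDensity_eq_lintegral_mul _ (by fun_prop)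
      (show Measurable fun t : ℝ => ENNReal.ofReal (Real.exp (-∑ j, (s j : ℝ) * e t j)) from
        (measurable_laplace_kernel s).comp he)]
  have h1 : ∀ t ∈ Ioi (0 : ℝ), ((fun t => ENNReal.ofReal (Real.exp (-(a * t)))) *
      fun t => ENNReal.ofReal (Real.exp (-∑ j, (s j : ℝ) * e t j))) t =
        ENNReal.ofReal (Real.exp (-(a + s i) * t)) := by
    intro t ht
    rw [Pi.mul_apply, ← ENNReal.ofReal_mul (Real.exp_pos _).le, ← Real.exp_add]
    congr 2
    rw [Finset.sum_eq_single i]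
    · simp [e, (mem_Ioi.1 ht).le]
      ring
    · intro j _ hj
      simp [e, hj]
    · simp
  rw [setLIntegral_congr_fun measurableSet_Ioi h1]
  have hpos : 0 < a + (s i : ℝ) := add_pos_of_pos_of_nonneg ha (s i).2
  rw [← ofReal_integral_eq_lintegral_ofReal]
  · congr 1
    have := integral_exp_mul_Ioi (a := -(a + s i)) (by linarith) 0
    simp only [mul_zero, Real.exp_zero] at this
    rw [this]
    field_simp
  · exact integrableOn_exp_mul_Ioi (by linarith) 0
  · exact ae_of_all _ fun t => (Real.exp_pos _).le

end IsLaplace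

/-- The exponential functions `x ↦ exp (-⟨s, x⟩)` as bounded continuous functions. -/
def laplaceBCF (s : ι → ℝ≥0) : BoundedContinuousFunction (ι → ℝ≥0) ℝ :=
  BoundedContinuousFunction.ofNormedAddCommGroup
    (fun x => Real.exp (-∑ i, (s i : ℝ) * x i)) (by fun_prop) 1 fun x => by
      rw [Real.norm_eq_abs, abs_of_pos (Real.exp_pos _), Real.exp_le_one_iff, neg_nonpos]
      exact Finset.sum_nonneg fun i _ => by positivity

lemma laplaceBCF_apply (s x : ι → ℝ≥0) :
    laplaceBCF s x = Real.exp (-∑ i, (s i : ℝ) * x i) := rfl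

/-- The exponential functions form a multiplicative monoid. -/
def laplaceHom : Multiplicative (ι → ℝ≥0) →* BoundedContinuousFunction (ι → ℝ≥0) ℝ where
  toFun s := laplaceBCF s.toAdd
  map_one' := by
    ext x
    simp [laplaceBCF_apply]
  map_mul' s t := by
    ext x
    rw [BoundedContinuousFunction.mul_apply, laplaceBCF_apply, laplaceBCF_apply, laplaceBCF_apply,
      ← Real.exp_add]
    congr 1
    simp only [toAdd_mul, Pi.add_apply, NNReal.coe_add, add_mul, Finset.sum_add_distrib]
    ring

/-- The algebra spanned by the exponential functions. -/
def laplaceAlgebra (ι : Type*) [Fintype ι] :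
    StarSubalgebra ℝ (BoundedContinuousFunction (ι → ℝ≥0) ℝ) where
  toSubalgebra := Algebra.adjoin ℝ (MonoidHom.mrange (laplaceHom (ι := ι)))
  star_mem' {a} ha := by
    have : star a = a := by
      ext x
      simp
    rwa [this]

/-- The exponentials are closed under multiplication, so the algebra they generate is just their
linear span and linearity of the integral suffices. -/
lemma integral_eq_of_mem_laplaceAlgebra {μ ν : Measure (ι → ℝ≥0)} [IsFiniteMeasure μ]
    [IsFiniteMeasure ν] (h : ∀ s : ι → ℝ≥0, laplace μ s = laplace ν s)
    {g : BoundedContinuousFunction (ι → ℝ≥0) ℝ} (hg : g ∈ laplaceAlgebra ι) :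
    ∫ x, g x ∂μ = ∫ x, g x ∂ν := by
  have hg' : g ∈ Subalgebra.toSubmodule
      (Algebra.adjoin ℝ (MonoidHom.mrange (laplaceHom (ι := ι)) :
        Set (BoundedContinuousFunction (ι → ℝ≥0) ℝ))) := hg
  rw [Algebra.adjoin_eq_span, Submonoid.closure_eq] at hg'
  clear hg
  induction hg' using Submodule.span_induction with
  | mem x hx =>
    obtain ⟨s, rfl⟩ := hx
    have key : ∀ ρ : Measure (ι → ℝ≥0),
        ∫ x, laplaceHom s x ∂ρ = (laplace ρ s.toAdd).toReal := fun ρ =>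
      integral_eq_lintegral_of_nonneg_ae (ae_of_all _ fun x => (Real.exp_pos _).le)
        (laplaceHom s).continuous.measurable.aestronglyMeasurable
    rw [key, key, h]
  | zero => simp
  | add x y _ _ hx hy =>
    simp only [BoundedContinuousFunction.coe_add, Pi.add_apply]
    rw [integral_add (x.integrable μ) (y.integrable μ), integral_add (x.integrable ν)
      (y.integrable ν), hx, hy]
  | smul a x _ hx =>
    simp only [BoundedContinuousFunction.coe_smul]
    rw [integral_smul, integral_smul, hx]

/-- A point-separating algebra of bounded continuous functions determines finite measures on a
Polish space. The coordinate exponentials already separate points. -/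
lemma measure_eq_of_laplace_eq_of_nonneg {μ ν : Measure (ι → ℝ≥0)} [IsFiniteMeasure μ]
    [IsFiniteMeasure ν] (h : ∀ s : ι → ℝ≥0, laplace μ s = laplace ν s) : μ = ν := by
  refine ext_of_forall_mem_subalgebra_integral_eq_of_polish (𝕜 := ℝ) (A := laplaceAlgebra ι) ?_
    fun g hg => integral_eq_of_mem_laplaceAlgebra h hg
  intro x y hxy
  obtain ⟨i, hi⟩ := Function.ne_iff.1 hxy
  classical
  have hmem : laplaceBCF (Pi.single i 1) ∈ laplaceAlgebra ι :=
    Algebra.subset_adjoin ⟨Multiplicative.ofAdd (Pi.single i 1), rfl⟩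
  refine ⟨_, ⟨_, ⟨_, hmem, rfl⟩, rfl⟩, ?_⟩
  have key : ∀ z : ι → ℝ≥0, laplaceBCF (Pi.single i 1) z = Real.exp (-z i) := fun z => by
    rw [laplaceBCF_apply, Finset.sum_eq_single i] <;> simp +contextual
  change laplaceBCF (Pi.single i 1) x ≠ laplaceBCF (Pi.single i 1) y
  rw [key, key]
  simpa using hi

/-- Finite measures on the orthant with the same Laplace transform are equal. -/
lemma measure_eq_of_laplace_eq {μ ν : Measure (ι → ℝ≥0)} [IsFiniteMeasure μ] [IsFiniteMeasure ν]
    (h : ∀ s : ι → ℝ≥0, (∀ i, 0 < s i) → laplace μ s = laplace ν s) : μ = ν := by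
  -- Tilting by exp(-Σ x_i) shifts the parameter by 1, so that strictly positive parameters cover
  -- all nonnegative ones. The tilt is undone at the end by the density `w⁻¹`.
  let w : (ι → ℝ≥0) → ℝ≥0∞ := fun x => ENNReal.ofReal (Real.exp (-∑ i, ((1 : ℝ≥0) : ℝ) * x i))
  have hw : Measurable w := measurable_laplace_kernel (fun _ => 1)
  have key : ∀ (ρ : Measure (ι → ℝ≥0)) (s : ι → ℝ≥0),
      laplace (ρ.withDensity w) s = laplace ρ (s + 1) := by
    intro ρ s
    rw [laplace, lintegral_withDensity_eq_lintegral_mul _ hw (measurable_laplace_kernel s)]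
    refine lintegral_congr fun x => ?_
    rw [Pi.mul_apply, ← ENNReal.ofReal_mul (Real.exp_pos _).le, ← Real.exp_add]
    congr 2
    simp only [Pi.add_apply, NNReal.coe_add, Pi.one_apply, add_mul, Finset.sum_add_distrib]
    ring
  have hw1 : ∀ x, w x ≤ 1 := fun x => by
    refine ENNReal.ofReal_le_one.2 (Real.exp_le_one_iff.2 (neg_nonpos.2 ?_))
    exact Finset.sum_nonneg fun i _ => by positivity
  have hfin : ∀ ρ : Measure (ι → ℝ≥0), IsFiniteMeasure ρ → IsFiniteMeasure (ρ.withDensity w) :=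
    fun ρ _ => isFiniteMeasure_withDensity (ne_of_lt (lt_of_le_of_lt
      (lintegral_mono hw1) (by simp)))
  have := hfin μ inferInstance
  have := hfin ν inferInstance
  have heq : μ.withDensity w = ν.withDensity w :=
    measure_eq_of_laplace_eq_of_nonneg fun s => by
      rw [key, key]
      exact h _ fun i => by simp
  have hw0 : ∀ x, w x ≠ 0 := fun x => by simp [w, Real.exp_pos]
  have hinv : ∀ ρ : Measure (ι → ℝ≥0), (ρ.withDensity w).withDensity w⁻¹ = ρ := fun ρ =>
    withDensity_inv_same hw (ae_of_all _ hw0) (ae_of_all _ fun x => ENNReal.ofReal_ne_top)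
  rw [← hinv μ, ← hinv ν, heq]

/-- The binomial series with negative exponent has nonnegative coefficients. -/
lemma exists_binomial_series {α : ℝ} (hα : 0 < α) :
    ∃ c : ℕ → ℝ, (∀ n, 0 ≤ c n) ∧ c 0 = 1 ∧
      ∀ z : ℝ, 0 ≤ z → z < 1 → HasSum (fun n => c n * z ^ n) ((1 - z) ^ (-α)) := by
  -- The coefficient is α(α + 1)⋯(α + n - 1) / n!, which is nonnegative because α > 0.
  refine ⟨fun n => Ring.choose (α + n - 1) n, fun n => ?_, by simp, fun z hz hz1 => ?_⟩
  · have h1 := Ring.factorial_nsmul_multichoose_eq_ascPochhammer α n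
    rw [Polynomial.ascPochhammer_smeval_eq_eval, Ring.multichoose_eq, nsmul_eq_mul] at h1
    have h2 := ascPochhammer_pos n α hα
    rw [← h1] at h2
    exact (pos_of_mul_pos_right h2 (by positivity)).le
  · have := (Real.one_div_one_sub_rpow_hasFPowerSeriesOnBall_zero α).hasSum (y := z) ?_
    · simpa [FormalMultilinearSeries.ofScalars_apply_eq, mul_comm,
        Real.rpow_neg (by linarith : 0 ≤ 1 - z)] using this
    · simpa [enorm_eq_nnnorm, ← NNReal.coe_lt_coe, abs_of_nonneg hz] using hz1

end Laplace

end

noncomputable section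

/-! ### Inverse M-matrices and their resolvents -/

section MMatrix

open Matrix

variable {ι : Type*} [Fintype ι] [DecidableEq ι]

/-- `A` is the inverse of the symmetric entrywise nonnegative matrix `U`, the off-diagonal entries
of `A` are nonpositive, and the matrices `1 + U S` are nonsingular. -/
structure IsInverseMPair (U A : Matrix ι ι ℝ) : Prop where
  mul_eq_one : A * U = 1
  symm : U.IsSymm
  nonneg : ∀ i j, 0 ≤ U i j
  off_diag : ∀ i j, i ≠ j → A i j ≤ 0
  det_pos : ∀ s : ι → ℝ≥0, 0 < (1 + U * diagonal fun i => (s i : ℝ)).det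

namespace IsInverseMPair

variable {U A : Matrix ι ι ℝ} (h : IsInverseMPair U A)
include h

lemma mul_eq_one' : U * A = 1 := mul_eq_one_comm.1 h.mul_eq_one

lemma symm_inv : A.IsSymm := by
  have h1 : Aᵀ * U = 1 := by
    have := congrArg transpose h.mul_eq_one'
    rwa [transpose_mul, h.symm.eq, transpose_one] at this
  calc Aᵀ = Aᵀ * (U * A) := by rw [h.mul_eq_one', mul_one]
    _ = A := by rw [← mul_assoc, h1, one_mul]

/-- In 1 = Σ_j A_ij U_ji the off-diagonal terms are nonpositive, so the diagonal term has to be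
positive. -/
lemma diag_pos (i : ι) : 0 < A i i := by
  have h1 : ∑ j, A i j * U j i = 1 := by
    have := congrFun (congrFun h.mul_eq_one i) i
    simpa [mul_apply] using this
  by_contra hneg
  have : ∑ j, A i j * U j i ≤ 0 := Finset.sum_nonpos fun j _ => by
    by_cases hij : i = j
    · subst hij
      exact mul_nonpos_of_nonpos_of_nonneg (not_lt.1 hneg) (h.nonneg _ _)
    · exact mul_nonpos_of_nonpos_of_nonneg (h.off_diag _ _ hij) (h.nonneg _ _)
  linarith

lemma add_diagonal_det_pos_mul (s : ι → ℝ≥0) :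
    1 + U * diagonal (fun i => (s i : ℝ)) = U * (A + diagonal fun i => (s i : ℝ)) := by
  rw [mul_add, h.mul_eq_one']

lemma isUnit_det_add (s : ι → ℝ≥0) : IsUnit (A + diagonal fun i => (s i : ℝ)).det := by
  have h1 := h.det_pos s
  rw [h.add_diagonal_det_pos_mul, det_mul] at h1
  exact isUnit_iff_ne_zero.2 (right_ne_zero_of_mul h1.ne')

end IsInverseMPair

omit [DecidableEq ι] in
lemma mulEntry_nonneg {P Q : Matrix ι ι ℝ} (hP : ∀ i j, 0 ≤ P i j) (hQ : ∀ i j, 0 ≤ Q i j)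
    (i j : ι) : 0 ≤ (P * Q) i j := by
  rw [mul_apply]
  exact Finset.sum_nonneg fun l _ => mul_nonneg (hP _ _) (hQ _ _)

/-- The `n`-th term of the Neumann series of `(A + diag s)⁻¹`. -/
def neumannTerm (A : Matrix ι ι ℝ) (s : ι → ℝ≥0) (n : ℕ) : Matrix ι ι ℝ :=
  (diagonal (fun i => (A i i + s i)⁻¹) * (diagonal (fun i => A i i) - A)) ^ n *
    diagonal (fun i => (A i i + s i)⁻¹)

namespace IsInverseMPair

variable {U A : Matrix ι ι ℝ} (h : IsInverseMPair U A)
include h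

lemma offDiag_nonneg (i j : ι) : 0 ≤ (diagonal (fun i => A i i) - A) i j := by
  by_cases hij : i = j
  · subst hij
    simp
  · simpa [hij] using h.off_diag i j hij

lemma diagInv_nonneg (s : ι → ℝ≥0) (i j : ι) : 0 ≤ diagonal (fun i => (A i i + s i)⁻¹) i j := by
  by_cases hij : i = j
  · subst hij
    have := h.diag_pos i
    simp only [diagonal_apply_eq]
    positivity
  · simp [hij]

lemma neumannPow_nonneg (s : ι → ℝ≥0) (n : ℕ) (i j : ι) :
    0 ≤ ((diagonal (fun i => (A i i + s i)⁻¹) * (diagonal (fun i => A i i) - A)) ^ n) i j := by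
  induction n generalizing i j with
  | zero => by_cases hij : i = j <;> simp [hij, one_apply]
  | succ n ih =>
    rw [pow_succ]
    exact mulEntry_nonneg ih (mulEntry_nonneg (h.diagInv_nonneg s) h.offDiag_nonneg) i j

lemma neumannTerm_nonneg (s : ι → ℝ≥0) (n : ℕ) (i j : ι) : 0 ≤ neumannTerm A s n i j :=
  mulEntry_nonneg (h.neumannPow_nonneg s n) (h.diagInv_nonneg s) i j

/-- The telescoped Neumann series. -/
lemma add_diagonal_mul_sum (s : ι → ℝ≥0) (N : ℕ) :
    (A + diagonal fun i => (s i : ℝ)) * ∑ n ∈ Finset.range N, neumannTerm A s n =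
      1 - diagonal (fun i => A i i + s i) * neumannTerm A s N := by
  have hDR : diagonal (fun i => A i i + (s i : ℝ)) * diagonal (fun i => (A i i + s i)⁻¹) = 1 := by
    rw [diagonal_mul_diagonal, ← diagonal_one]
    congr 1
    ext i
    have := h.diag_pos i
    exact mul_inv_cancel₀ (by positivity)
  set R := diagonal (fun i => (A i i + (s i : ℝ))⁻¹) with hR
  set D := diagonal (fun i => A i i + (s i : ℝ)) with hD
  set B := diagonal (fun i => A i i) - A with hB
  -- With `D = diag(A_ii + s_i)`, `R = D⁻¹` and `B ≥ 0` the negated off-diagonal part of `A`, the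
  -- matrix factors as D(1 - RB) and the sum is geometric.
  have hA : A + diagonal (fun i => (s i : ℝ)) = D * (1 - R * B) := by
    rw [mul_sub, ← mul_assoc, hDR, hB, hD, mul_one, one_mul, ← diagonal_add]
    abel
  have hsum : ∑ n ∈ Finset.range N, neumannTerm A s n =
      (∑ n ∈ Finset.range N, (R * B) ^ n) * R := by
    rw [Finset.sum_mul]
    rfl
  rw [hA, hsum, mul_assoc, ← mul_assoc (1 - R * B), mul_neg_geom_sum, sub_mul, mul_sub, one_mul,
    hDR]
  rfl

/-- No spectral radius is needed. Multiplying the telescoped series by `U` gives (1 + U S) V = U - U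
D T_N, and every matrix involved is entrywise nonnegative, so V ≤ U. -/
lemma sum_neumannTerm_le (s : ι → ℝ≥0) (N : ℕ) (i j : ι) :
    (∑ n ∈ Finset.range N, neumannTerm A s n) i j ≤ U i j := by
  set V := ∑ n ∈ Finset.range N, neumannTerm A s n with hV
  have hV0 : ∀ i j, 0 ≤ V i j := fun i j => by
    rw [hV, Matrix.sum_apply]
    exact Finset.sum_nonneg fun n _ => h.neumannTerm_nonneg s n i j
  have h1 : (1 + U * diagonal fun i => (s i : ℝ)) * V =
      U - U * (diagonal (fun i => A i i + s i) * neumannTerm A s N) := by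
    rw [h.add_diagonal_det_pos_mul, mul_assoc, h.add_diagonal_mul_sum, mul_sub, mul_one]
  have h2 := congrFun (congrFun h1 i) j
  rw [add_mul, one_mul, Matrix.add_apply, Matrix.sub_apply] at h2
  have hdiag : ∀ (c : ι → ℝ), (∀ i, 0 ≤ c i) → ∀ i j, 0 ≤ diagonal c i j := by
    intro c hc i j
    by_cases hij : i = j
    · subst hij
      simpa using hc i
    · simp [hij]
  have h3 : 0 ≤ (U * (diagonal fun i => (s i : ℝ)) * V) i j :=
    mulEntry_nonneg (mulEntry_nonneg h.nonneg (hdiag _ fun i => (s i).2)) hV0 i j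
  have h4 : 0 ≤ (U * (diagonal (fun i => A i i + (s i : ℝ)) * neumannTerm A s N)) i j :=
    mulEntry_nonneg h.nonneg (mulEntry_nonneg
      (hdiag _ fun i => add_nonneg (h.diag_pos i).le (s i).2) (h.neumannTerm_nonneg s N)) i j
  linarith

lemma summable_neumannTerm (s : ι → ℝ≥0) (i j : ι) :
    Summable fun n => neumannTerm A s n i j :=
  summable_of_sum_range_le (fun n => h.neumannTerm_nonneg s n i j) (c := U i j) fun N => by
    simpa [Matrix.sum_apply] using h.sum_neumannTerm_le s N i j

/-- Summability, obtained from the bound by `U`, forces the remainder in the telescoped identity to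
vanish. -/
lemma hasSum_neumannTerm (s : ι → ℝ≥0) (i j : ι) :
    HasSum (fun n => neumannTerm A s n i j) ((A + diagonal fun i => (s i : ℝ))⁻¹ i j) := by
  have hlim : Tendsto (fun N => neumannTerm A s N) atTop (𝓝 0) :=
    tendsto_pi_nhds.2 fun i => tendsto_pi_nhds.2 fun j =>
      (h.summable_neumannTerm s i j).tendsto_atTop_zero
  have hEq : ∀ N, ∑ n ∈ Finset.range N, neumannTerm A s n =
      (A + diagonal fun i => (s i : ℝ))⁻¹ *
        (1 - diagonal (fun i => A i i + s i) * neumannTerm A s N) := fun N => by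
    rw [← h.add_diagonal_mul_sum, ← mul_assoc, nonsing_inv_mul _ (h.isUnit_det_add s), one_mul]
  have hlim2 : Tendsto (fun N => ∑ n ∈ Finset.range N, neumannTerm A s n) atTop
      (𝓝 ((A + diagonal fun i => (s i : ℝ))⁻¹)) := by
    simp_rw [hEq]
    have : Continuous fun Q : Matrix ι ι ℝ => (A + diagonal fun i => (s i : ℝ))⁻¹ *
        (1 - diagonal (fun i => A i i + (s i : ℝ)) * Q) := by fun_prop
    simpa [Function.comp_def] using (this.tendsto 0).comp hlim
  rw [(h.summable_neumannTerm s i j).hasSum_iff_tendsto_nat]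
  have := (tendsto_pi_nhds.1 (tendsto_pi_nhds.1 hlim2 i)) j
  simpa [Matrix.sum_apply] using this

lemma resolvent_nonneg (s : ι → ℝ≥0) (i j : ι) :
    0 ≤ (A + diagonal fun i => (s i : ℝ))⁻¹ i j :=
  (h.hasSum_neumannTerm s i j).nonneg fun n => h.neumannTerm_nonneg s n i j

lemma resolvent_le (s : ι → ℝ≥0) (i j : ι) :
    (A + diagonal fun i => (s i : ℝ))⁻¹ i j ≤ U i j := by
  refine le_of_tendsto (h.hasSum_neumannTerm s i j).tendsto_sum_nat (Eventually.of_forall fun N => ?_)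
  simpa [Matrix.sum_apply] using h.sum_neumannTerm_le s N i j

lemma isLaplace_diagInv (i j : ι) :
    IsLaplace fun s : ι → ℝ≥0 => ENNReal.ofReal (diagonal (fun i => (A i i + (s i : ℝ))⁻¹) i j) := by
  by_cases hij : i = j
  · subst hij
    simpa using IsLaplace.inv_add_apply (h.diag_pos i) i
  · simpa [hij] using IsLaplace.const 0

omit h [DecidableEq ι] in
lemma _root_.IsLaplace.matrix_mul {P Q : (ι → ℝ≥0) → Matrix ι ι ℝ}
    (hP0 : ∀ s i j, 0 ≤ P s i j) (hQ0 : ∀ s i j, 0 ≤ Q s i j)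
    (hP : ∀ i j, IsLaplace fun s => ENNReal.ofReal (P s i j))
    (hQ : ∀ i j, IsLaplace fun s => ENNReal.ofReal (Q s i j)) (i j : ι) :
    IsLaplace fun s => ENNReal.ofReal ((P s * Q s) i j) := by
  refine (IsLaplace.sum Finset.univ fun l => (hP i l).mul (hQ l j)).congr fun s => ?_
  rw [mul_apply, ENNReal.ofReal_sum_of_nonneg fun l _ => mul_nonneg (hP0 _ _ _) (hQ0 _ _ _)]
  exact Finset.sum_congr rfl fun l _ => (ENNReal.ofReal_mul (hP0 _ _ _)).symm

lemma isLaplace_neumannTerm (n : ℕ) (i j : ι) :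
    IsLaplace fun s : ι → ℝ≥0 => ENNReal.ofReal (neumannTerm A s n i j) := by
  refine IsLaplace.matrix_mul (fun s => h.neumannPow_nonneg s n) h.diagInv_nonneg ?_
    h.isLaplace_diagInv i j
  induction n with
  | zero => exact fun i j => by simpa using IsLaplace.const _
  | succ n ih =>
    simp_rw [pow_succ]
    exact IsLaplace.matrix_mul (fun s => h.neumannPow_nonneg s n)
      (fun s => mulEntry_nonneg (h.diagInv_nonneg s) h.offDiag_nonneg) ih
      (IsLaplace.matrix_mul h.diagInv_nonneg (fun _ => h.offDiag_nonneg) h.isLaplace_diagInv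
        fun i j => IsLaplace.const _)

/-- Each Neumann term is built by sums and products from the transforms (A_ii + s_i)⁻¹ and
nonnegative constants. -/
lemma isLaplace_resolvent (i j : ι) :
    IsLaplace fun s : ι → ℝ≥0 => ENNReal.ofReal ((A + diagonal fun i => (s i : ℝ))⁻¹ i j) :=
  (IsLaplace.tsum fun n => h.isLaplace_neumannTerm n i j).congr fun s => by
    rw [← (h.hasSum_neumannTerm s i j).tsum_eq, ENNReal.ofReal_tsum_of_nonneg
      (fun n => h.neumannTerm_nonneg s n i j) (h.summable_neumannTerm s i j)]

end IsInverseMPair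

end MMatrix

end

noncomputable section

/-! ### Comparison of permanental laws whose kernels are rank one perturbations -/

section Comparison

open Matrix

variable {ι : Type*} [Fintype ι]

/-- The binomial series of (1 - Q)^{-α} has constant term 1 and nonnegative coefficients, and powers
of transforms are transforms of convolutions. -/
lemma IsLaplace.one_sub_rpow_neg {Q : (ι → ℝ≥0) → ℝ} (hQ : IsLaplace fun s => ENNReal.ofReal (Q s))
    (h0 : ∀ s, 0 ≤ Q s) (h1 : ∀ s, Q s < 1) {α : ℝ} (hα : 0 < α) :
    ∃ H, IsLaplace H ∧ ∀ s, ENNReal.ofReal ((1 - Q s) ^ (-α)) = 1 + H s := by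
  obtain ⟨c, hc, hc0, hsum⟩ := exists_binomial_series hα
  refine ⟨fun s => ∑' n, ENNReal.ofReal (c (n + 1)) * ENNReal.ofReal (Q s) ^ (n + 1),
    IsLaplace.tsum fun n => (IsLaplace.const _).mul (hQ.pow _), fun s => ?_⟩
  have hs := hsum (Q s) (h0 s) (h1 s)
  rw [← hs.tsum_eq, ENNReal.ofReal_tsum_of_nonneg
    (fun n => mul_nonneg (hc n) (pow_nonneg (h0 s) n)) hs.summable,
    tsum_eq_zero_add' ENNReal.summable]
  congr 1
  · simp [hc0]
  · exact tsum_congr fun n => by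
      rw [ENNReal.ofReal_mul (hc _), ENNReal.ofReal_pow (h0 s)]

lemma IsLaplace.const_sub_rpow_neg {L : (ι → ℝ≥0) → ℝ}
    (hL : IsLaplace fun s => ENNReal.ofReal (L s)) {C : ℝ} (hC : 0 < C)
    (h0 : ∀ s, 0 ≤ L s) (h1 : ∀ s, L s < C) {α : ℝ} (hα : 0 < α) :
    IsLaplace fun s => ENNReal.ofReal ((C - L s) ^ (-α)) := by
  have hQ : IsLaplace fun s => ENNReal.ofReal (C⁻¹ * L s) :=
    ((IsLaplace.const (ENNReal.ofReal C⁻¹)).mul hL).congr fun s =>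
      (ENNReal.ofReal_mul (by positivity)).symm
  have hQ1 : ∀ s, C⁻¹ * L s < 1 := fun s => by
    rw [inv_mul_lt_iff₀ hC]
    simpa using h1 s
  obtain ⟨H, hH, hHs⟩ := hQ.one_sub_rpow_neg (fun s => mul_nonneg (by positivity) (h0 s)) hQ1 hα
  refine ((IsLaplace.const (ENNReal.ofReal (C ^ (-α)))).mul ((IsLaplace.const 1).add hH)).congr
    fun s => ?_
  rw [← hHs, ← ENNReal.ofReal_mul (by positivity), ← Real.mul_rpow hC.le (by linarith [hQ1 s])]
  congr 2
  field_simp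

/-- If `M` and `R` come from nonnegative measures, so does `(M - R) ^ (-α) - M ^ (-α)`. -/
lemma IsLaplace.sub_rpow_neg_sub {M R : (ι → ℝ≥0) → ℝ}
    (hM : ∀ β : ℝ, 0 < β → IsLaplace fun s => ENNReal.ofReal (M s ^ (-β)))
    (hR : IsLaplace fun s => ENNReal.ofReal (R s))
    (h0 : ∀ s, 0 ≤ R s) (h1 : ∀ s, R s < M s) {α : ℝ} (hα : 0 < α) :
    ∃ H, IsLaplace H ∧
      ∀ s, ENNReal.ofReal ((M s - R s) ^ (-α)) = ENNReal.ofReal (M s ^ (-α)) + H s := by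
  have hMpos : ∀ s, 0 < M s := fun s => (h0 s).trans_lt (h1 s)
  -- The hypothesis on `M` is used at exponent 1 here and at exponent α below: M - R = M(1 - R/M),
  -- where R/M is a product of two transforms.
  have hQ : IsLaplace fun s => ENNReal.ofReal (R s / M s) :=
    (hR.mul (hM 1 one_pos)).congr fun s => by
      rw [← ENNReal.ofReal_mul (h0 s), Real.rpow_neg_one, div_eq_mul_inv]
  have hQ1 : ∀ s, R s / M s < 1 := fun s => (div_lt_one (hMpos s)).2 (h1 s)
  obtain ⟨H, hH, hHs⟩ := hQ.one_sub_rpow_neg (fun s => div_nonneg (h0 s) (hMpos s).le) hQ1 hα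
  refine ⟨fun s => ENNReal.ofReal (M s ^ (-α)) * H s, (hM α hα).mul hH, fun s => ?_⟩
  have : M s - R s = M s * (1 - R s / M s) := by
    have := (hMpos s).ne'
    field_simp
  rw [this, Real.mul_rpow (hMpos s).le (by linarith [hQ1 s]), ENNReal.ofReal_mul
    (Real.rpow_nonneg (hMpos s).le _), hHs, mul_add, mul_one]

/-- The pairing of two square matrices. -/
def entryPairing (κ Q : Matrix ι ι ℝ) : ℝ := ∑ i, ∑ j, κ i j * Q i j

lemma entryPairing_mono {κ κ' Q Q' : Matrix ι ι ℝ} (hκ : ∀ i j, 0 ≤ κ i j)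
    (hκκ' : ∀ i j, κ i j ≤ κ' i j) (hQ : ∀ i j, 0 ≤ Q i j) (hQQ' : ∀ i j, Q i j ≤ Q' i j) :
    entryPairing κ Q ≤ entryPairing κ' Q' :=
  Finset.sum_le_sum fun i _ => Finset.sum_le_sum fun j _ =>
    mul_le_mul (hκκ' i j) (hQQ' i j) (hQ i j) ((hκ i j).trans (hκκ' i j))

lemma entryPairing_nonneg {κ Q : Matrix ι ι ℝ} (hκ : ∀ i j, 0 ≤ κ i j) (hQ : ∀ i j, 0 ≤ Q i j) :
    0 ≤ entryPairing κ Q :=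
  Finset.sum_nonneg fun i _ => Finset.sum_nonneg fun j _ => mul_nonneg (hκ i j) (hQ i j)

lemma entryPairing_sub_left (κ κ' Q : Matrix ι ι ℝ) :
    entryPairing (κ - κ') Q = entryPairing κ Q - entryPairing κ' Q := by
  simp [entryPairing, sub_mul, Finset.sum_sub_distrib]

lemma entryPairing_vecMulVec (a b : ι → ℝ) (Q : Matrix ι ι ℝ) :
    entryPairing (vecMulVec a b) Q = a ⬝ᵥ Q *ᵥ b := by
  simp only [entryPairing, vecMulVec_apply, dotProduct, mulVec, Finset.mul_sum]
  exact Finset.sum_congr rfl fun i _ => Finset.sum_congr rfl fun j _ => by ring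

variable [DecidableEq ι]

namespace IsInverseMPair

variable {U A : Matrix ι ι ℝ} (h : IsInverseMPair U A)
include h

lemma isLaplace_entryPairing {κ : Matrix ι ι ℝ} (hκ : ∀ i j, 0 ≤ κ i j) :
    IsLaplace fun s : ι → ℝ≥0 =>
      ENNReal.ofReal (entryPairing κ (A + diagonal fun i => (s i : ℝ))⁻¹) := by
  refine (IsLaplace.sum Finset.univ fun i => IsLaplace.sum Finset.univ fun j =>
    (IsLaplace.const (ENNReal.ofReal (κ i j))).mul (h.isLaplace_resolvent i j)).congr fun s => ?_
  have h0 : ∀ i j, 0 ≤ κ i j * (A + diagonal fun i => (s i : ℝ))⁻¹ i j := fun i j =>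
    mul_nonneg (hκ i j) (h.resolvent_nonneg s i j)
  rw [entryPairing, ENNReal.ofReal_sum_of_nonneg fun i _ => Finset.sum_nonneg fun j _ => h0 i j]
  refine Finset.sum_congr rfl fun i _ => ?_
  rw [ENNReal.ofReal_sum_of_nonneg fun j _ => h0 i j]
  exact Finset.sum_congr rfl fun j _ => (ENNReal.ofReal_mul (hκ i j)).symm

/-- The determinant of a rank one perturbation of `1 + U S`. -/
lemma det_rank_one (a b : ι → ℝ) (s : ι → ℝ≥0) :
    (1 + (U + Matrix.of fun i j => (U *ᵥ b) i * (U *ᵥ a) j) * diagonal fun i => (s i : ℝ)).det =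
      (1 + U * diagonal fun i => (s i : ℝ)).det *
        (1 + a ⬝ᵥ U *ᵥ b - a ⬝ᵥ (A + diagonal fun i => (s i : ℝ))⁻¹ *ᵥ b) := by
  set S : Matrix ι ι ℝ := diagonal fun i => (s i : ℝ) with hS
  set G := (A + S)⁻¹ with hG
  have hU := h.isUnit_det_add s
  have hQ : IsUnit (1 + U * S).det := isUnit_iff_ne_zero.2 (h.det_pos s).ne'
  have hQinv : (1 + U * S)⁻¹ = G * A := by
    refine inv_eq_right_inv ?_
    rw [h.add_diagonal_det_pos_mul, mul_assoc, ← mul_assoc (A + S), hG, mul_nonsing_inv _ hU,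
      one_mul, h.mul_eq_one']
  have hsplit : 1 + (U + Matrix.of fun i j => (U *ᵥ b) i * (U *ᵥ a) j) * S =
      (1 + U * S) + replicateCol Unit (U *ᵥ b) * replicateRow Unit (S *ᵥ (U *ᵥ a)) := by
    rw [add_mul, add_assoc]
    congr 2
    generalize U *ᵥ a = f
    generalize U *ᵥ b = g
    ext i j
    simp [hS, mul_apply, mulVec_diagonal, diagonal_apply]
    ring
  -- By the matrix determinant lemma it remains to see that (S U a)·(G b) = a·U b - a·G b. Moving
  -- `S` across and writing S G b = b - A G b gives this.
  rw [hsplit, det_add_replicateCol_mul_replicateRow hQ, hQinv]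
  congr 1
  rw [det_unique, Matrix.add_apply, Matrix.one_apply_eq, add_sub_assoc]
  congr 1
  have h1 : (replicateRow Unit (S *ᵥ (U *ᵥ a)) * (G * A) * replicateCol Unit (U *ᵥ b) :
      Matrix Unit Unit ℝ) default default = (S *ᵥ (U *ᵥ a)) ⬝ᵥ (G *ᵥ b) := by
    rw [Matrix.mul_assoc, ← replicateCol_mulVec, mulVec_mulVec b, mul_assoc G, h.mul_eq_one, mul_one]
    rfl
  rw [h1]
  have h2 : S *ᵥ (G *ᵥ b) = b - A *ᵥ (G *ᵥ b) := by
    have : (A + S) *ᵥ (G *ᵥ b) = b := by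
      rw [mulVec_mulVec, hG, mul_nonsing_inv _ hU, one_mulVec]
    rw [add_mulVec] at this
    rw [eq_sub_iff_add_eq, add_comm, this]
  have hsymm : ∀ (Q : Matrix ι ι ℝ), Q.IsSymm → ∀ v w, (Q *ᵥ v) ⬝ᵥ w = v ⬝ᵥ (Q *ᵥ w) := by
    intro Q hQ v w
    rw [dotProduct_mulVec, ← mulVec_transpose, hQ.eq]
  rw [hsymm S (by rw [hS]; exact diagonal_transpose _), h2, dotProduct_sub, hsymm U h.symm,
    hsymm U h.symm, mulVec_mulVec, h.mul_eq_one', one_mulVec]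

/-- Since (A + S)⁻¹ ≤ U entrywise, the second factor in `det_rank_one` is at least 1. -/
lemma det_rank_one_pos {a b : ι → ℝ} (ha : ∀ i, 0 ≤ a i) (hb : ∀ i, 0 ≤ b i) (s : ι → ℝ≥0) :
    0 < (1 + (U + Matrix.of fun i j => (U *ᵥ b) i * (U *ᵥ a) j) *
      diagonal fun i => (s i : ℝ)).det := by
  rw [h.det_rank_one]
  refine mul_pos (h.det_pos s) ?_
  have := entryPairing_mono (κ := vecMulVec a b) (κ' := vecMulVec a b)
    (fun i j => mul_nonneg (ha i) (hb j)) (fun i j => le_rfl) (h.resolvent_nonneg s)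
    (h.resolvent_le s)
  rw [entryPairing_vecMulVec, entryPairing_vecMulVec] at this
  linarith

/-- A common lower bound for the laws of two permanental vectors whose kernels are rank one
perturbations of the same matrix. -/
theorem measure_le_add_of_laplace {α : ℝ} (hα : 0 < α)
    (hD : IsLaplace fun s : ι → ℝ≥0 =>
      ENNReal.ofReal ((1 + U * diagonal fun i => (s i : ℝ)).det ^ (-α)))
    {a b a' b' : ι → ℝ} (ha : ∀ i, 0 ≤ a i) (hb : ∀ i, 0 ≤ b i) (ha' : ∀ i, 0 ≤ a' i)
    (hb' : ∀ i, 0 ≤ b' i) {μ μ' : Measure (ι → ℝ≥0)} [IsProbabilityMeasure μ]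
    [IsProbabilityMeasure μ']
    (hμ : ∀ s : ι → ℝ≥0, (∀ i, 0 < s i) → laplace μ s = ENNReal.ofReal
      ((1 + (U + Matrix.of fun i j => (U *ᵥ b) i * (U *ᵥ a) j) *
        diagonal fun i => (s i : ℝ)).det ^ (-α)))
    (hμ' : ∀ s : ι → ℝ≥0, (∀ i, 0 < s i) → laplace μ' s = ENNReal.ofReal
      ((1 + (U + Matrix.of fun i j => (U *ᵥ b') i * (U *ᵥ a') j) *
        diagonal fun i => (s i : ℝ)).det ^ (-α)))
    (B : Set (ι → ℝ≥0)) :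
    μ B ≤ μ' B + ENNReal.ofReal
      (1 - (1 + ∑ i, ∑ j, |a i * b j - a' i * b' j| * U i j) ^ (-α)) := by
  set err := ∑ i, ∑ j, |a i * b j - a' i * b' j| * U i j with herr
  -- The smaller charge matrix `κ` and the larger constant `C` give M = C - ⟨κ, G⟩. The rank one
  -- factor of either determinant is M - R with R a Laplace transform, so both laws contain the
  -- measure with transform det(1 + U S)^{-α} M^{-α}.
  set κ : Matrix ι ι ℝ := Matrix.of fun i j => min (a i * b j) (a' i * b' j) with hκ
  let G : (ι → ℝ≥0) → Matrix ι ι ℝ := fun s => (A + diagonal fun i => (s i : ℝ))⁻¹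
  have hG0 : ∀ s i j, 0 ≤ G s i j := h.resolvent_nonneg
  have hGU : ∀ s i j, G s i j ≤ U i j := h.resolvent_le
  have hκ0 : ∀ i j, 0 ≤ κ i j := fun i j =>
    le_min (mul_nonneg (ha i) (hb j)) (mul_nonneg (ha' i) (hb' j))
  set C := 1 + max (a ⬝ᵥ U *ᵥ b) (a' ⬝ᵥ U *ᵥ b') with hC
  let M : (ι → ℝ≥0) → ℝ := fun s => C - entryPairing κ (G s)
  have hκL : ∀ s, 0 ≤ entryPairing κ (G s) := fun s => entryPairing_nonneg hκ0 (hG0 s)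
  have hκU : entryPairing κ U ≤ a ⬝ᵥ U *ᵥ b := by
    rw [← entryPairing_vecMulVec]
    exact entryPairing_mono hκ0 (fun i j => min_le_left _ _) h.nonneg fun _ _ => le_rfl
  have hκC : ∀ s, entryPairing κ (G s) < C := fun s => by
    have h1 : entryPairing κ (G s) ≤ entryPairing κ U :=
      entryPairing_mono hκ0 (fun _ _ => le_rfl) (hG0 s) (hGU s)
    have := le_max_left (a ⬝ᵥ U *ᵥ b) (a' ⬝ᵥ U *ᵥ b')
    rw [hC]
    linarith
  have hM : ∀ β : ℝ, 0 < β → IsLaplace fun s => ENNReal.ofReal (M s ^ (-β)) := fun β hβ =>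
    (h.isLaplace_entryPairing hκ0).const_sub_rpow_neg ((hκL 0).trans_lt (hκC 0)) hκL hκC hβ
  have key : ∀ (a₁ b₁ : ι → ℝ), (∀ i, 0 ≤ a₁ i) → (∀ i, 0 ≤ b₁ i) →
      (∀ i j, κ i j ≤ a₁ i * b₁ j) → 1 + a₁ ⬝ᵥ U *ᵥ b₁ ≤ C → ∃ H, IsLaplace H ∧ ∀ s : ι → ℝ≥0,
        ENNReal.ofReal ((1 + (U + Matrix.of fun i j => (U *ᵥ b₁) i * (U *ᵥ a₁) j) *
          diagonal fun i => (s i : ℝ)).det ^ (-α)) =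
        ENNReal.ofReal ((1 + U * diagonal fun i => (s i : ℝ)).det ^ (-α)) *
          ENNReal.ofReal (M s ^ (-α)) + H s := by
    intro a₁ b₁ ha₁ hb₁ hle hCle
    let R : (ι → ℝ≥0) → ℝ := fun s =>
      (C - 1 - a₁ ⬝ᵥ U *ᵥ b₁) + entryPairing (vecMulVec a₁ b₁ - κ) (G s)
    have hdiff : ∀ i j, 0 ≤ (vecMulVec a₁ b₁ - κ) i j := fun i j => by
      simpa [vecMulVec_apply] using hle i j
    have hF : ∀ s, M s - R s = 1 + a₁ ⬝ᵥ U *ᵥ b₁ - a₁ ⬝ᵥ G s *ᵥ b₁ := fun s => by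
      simp only [M, R, entryPairing_sub_left, entryPairing_vecMulVec]
      ring
    have hF1 : ∀ s, 1 ≤ M s - R s := fun s => by
      rw [hF, ← entryPairing_vecMulVec, ← entryPairing_vecMulVec]
      have := entryPairing_mono (κ := vecMulVec a₁ b₁) (fun i j => by
        simpa [vecMulVec_apply] using mul_nonneg (ha₁ i) (hb₁ j)) (fun _ _ => le_rfl)
        (hG0 s) (hGU s)
      linarith
    have hR0 : ∀ s, 0 ≤ R s := fun s =>
      add_nonneg (by linarith) (entryPairing_nonneg hdiff (hG0 s))
    have hR : IsLaplace fun s => ENNReal.ofReal (R s) :=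
      ((IsLaplace.const (ENNReal.ofReal (C - 1 - a₁ ⬝ᵥ U *ᵥ b₁))).add
        (h.isLaplace_entryPairing hdiff)).congr fun s =>
          (ENNReal.ofReal_add (by linarith) (entryPairing_nonneg hdiff (hG0 s))).symm
    obtain ⟨H, hH, hHs⟩ := IsLaplace.sub_rpow_neg_sub hM hR hR0
      (fun s => by linarith [hF1 s]) hα
    refine ⟨fun s => ENNReal.ofReal ((1 + U * diagonal fun i => (s i : ℝ)).det ^ (-α)) * H s,
      hD.mul hH, fun s => ?_⟩
    rw [h.det_rank_one, Real.mul_rpow (h.det_pos s).le, ENNReal.ofReal_mul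
      (Real.rpow_nonneg (h.det_pos s).le _), ← mul_add, ← hHs, hF]
    linarith [hF s, hF1 s]
  obtain ⟨H, hH, hHs⟩ := key a b ha hb (fun i j => min_le_left _ _)
    (by linarith [le_max_left (a ⬝ᵥ U *ᵥ b) (a' ⬝ᵥ U *ᵥ b')])
  obtain ⟨H', hH', hHs'⟩ := key a' b' ha' hb' (fun i j => min_le_right _ _)
    (by linarith [le_max_right (a ⬝ᵥ U *ᵥ b) (a' ⬝ᵥ U *ᵥ b')])
  obtain ⟨ρ, _, hρ⟩ := hD.mul (hM α hα)
  obtain ⟨σ, _, hσ⟩ := hH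
  obtain ⟨σ', _, hσ'⟩ := hH'
  have hA0 : A + diagonal (fun i => (((0 : ι → ℝ≥0) i : ℝ≥0) : ℝ)) = A := by simp
  have hAinv : A⁻¹ = U := inv_eq_right_inv h.mul_eq_one
  have hG00 : G 0 = U := by simp only [G, hA0, hAinv]
  have hone : ∀ a₁ b₁ : ι → ℝ,
      ENNReal.ofReal ((1 + (U + Matrix.of fun i j => (U *ᵥ b₁) i * (U *ᵥ a₁) j) *
        diagonal fun i => (((0 : ι → ℝ≥0) i : ℝ≥0) : ℝ)).det ^ (-α)) = 1 := by
    intro a₁ b₁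
    simp
  have hlap : ∀ s, laplace (ρ + σ) s = _ := fun s => by
    rw [laplace_add, hρ, hσ, ← hHs]
  have hlap' : ∀ s, laplace (ρ + σ') s = _ := fun s => by
    rw [laplace_add, hρ, hσ', ← hHs']
  have hmass : (ρ + σ) univ = 1 := by rw [← laplace_zero_right, hlap, hone]
  have hmass' : (ρ + σ') univ = 1 := by rw [← laplace_zero_right, hlap', hone]
  have : IsFiniteMeasure (ρ + σ) := ⟨by rw [hmass]; exact ENNReal.one_lt_top⟩
  have : IsFiniteMeasure (ρ + σ') := ⟨by rw [hmass']; exact ENNReal.one_lt_top⟩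
  have hμeq : μ = ρ + σ := measure_eq_of_laplace_eq fun s hs => by rw [hμ s hs, hlap]
  have hμeq' : μ' = ρ + σ' := measure_eq_of_laplace_eq fun s hs => by rw [hμ' s hs, hlap']
  -- The mass of a measure is its transform at `s = 0`, where the resolvent is `U`.
  have hρu : ρ univ = ENNReal.ofReal ((C - entryPairing κ U) ^ (-α)) := by
    rw [← laplace_zero_right, hρ]
    simp only [M, hG00]
    simp
  -- Each of the two charge matrices exceeds `κ` entrywise by at most |a_i b_j - a'_i b'_j|.
  have herrC : C - entryPairing κ U ≤ 1 + err := by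
    rw [hC, add_sub_assoc, herr]
    refine add_le_add le_rfl ?_
    rw [sub_le_iff_le_add]
    have hsum : ∀ a₁ b₁ : ι → ℝ, (∀ i j, a₁ i * b₁ j ≤ |a i * b j - a' i * b' j| + κ i j) →
        a₁ ⬝ᵥ U *ᵥ b₁ ≤ ∑ i, ∑ j, |a i * b j - a' i * b' j| * U i j + entryPairing κ U := by
      intro a₁ b₁ hle
      rw [← entryPairing_vecMulVec, entryPairing, entryPairing, ← Finset.sum_add_distrib]
      refine Finset.sum_le_sum fun i _ => ?_
      rw [← Finset.sum_add_distrib]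
      refine Finset.sum_le_sum fun j _ => ?_
      rw [← add_mul]
      exact mul_le_mul_of_nonneg_right (hle i j) (h.nonneg i j)
    refine max_le (hsum a b fun i j => ?_) (hsum a' b' fun i j => ?_)
    · rw [hκ, Matrix.of_apply]
      rcases min_cases (a i * b j) (a' i * b' j) with h1 | h1 <;> rw [h1.1]
      · linarith [abs_nonneg (a i * b j - a' i * b' j)]
      · linarith [le_abs_self (a i * b j - a' i * b' j)]
    · rw [hκ, Matrix.of_apply]
      rcases min_cases (a i * b j) (a' i * b' j) with h1 | h1 <;> rw [h1.1]
      · linarith [neg_abs_le (a i * b j - a' i * b' j)]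
      · linarith [abs_nonneg (a i * b j - a' i * b' j)]
  have hpos : 0 < C - entryPairing κ U := by
    have := hκC 0
    rw [hG00] at this
    linarith
  have hρle : ENNReal.ofReal ((1 + err) ^ (-α)) ≤ ρ univ := by
    rw [hρu]
    exact ENNReal.ofReal_le_ofReal (Real.rpow_le_rpow_of_nonpos hpos herrC (by linarith))
  have herr0 : 0 ≤ err := by
    rw [herr]
    exact Finset.sum_nonneg fun i _ => Finset.sum_nonneg fun j _ =>
      mul_nonneg (abs_nonneg _) (h.nonneg i j)
  have hσle : σ univ ≤ ENNReal.ofReal (1 - (1 + err) ^ (-α)) := by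
    have h1 : ρ univ + σ univ = 1 := by simpa using hmass
    have h2 : ρ univ ≠ ⊤ := ne_top_of_le_ne_top ENNReal.one_ne_top (h1 ▸ le_self_add)
    rw [ENNReal.ofReal_sub _ (Real.rpow_nonneg (by linarith) _), ENNReal.ofReal_one]
    calc σ univ = 1 - ρ univ := (ENNReal.sub_eq_of_eq_add_rev h2 h1.symm).symm
      _ ≤ _ := tsub_le_tsub_left hρle 1
  calc μ B = ρ B + σ B := by rw [hμeq]; simp
    _ ≤ ρ B + σ univ := by gcongr; exact subset_univ B
    _ ≤ μ' B + ENNReal.ofReal (1 - (1 + err) ^ (-α)) := by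
      gcongr
      rw [hμeq']
      exact Measure.le_add_right le_rfl

end IsInverseMPair

end Comparison

end

noncomputable section

/-! ### Joint measurability of right-continuous families -/

/-- A right-continuous family of measurable functions is jointly measurable. -/
lemma measurable_uncurry_of_rightContinuous {X : Type*} [MeasurableSpace X] {f : ℝ≥0 → X → ℝ≥0∞}
    (hf : ∀ t, Measurable (f t)) (hc : ∀ x t, ContinuousWithinAt (fun s => f s x) (Ici t) t) :
    Measurable (Function.uncurry f) := by
  -- Time is approximated from the right by points of a grid of mesh 1/(n + 1). Each approximation
  -- takes countably many values, and right-continuity gives the limit.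
  obtain ⟨τ, hτm, hτ⟩ : ∃ τ : ℕ → ℝ≥0 → ℝ≥0, (∀ n, ∃ (k : ℝ≥0 → ℕ) (c : ℕ → ℝ≥0),
      Measurable k ∧ ∀ t, τ n t = c (k t)) ∧ ∀ t, Tendsto (fun n => τ n t) atTop (𝓝[≥] t) := by
    refine ⟨fun n t => (⌊t * (n + 1)⌋₊ + 1) / (n + 1), fun n => ⟨fun t => ⌊t * (n + 1)⌋₊,
      fun k => (k + 1) / (n + 1), Nat.measurable_floor.comp (measurable_id.mul_const _),
      fun t => rfl⟩, fun t => ?_⟩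
    have hle : ∀ n : ℕ, t ≤ (⌊t * (n + 1)⌋₊ + 1) / (n + 1) := fun n => by
      rw [le_div_iff₀ (by positivity)]
      exact (Nat.lt_floor_add_one _).le
    have hub : ∀ n : ℕ, (⌊t * (n + 1)⌋₊ + 1) / (n + 1) ≤ t + 1 / (n + 1) := fun n => by
      rw [div_le_iff₀ (by positivity), add_mul, one_div, inv_mul_cancel₀ (by positivity)]
      gcongr
      exact Nat.floor_le (by positivity)
    refine tendsto_nhdsWithin_iff.2 ⟨?_, Eventually.of_forall fun n => hle n⟩
    refine tendsto_of_tendsto_of_tendsto_of_le_of_le tendsto_const_nhds ?_ hle hub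
    have := (tendsto_one_div_add_atTop_nhds_zero_nat (𝕜 := ℝ≥0)).const_add t
    simpa using this
  refine measurable_of_tendsto_metrizable (f := fun n (p : ℝ≥0 × X) => f (τ n p.1) p.2)
    (fun n => ?_) (tendsto_pi_nhds.2 fun p => (hc p.2 p.1).tendsto.comp (hτ p.1))
  obtain ⟨k, c, hk, hkc⟩ := hτm n
  simp_rw [hkc]
  have h1 : Measurable fun p : ℕ × X => f (c p.1) p.2 :=
    measurable_from_prod_countable_right fun j => hf (c j)
  exact h1.comp ((hk.comp measurable_fst).prodMk measurable_snd)

lemma measurable_zeroExt {S : Type*} [TopologicalSpace S] [MeasurableSpace S] [BorelSpace S]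
    {h : S → ℝ≥0∞} (hh : Measurable h) : Measurable (zeroExt h) := by
  have he : MeasurableEmbedding ((↑) : S → OnePoint S) :=
    OnePoint.isOpenEmbedding_coe.measurableEmbedding
  have h1 : MeasurableSet ({OnePoint.infty}ᶜ : Set (OnePoint S)) := by
    have := he.measurableSet_range
    rwa [← OnePoint.compl_range_coe, compl_compl]
  intro B hB
  have : zeroExt h ⁻¹' B = ((↑) : S → OnePoint S) '' (h ⁻¹' B) ∪
      ({OnePoint.infty} ∩ {_x | (0 : ℝ≥0∞) ∈ B}) := by
    ext z
    induction z using OnePoint.rec with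
    | infty => simp [zeroExt]
    | coe x => simp [zeroExt]
  rw [this]
  refine (he.measurableSet_image' (hh hB)).union (MeasurableSet.inter ?_ (by simp))
  simpa using h1.compl

namespace BorelRightProcess

variable {S : Type*} [TopologicalSpace S] {Ω : Type*} [MeasurableSpace Ω]

lemma measurable_Y (𝒴 : BorelRightProcess S Ω) (t : ℝ≥0) : Measurable (𝒴.Y t) :=
  (𝒴.adapted t).mono (𝒴.filt.le t) le_rfl

lemma measurable_lintegral_Y (𝒴 : BorelRightProcess S Ω) (t : ℝ≥0) {H : OnePoint S → ℝ≥0∞}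
    (hH : Measurable H) : Measurable fun x => ∫⁻ ω, H (𝒴.Y t ω) ∂(𝒴.P x) := by
  have h1 : Measurable fun x => (𝒴.P x).map (𝒴.Y t) :=
    Measure.measurable_of_measurable_coe _ fun B hB => by
      simp_rw [Measure.map_apply (𝒴.measurable_Y t) hB]
      exact 𝒴.borel_semigroup t B hB
  have h2 := (Measure.measurable_lintegral hH).comp h1
  have h3 : (fun x => ∫⁻ ω, H (𝒴.Y t ω) ∂(𝒴.P x)) =
      (fun μ : Measure (OnePoint S) => ∫⁻ z, H z ∂μ) ∘ fun x => (𝒴.P x).map (𝒴.Y t) :=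
    funext fun x => (lintegral_map hH (𝒴.measurable_Y t)).symm
  rw [h3]
  exact h2

lemma markov (𝒴 : BorelRightProcess S Ω) (t s : ℝ≥0) {H : OnePoint S → ℝ≥0∞} (hH : Measurable H)
    (x : OnePoint S) : ∫⁻ ω, H (𝒴.Y (t + s) ω) ∂(𝒴.P x) =
      ∫⁻ ω, (∫⁻ ω', H (𝒴.Y s ω') ∂(𝒴.P (𝒴.Y t ω))) ∂(𝒴.P x) := by
  have hτ : IsStoppingTime 𝒴.filt fun _ => ((t : ℝ≥0) : WithTop ℝ≥0) :=
    isStoppingTime_const 𝒴.filt t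
  have := 𝒴.strong_markov x _ hτ univ MeasurableSet.univ s H hH
  have h1 : {_ω : Ω | ((t : ℝ≥0) : WithTop ℝ≥0) ≠ ⊤} = univ :=
    eq_univ_of_forall fun _ => WithTop.coe_ne_top
  rw [h1, univ_inter, Measure.restrict_univ] at this
  exact this

variable [MeasurableSpace S] [BorelSpace S] (𝒴 : BorelRightProcess S Ω)

lemma measurable_semigroup (t : ℝ≥0) {h : S → ℝ≥0∞} (hh : Measurable h) :
    Measurable (𝒴.semigroup t h) :=
  (𝒴.measurable_lintegral_Y t (measurable_zeroExt hh)).comp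
    OnePoint.continuous_coe.measurable

lemma measurable_zeroExt_Y (t : ℝ≥0) {h : S → ℝ≥0∞} (hh : Measurable h) :
    Measurable fun ω => zeroExt h (𝒴.Y t ω) :=
  (measurable_zeroExt hh).comp (𝒴.measurable_Y t)

lemma lintegral_zeroExt_eq (t : ℝ≥0) {h : S → ℝ≥0∞} (hh : Measurable h) (y : OnePoint S) :
    ∫⁻ ω, zeroExt h (𝒴.Y t ω) ∂(𝒴.P y) = zeroExt (𝒴.semigroup t h) y := by
  induction y using OnePoint.rec with
  | infty =>
    change _ = 0
    rw [lintegral_eq_zero_iff (𝒴.measurable_zeroExt_Y t hh)]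
    filter_upwards [𝒴.start OnePoint.infty] with ω hω
    have := 𝒴.cemetery_absorbing ω 0 t (by positivity) hω
    simp [this, zeroExt]
  | coe x => rfl

lemma semigroup_add (t s : ℝ≥0) {h : S → ℝ≥0∞} (hh : Measurable h) (x : S) :
    𝒴.semigroup (t + s) h x = 𝒴.semigroup t (𝒴.semigroup s h) x := by
  rw [semigroup, 𝒴.markov t s (measurable_zeroExt hh)]
  simp_rw [𝒴.lintegral_zeroExt_eq s hh]
  rfl

omit [MeasurableSpace S] [BorelSpace S] in
lemma semigroup_mono (t : ℝ≥0) {h h' : S → ℝ≥0∞} (hle : ∀ x, h x ≤ h' x) (x : S) :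
    𝒴.semigroup t h x ≤ 𝒴.semigroup t h' x := by
  refine lintegral_mono fun ω => ?_
  generalize 𝒴.Y t ω = z
  induction z using OnePoint.rec with
  | infty => simp [zeroExt]
  | coe x => exact hle x

omit [MeasurableSpace S] [BorelSpace S] in
lemma semigroup_const_le (t : ℝ≥0) (c : ℝ≥0∞) (x : S) : 𝒴.semigroup t (fun _ => c) x ≤ c := by
  have := 𝒴.isProbabilityMeasure x
  calc 𝒴.semigroup t (fun _ => c) x ≤ ∫⁻ _, c ∂(𝒴.P x) := by
        refine lintegral_mono fun ω => ?_
        generalize 𝒴.Y t ω = z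
        induction z using OnePoint.rec with
        | infty => simp [zeroExt]
        | coe x => exact le_rfl
    _ = c := by simp

lemma semigroup_add_right (t : ℝ≥0) (h : S → ℝ≥0∞) {h' : S → ℝ≥0∞} (hh : Measurable h') (x : S) :
    𝒴.semigroup t (fun y => h y + h' y) x = 𝒴.semigroup t h x + 𝒴.semigroup t h' x := by
  rw [semigroup, semigroup, semigroup,
    ← lintegral_add_right _ (𝒴.measurable_zeroExt_Y t hh)]
  refine lintegral_congr fun ω => ?_
  generalize 𝒴.Y t ω = z
  induction z using OnePoint.rec with
  | infty => simp [zeroExt]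
  | coe x => rfl

lemma semigroup_const_mul (t : ℝ≥0) (c : ℝ≥0∞) {h : S → ℝ≥0∞} (hh : Measurable h) (x : S) :
    𝒴.semigroup t (fun y => c * h y) x = c * 𝒴.semigroup t h x := by
  rw [semigroup, semigroup,
    ← lintegral_const_mul _ (𝒴.measurable_zeroExt_Y t hh)]
  refine lintegral_congr fun ω => ?_
  generalize 𝒴.Y t ω = z
  induction z using OnePoint.rec with
  | infty => simp [zeroExt]
  | coe x => rfl

/-- `h` extends continuously by `0` to the cemetery and is bounded. -/
structure _root_.IsTestFunction (h : S → ℝ≥0∞) : Prop where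
  continuous_zeroExt : Continuous (zeroExt h)
  bounded : ∃ C : ℝ≥0, ∀ x, h x ≤ C

omit [BorelSpace S] [MeasurableSpace S] in
lemma _root_.IsTestFunction.continuous {h : S → ℝ≥0∞} (hh : IsTestFunction h) : Continuous h :=
  hh.continuous_zeroExt.comp OnePoint.continuous_coe

lemma _root_.IsTestFunction.measurable {h : S → ℝ≥0∞} (hh : IsTestFunction h) : Measurable h :=
  hh.continuous.measurable

omit [BorelSpace S] [MeasurableSpace S] in
lemma zeroExt_comp_rightContinuous {h : S → ℝ≥0∞} (hh : IsTestFunction h) (ω : Ω) (t : ℝ≥0) :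
    ContinuousWithinAt (fun s => zeroExt h (𝒴.Y s ω)) (Ici t) t :=
  hh.continuous_zeroExt.continuousAt.comp_continuousWithinAt (𝒴.path_rightContinuous ω t)

lemma lintegral_zeroExt_rightContinuous {h : S → ℝ≥0∞} (hh : IsTestFunction h) (x : OnePoint S)
    (t : ℝ≥0) :
    ContinuousWithinAt (fun s => ∫⁻ ω, zeroExt h (𝒴.Y s ω) ∂(𝒴.P x)) (Ici t) t := by
  obtain ⟨C, hC⟩ := hh.bounded
  have := 𝒴.isProbabilityMeasure x
  refine tendsto_lintegral_filter_of_dominated_convergence (fun _ => (C : ℝ≥0∞))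
    (Eventually.of_forall fun s => (measurable_zeroExt hh.measurable).comp (𝒴.measurable_Y s))
    (Eventually.of_forall fun s => ae_of_all _ fun ω => ?_) (by simp)
    (ae_of_all _ fun ω => 𝒴.zeroExt_comp_rightContinuous hh ω t)
  generalize 𝒴.Y s ω = z
  induction z using OnePoint.rec with
  | infty => simp [zeroExt]
  | coe x => exact hC x

/-- Joint measurability of the semigroup in time and space. -/
lemma measurable_uncurry_zeroExt_semigroup {h : S → ℝ≥0∞} (hh : IsTestFunction h) :
    Measurable fun p : ℝ≥0 × OnePoint S => zeroExt (𝒴.semigroup p.1 h) p.2 := by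
  simp_rw [← 𝒴.lintegral_zeroExt_eq _ hh.measurable]
  exact measurable_uncurry_of_rightContinuous
    (f := fun t x => ∫⁻ ω, zeroExt h (𝒴.Y t ω) ∂(𝒴.P x))
    (fun t => 𝒴.measurable_lintegral_Y t (measurable_zeroExt hh.measurable))
    fun x t => 𝒴.lintegral_zeroExt_rightContinuous hh x t

lemma measurable_uncurry_semigroup {h : S → ℝ≥0∞} (hh : IsTestFunction h) :
    Measurable fun p : ℝ≥0 × S => 𝒴.semigroup p.1 h p.2 :=
  (𝒴.measurable_uncurry_zeroExt_semigroup hh).comp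
    (measurable_fst.prodMk (OnePoint.continuous_coe.measurable.comp measurable_snd))

lemma measurable_semigroup_time {h : S → ℝ≥0∞} (hh : IsTestFunction h) (x : S) :
    Measurable fun t => 𝒴.semigroup t h x :=
  (𝒴.measurable_uncurry_semigroup hh).comp (measurable_id.prodMk measurable_const)

/-- The `β`-resolvent of the process. -/
def resolvent (β : ℝ) (h : S → ℝ≥0∞) (x : S) : ℝ≥0∞ :=
  ∫⁻ t in Ioi (0 : ℝ), ENNReal.ofReal (Real.exp (-(β * t))) * 𝒴.semigroup t.toNNReal h x

lemma measurable_resolvent (β : ℝ) {h : S → ℝ≥0∞} (hh : IsTestFunction h) :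
    Measurable (𝒴.resolvent β h) := by
  refine Measurable.lintegral_prod_left' (f := fun p : ℝ × S =>
    ENNReal.ofReal (Real.exp (-(β * p.1))) * 𝒴.semigroup p.1.toNNReal h p.2) ?_
  refine Measurable.mul (by fun_prop) ((𝒴.measurable_uncurry_semigroup hh).comp
    (f := fun p : ℝ × S => (p.1.toNNReal, p.2)) ?_)
  exact (measurable_real_toNNReal.comp measurable_fst).prodMk measurable_snd

omit [MeasurableSpace S] [BorelSpace S] in
lemma _root_.lintegral_exp_neg_mul_Ioi {γ : ℝ} (hγ : 0 < γ) :
    ∫⁻ t in Ioi (0 : ℝ), ENNReal.ofReal (Real.exp (-(γ * t))) = ENNReal.ofReal γ⁻¹ := by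
  have h1 := integral_exp_mul_Ioi (a := -γ) (by linarith) 0
  have h2 := integrableOn_exp_mul_Ioi (a := -γ) (by linarith) 0
  simp only [neg_mul, mul_zero, Real.exp_zero] at h1 h2
  rw [← ofReal_integral_eq_lintegral_ofReal h2 (ae_of_all _ fun t => (Real.exp_pos _).le), h1]
  congr 1
  field_simp

omit [MeasurableSpace S] [BorelSpace S] in
lemma resolvent_le_of_semigroup_le {γ : ℝ} (hγ : 0 < γ) {h : S → ℝ≥0∞} {x : S} {c : ℝ≥0∞}
    (hc : ∀ t, 𝒴.semigroup t h x ≤ c) : 𝒴.resolvent γ h x ≤ ENNReal.ofReal γ⁻¹ * c := by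
  rw [← lintegral_exp_neg_mul_Ioi hγ, ← lintegral_mul_const _ (by fun_prop)]
  exact lintegral_mono fun t => mul_le_mul_right (hc _) _

/-- The shifted resolvent: `P_t R_β h = ∫ e^{-β s} P_{t+s} h ds`. -/
lemma semigroup_resolvent (β : ℝ) {h : S → ℝ≥0∞} (hh : IsTestFunction h) (t : ℝ≥0) (x : S) :
    𝒴.semigroup t (𝒴.resolvent β h) x =
      ∫⁻ s in Ioi (0 : ℝ), ENNReal.ofReal (Real.exp (-(β * s))) *
        𝒴.semigroup (t + s.toNNReal) h x := by
  have hz : ∀ z, zeroExt (𝒴.resolvent β h) z = ∫⁻ s in Ioi (0 : ℝ),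
      ENNReal.ofReal (Real.exp (-(β * s))) * zeroExt (𝒴.semigroup s.toNNReal h) z := by
    intro z
    induction z using OnePoint.rec with
    | infty => simp [zeroExt]
    | coe x => rfl
  rw [semigroup]
  simp_rw [hz]
  have := 𝒴.isProbabilityMeasure x
  have hmeas : Measurable fun p : Ω × ℝ => zeroExt (𝒴.semigroup p.2.toNNReal h) (𝒴.Y t p.1) :=
    (𝒴.measurable_uncurry_zeroExt_semigroup hh).comp
      ((measurable_real_toNNReal.comp measurable_snd).prodMk
        ((𝒴.measurable_Y t).comp measurable_fst))
  rw [lintegral_lintegral_swap]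
  · refine lintegral_congr fun s => ?_
    rw [lintegral_const_mul _ (𝒴.measurable_zeroExt_Y t (𝒴.measurable_semigroup _ hh.measurable)),
      𝒴.semigroup_add t _ hh.measurable]
    rfl
  · exact (Measurable.mul (by fun_prop) hmeas).aemeasurable

end BorelRightProcess

end

noncomputable section

/-! ### The domination principle -/

namespace BorelRightProcess

variable {S : Type*} [TopologicalSpace S] {Ω : Type*} [MeasurableSpace Ω]
  [MeasurableSpace S] [BorelSpace S] (𝒴 : BorelRightProcess S Ω)

omit [MeasurableSpace S] [BorelSpace S] [TopologicalSpace S] in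
lemma _root_.ofReal_exp_add_lintegral_Ioc {α r : ℝ} (hα : 0 < α) (hr : 0 < r) :
    ENNReal.ofReal (Real.exp (-(α * r))) +
      ENNReal.ofReal α * ∫⁻ t in Ioc 0 r, ENNReal.ofReal (Real.exp (-(α * t))) = 1 := by
  have h1 := integral_exp_mul_Ioi (a := -α) (by linarith) r
  have h2 := integrableOn_exp_mul_Ioi (a := -α) (by linarith) r
  simp only [neg_mul] at h1 h2
  have h3 : ENNReal.ofReal (Real.exp (-(α * r))) =
      ENNReal.ofReal α * ∫⁻ t in Ioi r, ENNReal.ofReal (Real.exp (-(α * t))) := by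
    rw [← ofReal_integral_eq_lintegral_ofReal h2 (ae_of_all _ fun t => (Real.exp_pos _).le), h1,
      ← ENNReal.ofReal_mul hα.le]
    congr 1
    field_simp
  have h4 := lintegral_union (μ := volume) (f := fun t => ENNReal.ofReal (Real.exp (-(α * t))))
    (measurableSet_Ioi (a := r)) (Set.disjoint_left.2 fun t (ht : t ∈ Ioc 0 r) ht' =>
      not_lt.2 ht.2 ht')
  rw [Ioc_union_Ioi_eq_Ioi hr.le, add_comm] at h4
  rw [h3, ← mul_add, ← h4,
    lintegral_exp_neg_mul_Ioi hα, ← ENNReal.ofReal_mul hα.le, mul_inv_cancel₀ hα.ne']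
  simp

/-- The resolvent equation, integrated against a test function. -/
lemma resolvent_resolvent {α : ℝ} (hα : 0 < α) (β : ℝ) {h : S → ℝ≥0∞}
    (hh : IsTestFunction h) (x : S) :
    𝒴.resolvent (α + β) (fun y => h y + ENNReal.ofReal α * 𝒴.resolvent β h y) x =
      𝒴.resolvent β h x := by
  let F : ℝ → ℝ≥0∞ := fun r =>
    ENNReal.ofReal (Real.exp (-(β * r))) * 𝒴.semigroup r.toNNReal h x
  have hF : Measurable F :=
    Measurable.mul (by fun_prop) ((𝒴.measurable_semigroup_time hh x).comp measurable_real_toNNReal)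
  have hRm := 𝒴.measurable_resolvent β hh
  have hshift : ∀ t ∈ Ioi (0 : ℝ), ENNReal.ofReal (Real.exp (-((α + β) * t))) *
      𝒴.semigroup t.toNNReal (𝒴.resolvent β h) x =
      ENNReal.ofReal (Real.exp (-(α * t))) * ∫⁻ r in Ici t, F r := by
    intro t ht
    have h1 : ∫⁻ r in Ici t, F r = ∫⁻ s in Ici 0, F (t + s) := by
      rw [← (measurePreserving_add_left volume t).setLIntegral_comp_preimage measurableSet_Ici hF]
      congr 2
      simp
    have hm : Measurable fun s : ℝ => 𝒴.semigroup (t.toNNReal + s.toNNReal) h x :=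
      (𝒴.measurable_semigroup_time hh x).comp (measurable_const.add measurable_real_toNNReal)
    have hm' : Measurable fun s : ℝ => ENNReal.ofReal (Real.exp (-(β * s))) *
        𝒴.semigroup (t.toNNReal + s.toNNReal) h x := Measurable.mul (by fun_prop) hm
    rw [𝒴.semigroup_resolvent β hh, h1, restrict_Ioi_eq_restrict_Ici,
      ← lintegral_const_mul _ (show Measurable fun s => F (t + s) from
        hF.comp (measurable_const_add t)),
      ← lintegral_const_mul _ hm']
    refine setLIntegral_congr_fun measurableSet_Ici fun s hs => ?_
    simp only [F]
    rw [Real.toNNReal_add (le_of_lt ht) hs, ← mul_assoc, ← mul_assoc,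
      ← ENNReal.ofReal_mul (Real.exp_pos _).le, ← ENNReal.ofReal_mul (Real.exp_pos _).le,
      ← Real.exp_add, ← Real.exp_add]
    congr 3
    ring
  have hsplit : ∀ t ∈ Ioi (0 : ℝ), ENNReal.ofReal (Real.exp (-((α + β) * t))) *
      𝒴.semigroup t.toNNReal (fun y => h y + ENNReal.ofReal α * 𝒴.resolvent β h y) x =
      ENNReal.ofReal (Real.exp (-(α * t))) * F t +
        ∫⁻ r in Ioi 0, ENNReal.ofReal α * ENNReal.ofReal (Real.exp (-(α * t))) *
          (Ici t).indicator F r := by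
    intro t ht
    have hsub : Ici t ∩ Ioi 0 = Ici t := inter_eq_left.2 fun r hr =>
      mem_Ioi.2 (lt_of_lt_of_le (mem_Ioi.1 ht) (mem_Ici.1 hr))
    rw [𝒴.semigroup_add_right _ _ (hRm.const_mul _), 𝒴.semigroup_const_mul _ _ hRm, mul_add,
      mul_left_comm, hshift t ht, lintegral_const_mul _ (hF.indicator measurableSet_Ici),
      setLIntegral_indicator measurableSet_Ici,
      hsub, mul_assoc (ENNReal.ofReal α)]
    congr 1
    simp only [F]
    rw [← mul_assoc, ← ENNReal.ofReal_mul (Real.exp_pos _).le, ← Real.exp_add]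
    congr 4
    ring
  have hm1 : Measurable fun t => ENNReal.ofReal (Real.exp (-(α * t))) * F t :=
    Measurable.mul (by fun_prop) hF
  -- After Fubini, F(r) carries the weight e^{-αr} + α ∫_0^r e^{-αt} dt = 1. The additive form of
  -- the resolvent equation avoids subtracting possibly infinite quantities.
  rw [resolvent, setLIntegral_congr_fun measurableSet_Ioi hsplit,
    lintegral_add_left hm1, lintegral_lintegral_swap, ← lintegral_add_left hm1]
  · refine setLIntegral_congr_fun measurableSet_Ioi fun r hr => ?_
    have h1 : ∀ t, ENNReal.ofReal α * ENNReal.ofReal (Real.exp (-(α * t))) *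
        (Ici t).indicator F r = (Iic r).indicator (fun t => ENNReal.ofReal α *
          ENNReal.ofReal (Real.exp (-(α * t)))) t * F r := by
      intro t
      by_cases h : t ≤ r <;> simp [indicator, h]
    simp only [h1]
    rw [lintegral_mul_const _ (Measurable.indicator (by fun_prop) measurableSet_Iic),
      setLIntegral_indicator measurableSet_Iic, inter_comm, Ioi_inter_Iic,
      lintegral_const_mul _ (by fun_prop), ← add_mul, ofReal_exp_add_lintegral_Ioc hα hr, one_mul]
  · refine Measurable.aemeasurable ?_
    have : Measurable fun p : ℝ × ℝ => (Ici p.1).indicator F p.2 := by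
      have h1 : (fun p : ℝ × ℝ => (Ici p.1).indicator F p.2) =
          {p : ℝ × ℝ | p.1 ≤ p.2}.indicator fun p => F p.2 := by
        ext p
        simp [indicator]
      rw [h1]
      exact (hF.comp measurable_snd).indicator (measurableSet_le measurable_fst measurable_snd)
    exact Measurable.mul (by fun_prop) this

/-- A measurable function `s` with `P_t s ≤ s` for all `t`. -/
structure IsSupermedian (s : S → ℝ≥0∞) : Prop where
  measurable : Measurable s
  semigroup_le : ∀ t x, 𝒴.semigroup t s x ≤ s x

namespace IsSupermedian

variable {𝒴} {s s' : S → ℝ≥0∞}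

lemma add (hs : 𝒴.IsSupermedian s) (hs' : 𝒴.IsSupermedian s') :
    𝒴.IsSupermedian fun x => s x + s' x where
  measurable := hs.measurable.add hs'.measurable
  semigroup_le t x := by
    rw [𝒴.semigroup_add_right _ _ hs'.measurable]
    exact add_le_add (hs.semigroup_le t x) (hs'.semigroup_le t x)

omit [BorelSpace S] in
lemma const (c : ℝ≥0∞) : 𝒴.IsSupermedian fun _ => c :=
  ⟨measurable_const, fun t x => 𝒴.semigroup_const_le t c x⟩

lemma antitone (hs : 𝒴.IsSupermedian s) (x : S) : Antitone fun t => 𝒴.semigroup t s x := by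
  intro t r htr
  obtain ⟨q, rfl⟩ := exists_add_of_le htr
  simp only
  rw [𝒴.semigroup_add t q hs.measurable]
  exact 𝒴.semigroup_mono t (fun y => hs.semigroup_le q y) x

end IsSupermedian

omit [BorelSpace S] in
-- For t > 0 monotonicity compares with the limit at 0; at t = 0 the process sits at its starting
-- point.
lemma IsFiniteExcessive.isSupermedian {f : S → ℝ} (hf : 𝒴.IsFiniteExcessive f) :
    𝒴.IsSupermedian fun x => ENNReal.ofReal (f x) where
  measurable := hf.2.1.ennreal_ofReal
  semigroup_le t x := by
    obtain ⟨hanti, hlim⟩ := hf.2.2 x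
    rcases eq_or_lt_of_le (zero_le (a := t)) with rfl | ht
    · have h0 : 𝒴.semigroup 0 (fun y => ENNReal.ofReal (f y)) x =
          ∫⁻ _, ENNReal.ofReal (f x) ∂(𝒴.P x) := by
        refine lintegral_congr_ae ?_
        filter_upwards [𝒴.start x] with ω hω
        simp [hω, zeroExt]
      have := 𝒴.isProbabilityMeasure x
      simp [h0]
    · refine ge_of_tendsto hlim ?_
      filter_upwards [Ioo_mem_nhdsGT ht] with r hr
      exact hanti hr.2.le

/-- The domination principle for the `β`-potential of a test function, with an error term. -/
lemma resolvent_le_add_of_le {α β : ℝ} (hα : 0 < α) (hβ : 0 < β) {h s : S → ℝ≥0∞}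
    (hh : IsTestFunction h) {C : ℝ≥0} (hC : ∀ x, h x ≤ C) (hs : 𝒴.IsSupermedian s)
    (hle : ∀ x, h x ≠ 0 → 𝒴.resolvent β h x ≤ s x) (x : S) :
    𝒴.resolvent β h x ≤ s x + ENNReal.ofReal α⁻¹ * C := by
  -- The function `p` is chosen so that α R_{α+β} p = R_β h. The excess v = (p - σ)⁺ satisfies v ≤ α
  -- R_{α+β} v: it vanishes where h ≠ 0, and elsewhere p = R_β h. As β > 0, `v` is bounded and α
  -- R_{α+β} contracts the supremum by α/(α + β) < 1, so v = 0. This maximum principle takes the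
  -- place of an argument with hitting times.
  set p : S → ℝ≥0∞ := fun y => ENNReal.ofReal α⁻¹ * h y + 𝒴.resolvent β h y with hp
  set σ : S → ℝ≥0∞ := fun y => s y + ENNReal.ofReal α⁻¹ * C with hσ
  set v : S → ℝ≥0∞ := fun y => p y - σ y with hv
  have hαβ : 0 < α + β := by linarith
  have hαα : ENNReal.ofReal α * ENNReal.ofReal α⁻¹ = 1 := by
    rw [← ENNReal.ofReal_mul hα.le, mul_inv_cancel₀ hα.ne', ENNReal.ofReal_one]
  have hσs : 𝒴.IsSupermedian σ := hs.add (.const _)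
  have hRm := 𝒴.measurable_resolvent β hh
  have hpm : Measurable p := (hh.measurable.const_mul _).add hRm
  have hinv : ∀ y, ENNReal.ofReal α * 𝒴.resolvent (α + β) p y = 𝒴.resolvent β h y := by
    intro y
    rw [← 𝒴.resolvent_resolvent hα β hh y, resolvent, resolvent, ← lintegral_const_mul]
    · refine lintegral_congr fun t => ?_
      rw [mul_left_comm, ← 𝒴.semigroup_const_mul _ _ hpm]
      congr 3
      ext z
      simp only [hp]
      rw [mul_add, ← mul_assoc, hαα, one_mul]
    · refine Measurable.mul (by fun_prop) ?_
      have h1 : ∀ t : ℝ, 𝒴.semigroup t.toNNReal p y =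
          ENNReal.ofReal α⁻¹ * 𝒴.semigroup t.toNNReal h y +
            𝒴.semigroup t.toNNReal (𝒴.resolvent β h) y := fun t => by
        rw [hp, 𝒴.semigroup_add_right _ _ hRm, 𝒴.semigroup_const_mul _ _ hh.measurable]
      simp_rw [h1]
      refine Measurable.add (Measurable.const_mul ((𝒴.measurable_semigroup_time hh y).comp
        measurable_real_toNNReal) _) ?_
      simp_rw [𝒴.semigroup_resolvent β hh]
      refine Measurable.lintegral_prod_right' (f := fun q : ℝ × ℝ =>
        ENNReal.ofReal (Real.exp (-(β * q.2))) *
          𝒴.semigroup (q.1.toNNReal + q.2.toNNReal) h y) ?_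
      exact Measurable.mul (by fun_prop) ((𝒴.measurable_semigroup_time hh y).comp (by fun_prop))
  have hcontr : ∀ y, 𝒴.resolvent (α + β) σ y ≤ ENNReal.ofReal (α + β)⁻¹ * σ y := fun y =>
    𝒴.resolvent_le_of_semigroup_le hαβ fun t => hσs.semigroup_le t y
  have hratio : ENNReal.ofReal α * ENNReal.ofReal (α + β)⁻¹ < 1 := by
    rw [← ENNReal.ofReal_mul hα.le, ENNReal.ofReal_lt_one, ← div_eq_mul_inv, div_lt_one hαβ]
    linarith
  have hvle : ∀ y, v y ≤ ENNReal.ofReal α * 𝒴.resolvent (α + β) v y := by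
    intro y
    by_cases hy : h y = 0
    · have h1 : 𝒴.resolvent (α + β) p y ≤
          𝒴.resolvent (α + β) v y + 𝒴.resolvent (α + β) σ y := by
        rw [resolvent, resolvent, resolvent, ← lintegral_add_right]
        · refine lintegral_mono fun t => ?_
          rw [← mul_add, ← 𝒴.semigroup_add_right _ _ hσs.measurable]
          exact mul_le_mul_right (𝒴.semigroup_mono _ (fun z => le_tsub_add) y) _
        · exact Measurable.mul (by fun_prop)
            ((hσs.antitone y).measurable.comp measurable_real_toNNReal)
      rw [hv, tsub_le_iff_right]
      calc p y = ENNReal.ofReal α * 𝒴.resolvent (α + β) p y := by rw [hinv]; simp [hp, hy]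
        _ ≤ ENNReal.ofReal α * 𝒴.resolvent (α + β) v y +
            ENNReal.ofReal α * (ENNReal.ofReal (α + β)⁻¹ * σ y) := by
          rw [← mul_add]
          exact mul_le_mul_right (h1.trans (add_le_add le_rfl (hcontr y))) _
        _ ≤ _ := by
          refine add_le_add le_rfl ?_
          rw [← mul_assoc]
          exact (mul_le_mul_left hratio.le _).trans (one_mul _).le
    · have : v y = 0 := by
        rw [hv, tsub_eq_zero_iff_le]
        simp only [hp, hσ]
        rw [add_comm]
        exact add_le_add (hle y hy) (mul_le_mul_right (hC y) _)
      rw [this]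
      positivity
  have hRb : ∀ y, 𝒴.resolvent β h y ≤ ENNReal.ofReal β⁻¹ * C := fun y =>
    𝒴.resolvent_le_of_semigroup_le hβ fun t =>
      (𝒴.semigroup_mono t hC y).trans (𝒴.semigroup_const_le t _ y)
  have hvfin : ⨆ y, v y ≠ ⊤ := by
    refine ne_top_of_le_ne_top (b := ENNReal.ofReal α⁻¹ * C + ENNReal.ofReal β⁻¹ * C) ?_ ?_
    · exact ENNReal.add_ne_top.2 ⟨ENNReal.mul_ne_top ENNReal.ofReal_ne_top ENNReal.coe_ne_top,
        ENNReal.mul_ne_top ENNReal.ofReal_ne_top ENNReal.coe_ne_top⟩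
    · exact iSup_le fun y => tsub_le_self.trans (add_le_add (mul_le_mul_right (hC y) _) (hRb y))
  have hMle : ⨆ y, v y ≤ ENNReal.ofReal α * ENNReal.ofReal (α + β)⁻¹ * ⨆ y, v y := by
    refine iSup_le fun y => (hvle y).trans ?_
    rw [mul_assoc]
    refine mul_le_mul_right (𝒴.resolvent_le_of_semigroup_le hαβ fun t => ?_) _
    exact (𝒴.semigroup_mono t (fun z => le_iSup v z) y).trans (𝒴.semigroup_const_le t _ y)
  have hM0 : ⨆ y, v y = 0 := by
    by_contra hne
    have := ENNReal.mul_lt_mul_left hne hvfin hratio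
    rw [one_mul] at this
    exact absurd hMle (not_le.2 this)
  have hvx : v x = 0 := le_antisymm (hM0 ▸ le_iSup v x) (by positivity)
  rw [hv, tsub_eq_zero_iff_le] at hvx
  exact le_add_self.trans hvx

/-- The `0`-potential of a function. -/
def potential (h : S → ℝ≥0∞) (x : S) : ℝ≥0∞ := ∫⁻ t in Ioi (0 : ℝ), 𝒴.semigroup t.toNNReal h x

omit [MeasurableSpace S] [BorelSpace S] in
lemma resolvent_le_potential {β : ℝ} (hβ : 0 < β) (h : S → ℝ≥0∞) (x : S) :
    𝒴.resolvent β h x ≤ 𝒴.potential h x := by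
  refine setLIntegral_mono' measurableSet_Ioi fun t ht => ?_
  refine (mul_le_mul_left (ENNReal.ofReal_le_one.2 (Real.exp_le_one_iff.2 ?_)) _).trans
    (one_mul _).le
  exact neg_nonpos.2 (mul_nonneg hβ.le (le_of_lt ht))

/-- Fatou's lemma along β = 1/(n + 1). -/
lemma potential_le_of_resolvent_le {h : S → ℝ≥0∞} (hh : IsTestFunction h) {x : S} {c : ℝ≥0∞}
    (hc : ∀ β : ℝ, 0 < β → 𝒴.resolvent β h x ≤ c) : 𝒴.potential h x ≤ c := by
  have h1 : 𝒴.potential h x = ∫⁻ t in Ioi (0 : ℝ), liminf (fun n : ℕ =>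
      ENNReal.ofReal (Real.exp (-((1 / ((n : ℝ) + 1)) * t))) * 𝒴.semigroup t.toNNReal h x) atTop := by
    refine lintegral_congr fun t => (Tendsto.liminf_eq ?_).symm
    have h2 : Tendsto (fun n : ℕ => ENNReal.ofReal (Real.exp (-((1 / ((n : ℝ) + 1)) * t)))) atTop
        (𝓝 1) := by
      rw [← ENNReal.ofReal_one, ← Real.exp_zero]
      refine ENNReal.tendsto_ofReal ((Real.continuous_exp.tendsto 0).comp ?_)
      have := ((tendsto_one_div_add_atTop_nhds_zero_nat (𝕜 := ℝ)).mul_const t).neg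
      simpa using this
    simpa using ENNReal.Tendsto.mul_const h2 (b := 𝒴.semigroup t.toNNReal h x)
      (Or.inl one_ne_zero)
  rw [h1]
  refine (lintegral_liminf_le fun n => Measurable.mul (by fun_prop)
    ((𝒴.measurable_semigroup_time hh x).comp measurable_real_toNNReal)).trans ?_
  refine liminf_le_of_le (by isBoundedDefault) fun b hb => ?_
  obtain ⟨n, hn⟩ := hb.exists
  exact hn.trans (hc _ (by positivity))

/-- The domination principle for potentials of test functions. -/
theorem potential_le_of_le {h s : S → ℝ≥0∞} (hh : IsTestFunction h) (hs : 𝒴.IsSupermedian s)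
    (hle : ∀ x, h x ≠ 0 → 𝒴.potential h x ≤ s x) (x : S) : 𝒴.potential h x ≤ s x := by
  obtain ⟨C, hC⟩ := hh.bounded
  refine 𝒴.potential_le_of_resolvent_le hh fun β hβ => ?_
  -- Taking α = n + 1 → ∞ removes the error term C/α.
  have h1 : Tendsto (fun n : ℕ => s x + ENNReal.ofReal ((n : ℝ) + 1)⁻¹ * C) atTop
      (𝓝 (s x + 0 * C)) := by
    refine tendsto_const_nhds.add (ENNReal.Tendsto.mul_const ?_ (Or.inr ENNReal.coe_ne_top))
    rw [← ENNReal.ofReal_zero]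
    refine ENNReal.tendsto_ofReal ?_
    simpa using tendsto_one_div_add_atTop_nhds_zero_nat (𝕜 := ℝ)
  rw [zero_mul, add_zero] at h1
  exact ge_of_tendsto' h1 fun n => 𝒴.resolvent_le_add_of_le (by positivity) hβ hh hC hs
    (fun y hy => (𝒴.resolvent_le_potential hβ h y).trans (hle y hy)) x

lemma isSupermedian_potential {h : S → ℝ≥0∞} (hh : IsTestFunction h) :
    𝒴.IsSupermedian (𝒴.potential h) where
  measurable := by
    refine Measurable.lintegral_prod_left' (f := fun p : ℝ × S => 𝒴.semigroup p.1.toNNReal h p.2) ?_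
    exact (𝒴.measurable_uncurry_semigroup hh).comp
      ((measurable_real_toNNReal.comp measurable_fst).prodMk measurable_snd)
  semigroup_le r x := by
    have h0 : 𝒴.resolvent 0 h = 𝒴.potential h := by
      ext y
      simp [resolvent, potential]
    have hm : Measurable fun t : ℝ => 𝒴.semigroup t.toNNReal h x :=
      (𝒴.measurable_semigroup_time hh x).comp measurable_real_toNNReal
    rw [← h0, 𝒴.semigroup_resolvent 0 hh, h0]
    have h1 : ∀ s ∈ Ioi (0 : ℝ), ENNReal.ofReal (Real.exp (-(0 * s))) *
        𝒴.semigroup (r + s.toNNReal) h x = 𝒴.semigroup ((r : ℝ) + s).toNNReal h x := by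
      intro s hs
      rw [Real.toNNReal_add (NNReal.coe_nonneg r) (le_of_lt hs)]
      simp
    rw [setLIntegral_congr_fun measurableSet_Ioi h1]
    have h2 := (measurePreserving_add_left volume (r : ℝ)).setLIntegral_comp_preimage
      (measurableSet_Ioi (a := (r : ℝ))) hm
    have h3 : (fun x => (r : ℝ) + x) ⁻¹' Ioi (r : ℝ) = Ioi 0 := by simp
    rw [h3] at h2
    rw [h2]
    exact lintegral_mono_set (Ioi_subset_Ioi (NNReal.coe_nonneg r))

end BorelRightProcess

end

noncomputable section

/-! ### The domination principle for point charges -/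

namespace IsTestFunction

lemma const_mul {S : Type*} [TopologicalSpace S] {h : S → ℝ≥0∞} (hh : IsTestFunction h) (c : ℝ≥0) :
    IsTestFunction fun x => (c : ℝ≥0∞) * h x where
  continuous_zeroExt := by
    have : zeroExt (fun x => (c : ℝ≥0∞) * h x) = fun z => (c : ℝ≥0∞) * zeroExt h z := by
      ext z
      induction z using OnePoint.rec with
      | infty => simp [zeroExt]
      | coe x => rfl
    rw [this]
    exact (ENNReal.continuous_const_mul ENNReal.coe_ne_top).comp hh.continuous_zeroExt
  bounded := by
    obtain ⟨C, hC⟩ := hh.bounded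
    exact ⟨c * C, fun x => by rw [ENNReal.coe_mul]; exact mul_le_mul_right (hC x) _⟩

lemma sum {S : Type*} [TopologicalSpace S] {κ : Type*} (t : Finset κ) {h : κ → S → ℝ≥0∞}
    (hh : ∀ i, IsTestFunction (h i)) : IsTestFunction fun x => ∑ i ∈ t, h i x where
  continuous_zeroExt := by
    have : zeroExt (fun x => ∑ i ∈ t, h i x) = fun z => ∑ i ∈ t, zeroExt (h i) z := by
      ext z
      induction z using OnePoint.rec with
      | infty => simp [zeroExt]
      | coe x => rfl
    rw [this]
    exact continuous_finsetSum _ fun i _ => (hh i).continuous_zeroExt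
  bounded := by
    choose C hC using fun i => (hh i).bounded
    exact ⟨∑ i ∈ t, C i, fun x => by
      rw [ENNReal.ofNNReal_finsetSum]
      exact Finset.sum_le_sum fun i _ => hC i x⟩

/-- Compactness of the ball is what makes this cone function continuous at the cemetery. -/
lemma bump {S : Type*} [PseudoMetricSpace S] (x : S) {r : ℝ}
    (hr : IsCompact (Metric.closedBall x r)) :
    IsTestFunction fun y => ENNReal.ofReal (r - dist y x) where
  continuous_zeroExt := by
    rw [OnePoint.continuous_iff]
    refine ⟨?_, ?_⟩
    · refine tendsto_const_nhds.congr' ?_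
      have : (Metric.closedBall x r)ᶜ ∈ coclosedCompact S :=
        hr.compl_mem_coclosedCompact_of_isClosed Metric.isClosed_closedBall
      filter_upwards [this] with y hy
      rw [mem_compl_iff, Metric.mem_closedBall, not_le] at hy
      exact (ENNReal.ofReal_of_nonpos (by linarith)).symm
    · exact ENNReal.continuous_ofReal.comp (by fun_prop)
  bounded := ⟨r.toNNReal, fun y => ENNReal.ofReal_le_ofReal (by linarith [dist_nonneg (x := y) (y := x)])⟩

end IsTestFunction

namespace BorelRightProcess

variable {S : Type*} [PseudoMetricSpace S] {Ω : Type*} [MeasurableSpace Ω]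
  [MeasurableSpace S] [BorelSpace S] (𝒴 : BorelRightProcess S Ω)

lemma HasPotentialDensity.potential_eq {m : Measure S} {u : S → S → ℝ}
    (hu : 𝒴.HasPotentialDensity m u) {h : S → ℝ≥0∞} (hh : IsTestFunction h) (x : S) :
    𝒴.potential h x = ∫⁻ y, ENNReal.ofReal (u x y) * h y ∂m := by
  rw [← hu.2 x h hh.measurable, potential]
  have := 𝒴.isProbabilityMeasure x
  have hm : Measurable fun p : ℝ≥0 × Ω => zeroExt h (𝒴.Y p.1 p.2) :=
    measurable_uncurry_of_rightContinuous (f := fun t ω => zeroExt h (𝒴.Y t ω))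
      (fun t => 𝒴.measurable_zeroExt_Y t hh.measurable)
      fun ω t => 𝒴.zeroExt_comp_rightContinuous hh ω t
  rw [lintegral_lintegral_swap]
  · rfl
  · exact (hm.comp (f := fun q : Ω × ℝ => (q.2.toNNReal, q.1))
      ((measurable_real_toNNReal.comp measurable_snd).prodMk measurable_fst)).aemeasurable

/-- Right-continuity of the paths keeps P_t h(x) nonzero for small t. Read through the potential
density, this shows that `m` charges the bumps, which can therefore be normalized. -/
lemma potential_pos {h : S → ℝ≥0∞} (hh : IsTestFunction h) {x : S} (hx : h x ≠ 0) :
    𝒴.potential h x ≠ 0 := by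
  have h0 : 𝒴.semigroup 0 h x = h x := by
    have : 𝒴.semigroup 0 h x = ∫⁻ _, h x ∂(𝒴.P x) := by
      refine lintegral_congr_ae ?_
      filter_upwards [𝒴.start x] with ω hω
      simp [hω, zeroExt]
    have := 𝒴.isProbabilityMeasure x
    simp [*]
  have h1 : ∀ᶠ t in 𝓝[≥] (0 : ℝ≥0), 𝒴.semigroup t h x ≠ 0 :=
    (𝒴.lintegral_zeroExt_rightContinuous hh x 0).eventually_ne (by
      change 𝒴.semigroup 0 h x ≠ 0
      rwa [h0])
  obtain ⟨δ, hδ, hδ'⟩ : ∃ δ : ℝ≥0, 0 < δ ∧ ∀ t < δ, 𝒴.semigroup t h x ≠ 0 := by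
    obtain ⟨δ, hδ, hsub⟩ := mem_nhdsGE_iff_exists_Ico_subset.1 h1
    exact ⟨δ, hδ, fun t ht => hsub ⟨by positivity, ht⟩⟩
  intro h2
  have hm : Measurable fun t : ℝ => 𝒴.semigroup t.toNNReal h x :=
    (𝒴.measurable_semigroup_time hh x).comp measurable_real_toNNReal
  rw [potential, lintegral_eq_zero_iff hm] at h2
  rw [EventuallyEq, ae_restrict_iff' measurableSet_Ioi] at h2
  have h3 : volume (Ioo (0 : ℝ) δ) = 0 := by
    refine measure_mono_null ?_ h2
    intro t ht
    simp only [mem_compl_iff, mem_ofPred_eq, Classical.not_imp]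
    exact ⟨ht.1, hδ' _ ((Real.toNNReal_lt_iff_lt_coe ht.1.le).2 ht.2)⟩
  rw [Real.volume_Ioo] at h3
  simp at h3
  exact hδ.ne' h3

/-- The domination principle for finite point charges. -/
theorem sum_potentialDensity_le [LocallyCompactSpace S] {m : Measure S}
    [IsFiniteMeasureOnCompacts m] {u : S → S → ℝ}
    (hu : 𝒴.HasPotentialDensity m u) (huc : Continuous fun p : S × S => u p.1 p.2)
    {ι : Type*} [Fintype ι] (x : ι → S) (a : ι → ℝ) {s : S → ℝ} (hs0 : ∀ y, 0 ≤ s y)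
    (hs : 𝒴.IsSupermedian fun y => ENNReal.ofReal (s y)) (hsc : ∀ i, ContinuousAt s (x i))
    (hle : ∀ i, 0 < a i → ∑ j, u (x i) (x j) * a j ≤ s (x i)) (z : S) :
    ∑ j, u z (x j) * a j ≤ s z := by
  set N := ∑ j, |a j| with hN
  have hN0 : 0 ≤ N := Finset.sum_nonneg fun j _ => abs_nonneg _
  -- Point charges are replaced by normalized bumps. With `N` the total variation of the charge,
  -- this costs εN when the hypothesis is checked and εN in the conclusion, while `s` moves by at
  -- most ε between nearby points.
  suffices H : ∀ ε > 0, ∑ j, u z (x j) * a j ≤ s z + ε * (1 + 2 * N) by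
    have h1 : Tendsto (fun ε : ℝ => s z + ε * (1 + 2 * N)) (𝓝[>] 0) (𝓝 (s z + 0 * (1 + 2 * N))) :=
      (Continuous.tendsto (by fun_prop) 0).mono_left nhdsWithin_le_nhds
    rw [zero_mul, add_zero] at h1
    exact ge_of_tendsto h1 (eventually_mem_nhdsWithin.mono fun ε hε => H ε hε)
  intro ε hε
  -- a radius adapted to all the points
  obtain ⟨r, hr, hrK, hru, hrs, hrz⟩ : ∃ r > 0, (∀ i, IsCompact (Metric.closedBall (x i) r)) ∧
      (∀ l i, ∀ w ∈ Metric.closedBall (x l) r, ∀ y ∈ Metric.closedBall (x i) r,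
        |u w y - u (x l) (x i)| ≤ ε) ∧
      (∀ l, ∀ w ∈ Metric.closedBall (x l) r, |s w - s (x l)| ≤ ε) ∧
      ∀ i, ∀ y ∈ Metric.closedBall (x i) r, |u z y - u z (x i)| ≤ ε := by
    have e1 : ∀ i, ∀ᶠ r in 𝓝[>] (0 : ℝ), IsCompact (Metric.closedBall (x i) r) := fun i => by
      obtain ⟨r₀, hr₀, hK⟩ := Metric.exists_isCompact_closedBall (x i)
      filter_upwards [Ioo_mem_nhdsGT hr₀] with r hr
      exact hK.of_isClosed_subset Metric.isClosed_closedBall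
        (Metric.closedBall_subset_closedBall hr.2.le)
    have e0 : ∀ {Y : Type _} [PseudoMetricSpace Y] (F : Y → ℝ) (y₀ : Y), ContinuousAt F y₀ →
        ∀ᶠ r in 𝓝[>] (0 : ℝ), ∀ y ∈ Metric.closedBall y₀ r, |F y - F y₀| ≤ ε := by
      intro Y _ F y₀ hF
      obtain ⟨δ, hδ, hδ'⟩ := Metric.continuousAt_iff.1 hF ε hε
      filter_upwards [Ioo_mem_nhdsGT hδ] with r hr y hy
      exact (hδ' (lt_of_le_of_lt hy hr.2)).le
    have e2 : ∀ l i, ∀ᶠ r in 𝓝[>] (0 : ℝ), ∀ w ∈ Metric.closedBall (x l) r,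
        ∀ y ∈ Metric.closedBall (x i) r, |u w y - u (x l) (x i)| ≤ ε := fun l i => by
      filter_upwards [e0 (fun p : S × S => u p.1 p.2) (x l, x i) huc.continuousAt] with r hr w hw
        y hy
      exact hr (w, y) (by rw [← closedBall_prod_same]; exact ⟨hw, hy⟩)
    have e3 : ∀ l, ∀ᶠ r in 𝓝[>] (0 : ℝ), ∀ w ∈ Metric.closedBall (x l) r, |s w - s (x l)| ≤ ε :=
      fun l => e0 s (x l) (hsc l)
    have e4 : ∀ i, ∀ᶠ r in 𝓝[>] (0 : ℝ), ∀ y ∈ Metric.closedBall (x i) r,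
        |u z y - u z (x i)| ≤ ε := fun i =>
      e0 (u z) (x i) (huc.comp (Continuous.prodMk_right z)).continuousAt
    obtain ⟨r, h1, h2, h3, h4, h5⟩ := ((eventually_all.2 e1).and ((eventually_all.2 fun l =>
      eventually_all.2 (e2 l)).and ((eventually_all.2 e3).and ((eventually_all.2 e4).and
        eventually_mem_nhdsWithin)))).exists
    exact ⟨r, h5, h1, h2, h3, h4⟩
  -- normalized bumps
  let b : ι → S → ℝ≥0∞ := fun i y => ENNReal.ofReal (r - dist y (x i))
  have hb : ∀ i, IsTestFunction (b i) := fun i => .bump (x i) (hrK i)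
  have hbsupp : ∀ i y, b i y ≠ 0 → y ∈ Metric.closedBall (x i) r := fun i y hy => by
    by_contra hy'
    rw [Metric.mem_closedBall, not_le] at hy'
    exact hy (ENNReal.ofReal_of_nonpos (by linarith))
  let c : ι → ℝ≥0∞ := fun i => ∫⁻ y, b i y ∂m
  have hc0 : ∀ i, c i ≠ 0 := fun i h0 => by
    have h1 : b i (x i) ≠ 0 := by simp [b, hr]
    refine 𝒴.potential_pos (hb i) h1 ?_
    rw [hu.potential_eq 𝒴 (hb i)]
    rw [lintegral_eq_zero_iff (hb i).measurable] at h0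
    refine lintegral_eq_zero_of_ae_eq_zero ?_
    filter_upwards [h0] with y hy
    simp [hy]
  have hctop : ∀ i, c i ≠ ⊤ := fun i => by
    refine ne_top_of_le_ne_top (b := ENNReal.ofReal r * m (Metric.closedBall (x i) r))
      (ENNReal.mul_ne_top ENNReal.ofReal_ne_top (hrK i).measure_lt_top.ne) ?_
    rw [← setLIntegral_const, ← lintegral_indicator Metric.isClosed_closedBall.measurableSet]
    refine lintegral_mono fun y => ?_
    by_cases hy : y ∈ Metric.closedBall (x i) r
    · rw [indicator_of_mem hy]
      exact ENNReal.ofReal_le_ofReal (by linarith [dist_nonneg (x := y) (y := x i)])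
    · have : b i y = 0 := by
        by_contra h
        exact hy (hbsupp i y h)
      simp [this]
  have hk : ∀ i, IsTestFunction fun y => ((c i)⁻¹.toNNReal : ℝ≥0∞) * b i y := fun i =>
    (hb i).const_mul _
  have hcinv : ∀ i, ((c i)⁻¹.toNNReal : ℝ≥0∞) = (c i)⁻¹ := fun i =>
    ENNReal.coe_toNNReal (ENNReal.inv_ne_top.2 (hc0 i))
  have hVle : ∀ i w v, (∀ y ∈ Metric.closedBall (x i) r, u w y ≤ v) →
      𝒴.potential (fun y => ((c i)⁻¹.toNNReal : ℝ≥0∞) * b i y) w ≤ ENNReal.ofReal v := by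
    intro i w v hv
    rw [hu.potential_eq 𝒴 (hk i), hcinv]
    calc ∫⁻ y, ENNReal.ofReal (u w y) * ((c i)⁻¹ * b i y) ∂m
        ≤ ∫⁻ y, ENNReal.ofReal v * (c i)⁻¹ * b i y ∂m := by
          refine lintegral_mono fun y => ?_
          rw [← mul_assoc]
          by_cases hy : b i y = 0
          · simp [hy]
          · exact mul_le_mul_left (mul_le_mul_left
              (ENNReal.ofReal_le_ofReal (hv y (hbsupp i y hy))) _) _
      _ = ENNReal.ofReal v := by
        rw [lintegral_const_mul _ (hb i).measurable, mul_assoc,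
          ENNReal.inv_mul_cancel (hc0 i) (hctop i), mul_one]
  have hVge : ∀ i w v, (∀ y ∈ Metric.closedBall (x i) r, v ≤ u w y) →
      ENNReal.ofReal v ≤ 𝒴.potential (fun y => ((c i)⁻¹.toNNReal : ℝ≥0∞) * b i y) w := by
    intro i w v hv
    rw [hu.potential_eq 𝒴 (hk i), hcinv]
    calc ENNReal.ofReal v = ∫⁻ y, ENNReal.ofReal v * (c i)⁻¹ * b i y ∂m := by
          rw [lintegral_const_mul _ (hb i).measurable, mul_assoc,
            ENNReal.inv_mul_cancel (hc0 i) (hctop i), mul_one]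
      _ ≤ ∫⁻ y, ENNReal.ofReal (u w y) * ((c i)⁻¹ * b i y) ∂m := by
          refine lintegral_mono fun y => ?_
          rw [← mul_assoc]
          by_cases hy : b i y = 0
          · simp [hy]
          · exact mul_le_mul_left (mul_le_mul_left
              (ENNReal.ofReal_le_ofReal (hv y (hbsupp i y hy))) _) _
  let h : (ι → ℝ≥0) → S → ℝ≥0∞ := fun q y =>
    ∑ i, (q i : ℝ≥0∞) * (((c i)⁻¹.toNNReal : ℝ≥0∞) * b i y)
  have hh : ∀ q, IsTestFunction (h q) := fun q => .sum _ fun i => (hk i).const_mul (q i)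
  have hpot : ∀ q w, 𝒴.potential (h q) w =
      ∑ i, (q i : ℝ≥0∞) * 𝒴.potential (fun y => ((c i)⁻¹.toNNReal : ℝ≥0∞) * b i y) w := by
    intro q w
    rw [hu.potential_eq 𝒴 (hh q)]
    have hum : Measurable fun y => ENNReal.ofReal (u w y) :=
      (huc.comp (Continuous.prodMk_right w)).measurable.ennreal_ofReal
    simp_rw [hu.potential_eq 𝒴 (hk _), h, Finset.mul_sum]
    rw [lintegral_finsetSum]
    · refine Finset.sum_congr rfl fun i _ => ?_
      rw [← lintegral_const_mul _ (show Measurable fun y => ENNReal.ofReal (u w y) *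
        (((c i)⁻¹.toNNReal : ℝ≥0∞) * b i y) from hum.mul (hk i).measurable)]
      exact lintegral_congr fun y => mul_left_comm _ _ _
    · exact fun i _ => hum.mul ((hk i).const_mul (q i)).measurable
  have hpotle : ∀ (q : ι → ℝ≥0) w (v : ι → ℝ), (∀ i, 0 ≤ v i) →
      (∀ i, ∀ y ∈ Metric.closedBall (x i) r, u w y ≤ v i) →
      𝒴.potential (h q) w ≤ ENNReal.ofReal (∑ i, q i * v i) := by
    intro q w v hv0 hv
    rw [hpot, ENNReal.ofReal_sum_of_nonneg fun i _ => mul_nonneg (NNReal.coe_nonneg (q i)) (hv0 i)]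
    refine Finset.sum_le_sum fun i _ => ?_
    rw [ENNReal.ofReal_mul (NNReal.coe_nonneg (q i))]
    exact mul_le_mul' (by simp) (hVle i w (v i) (hv i))
  have hpotge : ∀ (q : ι → ℝ≥0) w (v : ι → ℝ),
      (∀ i, ∀ y ∈ Metric.closedBall (x i) r, v i ≤ u w y) →
      ENNReal.ofReal (∑ i, q i * v i) ≤ 𝒴.potential (h q) w := by
    intro q w v hv
    rw [hpot]
    refine (ENNReal.ofReal_le_ofReal (Finset.sum_le_sum fun i _ =>
      mul_le_mul_of_nonneg_left (le_max_left (v i) 0) (NNReal.coe_nonneg (q i)))).trans ?_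
    rw [ENNReal.ofReal_sum_of_nonneg fun i _ => mul_nonneg (NNReal.coe_nonneg (q i)) (le_max_right _ _)]
    refine Finset.sum_le_sum fun i _ => ?_
    rw [ENNReal.ofReal_mul (NNReal.coe_nonneg (q i))]
    refine mul_le_mul' (by simp) ?_
    rcases le_total (v i) 0 with h | h
    · simp [max_eq_right h]
    · rw [max_eq_left h]
      exact hVge i w (v i) (hv i)
  set p : ι → ℝ≥0 := fun i => (a i).toNNReal with hp
  set q : ι → ℝ≥0 := fun i => (-a i).toNNReal with hq
  have hpq : ∀ i, (p i : ℝ) - q i = a i := fun i => by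
    simp only [hp, hq, Real.coe_toNNReal']
    rcases le_total (a i) 0 with h | h
    · rw [max_eq_right h, max_eq_left (by linarith)]; ring
    · rw [max_eq_left h, max_eq_right (by linarith)]; ring
  have hpqN : ∑ i, ((p i : ℝ) + q i) = N := by
    refine Finset.sum_congr rfl fun i _ => ?_
    simp only [hp, hq, Real.coe_toNNReal']
    rcases le_total (a i) 0 with h | h
    · rw [max_eq_right h, max_eq_left (by linarith), abs_of_nonpos h]; ring
    · rw [max_eq_left h, max_eq_right (by linarith), abs_of_nonneg h]; ring
  have hsum : ∀ w' : S, ∑ i, (p i : ℝ) * (u w' (x i) + ε) - ∑ i, (q i : ℝ) * (u w' (x i) - ε) =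
      ∑ i, u w' (x i) * a i + ε * N := by
    intro w'
    rw [← hpqN, Finset.mul_sum, ← Finset.sum_sub_distrib, ← Finset.sum_add_distrib]
    refine Finset.sum_congr rfl fun i _ => ?_
    rw [← hpq i]
    ring
  have hsum' : ∑ i, (p i : ℝ) * (u z (x i) - ε) - ∑ i, (q i : ℝ) * (u z (x i) + ε) =
      ∑ i, u z (x i) * a i - ε * N := by
    rw [← hpqN, Finset.mul_sum, ← Finset.sum_sub_distrib, ← Finset.sum_sub_distrib]
    refine Finset.sum_congr rfl fun i _ => ?_
    rw [← hpq i]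
    ring
  -- The potential of the negative part of the charge is itself supermedian and joins the majorant.
  -- A positive charge remains, to which `potential_le_of_le` applies.
  have hσ : 𝒴.IsSupermedian fun y => (𝒴.potential (h q) y + ENNReal.ofReal (s y)) +
      ENNReal.ofReal (ε * (1 + N)) :=
    ((𝒴.isSupermedian_potential (hh q)).add hs).add (.const _)
  have hmain := 𝒴.potential_le_of_le (hh p) hσ (fun w hw => ?_) z
  · have h1 := hpotge p z (fun i => u z (x i) - ε) fun i y hy => by
      linarith [(abs_le.1 (hrz i y hy)).1]
    have h2 := hpotle q z (fun i => u z (x i) + ε) (fun i => add_nonneg (hu.1 _ _) hε.le)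
      fun i y hy => by linarith [(abs_le.1 (hrz i y hy)).2]
    have h3 : ENNReal.ofReal (∑ i, (p i : ℝ) * (u z (x i) - ε)) ≤
        ENNReal.ofReal (∑ i, (q i : ℝ) * (u z (x i) + ε) + s z + ε * (1 + N)) := by
      have hq0 : 0 ≤ ∑ i, (q i : ℝ) * (u z (x i) + ε) := Finset.sum_nonneg fun i _ =>
        mul_nonneg (NNReal.coe_nonneg (q i)) (add_nonneg (hu.1 _ _) hε.le)
      rw [ENNReal.ofReal_add (add_nonneg hq0 (hs0 z)) (by positivity),
        ENNReal.ofReal_add hq0 (hs0 z)]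
      exact h1.trans (hmain.trans (by gcongr))
    rw [ENNReal.ofReal_le_ofReal_iff (add_nonneg (add_nonneg (Finset.sum_nonneg fun i _ =>
      mul_nonneg (NNReal.coe_nonneg (q i)) (add_nonneg (hu.1 _ _) hε.le)) (hs0 z)) (by positivity))] at h3
    linarith [hsum']
  · obtain ⟨l, hl⟩ : ∃ l, (p l : ℝ≥0∞) * (((c l)⁻¹.toNNReal : ℝ≥0∞) * b l w) ≠ 0 := by
      by_contra hcon
      push Not at hcon
      exact hw (Finset.sum_eq_zero fun i _ => hcon i)
    have hpl : 0 < a l := by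
      by_contra hneg
      exact hl (by simp [hp, Real.toNNReal_of_nonpos (not_lt.1 hneg)])
    have hwl : w ∈ Metric.closedBall (x l) r := hbsupp l w fun h0 => hl (by simp [h0])
    have h1 := hpotle p w (fun i => u (x l) (x i) + ε) (fun i => add_nonneg (hu.1 _ _) hε.le)
      fun i y hy => by linarith [(abs_le.1 (hru l i w hwl y hy)).2]
    have h2 := hpotge q w (fun i => u (x l) (x i) - ε)
      fun i y hy => by linarith [(abs_le.1 (hru l i w hwl y hy)).1]
    refine h1.trans ?_
    calc ENNReal.ofReal (∑ i, (p i : ℝ) * (u (x l) (x i) + ε))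
        ≤ ENNReal.ofReal (∑ i, (q i : ℝ) * (u (x l) (x i) - ε) + s w + ε * (1 + N)) := by
          refine ENNReal.ofReal_le_ofReal ?_
          linarith [hsum (x l), hle l hpl, (abs_le.1 (hrs l w hwl)).1]
      _ ≤ _ := ENNReal.ofReal_add_le.trans (add_le_add (ENNReal.ofReal_add_le.trans
          (add_le_add h2 le_rfl)) le_rfl)

end BorelRightProcess

end

noncomputable section

-- Writing the diagonal matrix as Q² turns the determinant into that of 1 + Q V Q, and Q V Q is
-- positive semidefinite.
open Matrix in
lemma Matrix.PosSemidef.det_one_add_mul_diagonal_pos {ι : Type*} [Fintype ι] [DecidableEq ι]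
    {V : Matrix ι ι ℝ} (hV : V.PosSemidef) (s : ι → ℝ≥0) :
    0 < (1 + V * diagonal fun i => (s i : ℝ)).det := by
  let Q : Matrix ι ι ℝ := diagonal fun i => √(s i : ℝ)
  have hQ : diagonal (fun i => (s i : ℝ)) = Q * Q := by
    rw [diagonal_mul_diagonal]
    congr 1
    ext i
    exact (Real.mul_self_sqrt (NNReal.coe_nonneg _)).symm
  have hQt : Qᴴ = Q := by
    rw [conjTranspose_eq_transpose_of_trivial]
    exact diagonal_transpose _
  rw [hQ, ← Matrix.mul_assoc, det_one_add_mul_comm, ← Matrix.mul_assoc]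
  have h1 : (Q * V * Q).PosSemidef := by
    have := hV.mul_mul_conjTranspose_same Q
    rwa [hQt] at this
  exact (PosDef.one.add_posSemidef h1).det_pos

/-! ### Kernels satisfying the domination principle -/

/-- The domination principle for finite point charges on `J` and the majorant `s`. -/
def IsDominatedBy (u : ℝ → ℝ → ℝ) (J : Set ℝ) (s : ℝ → ℝ) : Prop :=
  ∀ t : Finset ℝ, ↑t ⊆ J → ∀ a : ℝ → ℝ,
    (∀ x ∈ t, 0 < a x → ∑ y ∈ t, u x y * a y ≤ s x) → ∀ z ∈ J, ∑ y ∈ t, u z y * a y ≤ s z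

lemma BorelRightProcess.isDominatedBy {T : Set ℝ} (hT : IsOpen T) {Ω : Type*} [MeasurableSpace Ω]
    (𝒴 : BorelRightProcess T Ω) {m : Measure T} [IsFiniteMeasureOnCompacts m] {u : ℝ → ℝ → ℝ}
    (hu : 𝒴.HasPotentialDensity m fun x y => u x y)
    (huc : Continuous fun p : ℝ × ℝ => u p.1 p.2) {J : Set ℝ} (hJ : J ⊆ T) {s : ℝ → ℝ}
    (hs0 : ∀ y : T, 0 ≤ s y) (hs : 𝒴.IsSupermedian fun y => ENNReal.ofReal (s y))
    (hsc : ∀ x ∈ J, ContinuousAt s x) : IsDominatedBy u J s := by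
  intro t ht a hle z hz
  have : LocallyCompactSpace T := hT.locallyCompactSpace
  have hconv : ∀ w, ∑ y ∈ t, u w y * a y = ∑ y : t, u w y * a y := fun w =>
    (Finset.sum_coe_sort t fun y => u w y * a y).symm
  have := 𝒴.sum_potentialDensity_le hu
    (huc.comp ((continuous_subtype_val.comp continuous_fst).prodMk
      (continuous_subtype_val.comp continuous_snd)))
    (fun y : t => (⟨y, hJ (ht y.2)⟩ : T)) (fun y => a y) (s := fun y => s y) hs0 hs
    (fun y => (hsc y (ht y.2)).comp (f := fun y : T => (y : ℝ)) continuous_subtype_val.continuousAt)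
    (fun y hy => by
      rw [← hconv]
      exact hle y y.2 hy) ⟨z, hJ hz⟩
  rwa [hconv]

/-- A positive symmetric kernel on `J` satisfying the domination principle for constants. -/
structure IsDominationKernel (u : ℝ → ℝ → ℝ) (J : Set ℝ) : Prop where
  symm : ∀ x y, u x y = u y x
  nonneg : ∀ x ∈ J, ∀ y ∈ J, 0 ≤ u x y
  diag_pos : ∀ x ∈ J, 0 < u x x
  lt_diag : ∀ x ∈ J, ∀ y ∈ J, y < x → u x y < u x x
  dominatedBy_zero : IsDominatedBy u J fun _ => 0
  dominatedBy_one : IsDominatedBy u J fun _ => 1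

lemma exists_charge_of_injective {u : ℝ → ℝ → ℝ} {t : Finset ℝ}
    (h : ∀ a : ℝ → ℝ, (∀ x ∈ t, ∑ y ∈ t, u x y * a y = 0) → ∀ x ∈ t, a x = 0) (r : ℝ → ℝ) :
    ∃ c : ℝ → ℝ, ∀ x ∈ t, ∑ y ∈ t, u x y * c y = r x := by
  classical
  let M : Matrix t t ℝ := Matrix.of fun x y => u x y
  have hinj : Function.Injective M.mulVecLin := by
    refine (injective_iff_map_eq_zero _).2 fun v hv => ?_
    ext x
    let a : ℝ → ℝ := fun y => if hy : y ∈ t then v ⟨y, hy⟩ else 0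
    have ha : ∀ y : t, a y = v y := fun y => by simp [a]
    have := h a (fun x hx => by
      have h1 := congrFun hv ⟨x, hx⟩
      rw [← Finset.sum_coe_sort t fun y => u x y * a y]
      simp_rw [ha]
      exact h1) x x.2
    rwa [ha] at this
  obtain ⟨v, hv⟩ := LinearMap.injective_iff_surjective.1 hinj fun x => r x
  refine ⟨fun y => if hy : y ∈ t then v ⟨y, hy⟩ else 0, fun x hx => ?_⟩
  rw [← Finset.sum_coe_sort t]
  have h1 := congrFun hv ⟨x, hx⟩
  simpa [M, Matrix.mulVec, dotProduct] using h1

namespace IsDominationKernel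

variable {u : ℝ → ℝ → ℝ} {J : Set ℝ} (h : IsDominationKernel u J)
include h

omit h in
/-- A nonsingular charge whose potential equals an admissible majorant is nonnegative. -/
lemma charge_nonneg {s : ℝ → ℝ} (hs : IsDominatedBy u J s) {t : Finset ℝ} (ht : ↑t ⊆ J)
    (hinj : ∀ a : ℝ → ℝ, (∀ x ∈ t, ∑ y ∈ t, u x y * a y = 0) → ∀ x ∈ t, a x = 0)
    {b : ℝ → ℝ} (hb : ∀ x ∈ t, ∑ y ∈ t, u x y * b y = s x) : ∀ x ∈ t, 0 ≤ b x := by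
  intro i hi
  by_contra hneg
  rw [not_le] at hneg
  -- The charge `c` has potential 1 at `i` and 0 on the rest of `t`. For small ε > 0 the charge b +
  -- εc is still nonpositive at `i`, so domination only has to be tested off `i`, where its
  -- potential equals `s`. Yet at `i` the potential is s + ε.
  obtain ⟨c, hc⟩ := exists_charge_of_injective hinj (Pi.single i 1)
  obtain ⟨ε, hε, hεi⟩ : ∃ ε > 0, b i + ε * c i ≤ 0 := by
    refine ⟨-b i / (|c i| + 1), by have := abs_nonneg (c i); apply div_pos <;> linarith, ?_⟩
    have h1 : -b i / (|c i| + 1) * c i ≤ -b i := by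
      rw [div_mul_eq_mul_div, div_le_iff₀ (by positivity)]
      nlinarith [le_abs_self (c i)]
    linarith
  have hpot : ∀ x ∈ t, ∑ y ∈ t, u x y * (b y + ε * c y) = s x + ε * (Pi.single i 1 : ℝ → ℝ) x := by
    intro x hx
    rw [← hb x hx, ← hc x hx, Finset.mul_sum, ← Finset.sum_add_distrib]
    exact Finset.sum_congr rfl fun y _ => by ring
  have := hs t ht (fun y => b y + ε * c y) (fun x hx hpos => ?_) i (ht hi)
  · rw [hpot i hi] at this
    simp at this
    linarith
  · have hxi : x ≠ i := by
      rintro rfl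
      exact absurd hpos (not_lt.2 hεi)
    rw [hpot x hx]
    simp [hxi]

/-- Finite point charges are determined by their potential. -/
theorem charge_eq_zero (t : Finset ℝ) (ht : ↑t ⊆ J) (a : ℝ → ℝ)
    (ha : ∀ x ∈ t, ∑ y ∈ t, u x y * a y = 0) : ∀ x ∈ t, a x = 0 := by
  classical
  -- The new point `x` lies to the right of `t`, so u(x, y) < u(x, x) for y in `t`. A relation
  -- involving `x` would give the unit charge at `x` the same potential as a nonnegative charge `b`
  -- on `t` of mass at most 1, and evaluating at `x` yields u(x, x) < u(x, x).
  induction t using Finset.induction_on_max generalizing a with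
  | empty => simp
  | insert x t hlt ih =>
    have hxt : x ∉ t := fun hx => lt_irrefl _ (hlt x hx)
    have htJ : ↑t ⊆ J := fun y hy => ht (by simp_all)
    have hxJ : x ∈ J := ht (by simp)
    have hinj := ih htJ
    simp only [Finset.sum_insert hxt] at ha
    by_cases hax : a x = 0
    · have h1 := hinj a fun z hz => by
        have := ha z (Finset.mem_insert_of_mem hz)
        simpa [hax] using this
      intro z hz
      rcases Finset.mem_insert.1 hz with rfl | hz
      · exact hax
      · exact h1 z hz
    · exfalso
      let b : ℝ → ℝ := fun y => -a y / a x
      have hb : ∀ z ∈ insert x t, ∑ y ∈ t, u z y * b y = u z x := by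
        intro z hz
        have h1 := ha z hz
        have h2 : ∑ y ∈ t, u z y * b y = -(∑ y ∈ t, u z y * a y) / a x := by
          rw [← Finset.sum_neg_distrib, Finset.sum_div]
          exact Finset.sum_congr rfl fun y _ => by simp only [b]; ring
        rw [h2, eq_comm, eq_div_iff hax]
        linarith
      -- Domination by the potential of a unit charge at `x` is domination by 0 after subtracting
      -- that charge. The cases are whether `x` already belongs to the support.
      have hux : IsDominatedBy u J fun z => u z x := by
        intro t' ht' a' hle z hz
        by_cases hxt' : x ∈ t'
        · have := h.dominatedBy_zero t' ht' (fun y => a' y - if y = x then 1 else 0)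
            (fun y hy hpos => by
              have h1 : 0 < a' y := by
                by_cases hyx : y = x
                · simp [hyx] at hpos
                  subst hyx
                  linarith
                · simpa [hyx] using hpos
              have := hle y hy h1
              simp only [mul_sub, Finset.sum_sub_distrib, mul_ite, mul_one, mul_zero,
                Finset.sum_ite_eq', hxt', if_true]
              linarith) z hz
          simp only [mul_sub, Finset.sum_sub_distrib, mul_ite, mul_one, mul_zero,
            Finset.sum_ite_eq', hxt', if_true] at this
          linarith
        · have hne : ∀ y ∈ t', y ≠ x := fun y hy hyx => hxt' (hyx ▸ hy)
          have hsum : ∀ w, ∑ y ∈ insert x t', u w y * (if y = x then -1 else a' y) =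
              ∑ y ∈ t', u w y * a' y - u w x := by
            intro w
            rw [Finset.sum_insert hxt']
            have : ∑ y ∈ t', u w y * (if y = x then -1 else a' y) = ∑ y ∈ t', u w y * a' y :=
              Finset.sum_congr rfl fun y hy => by simp [hne y hy]
            rw [this]
            simp
            ring
          have := h.dominatedBy_zero (insert x t') (by
            intro y hy
            rcases Finset.mem_insert.1 (Finset.mem_coe.1 hy) with rfl | hy
            · exact hxJ
            · exact ht' hy) (fun y => if y = x then -1 else a' y) (fun y hy hpos => by
              rcases Finset.mem_insert.1 hy with rfl | hy
              · simp at hpos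
                linarith
              · rw [hsum]
                have := hle y hy (by simpa [hne y hy] using hpos)
                linarith) z hz
          rw [hsum] at this
          linarith
      have hb0 : ∀ y ∈ t, 0 ≤ b y :=
        charge_nonneg hux htJ hinj fun z hz => hb z (Finset.mem_insert_of_mem hz)
      obtain ⟨e, he⟩ := exists_charge_of_injective hinj fun _ => 1
      have hex : ∑ y ∈ t, u x y * e y ≤ 1 :=
        h.dominatedBy_one t htJ e (fun z hz _ => (he z hz).le) x hxJ
      -- The potential of the equilibrium charge `e` is 1 on `t` and at most 1 at `x`. Pairing it
      -- with `b` and using the symmetry of `u` gives the mass of `b` on one side and the potential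
      -- of `e` at `x` on the other.
      have hb1 : ∑ y ∈ t, b y ≤ 1 := by
        calc ∑ y ∈ t, b y = ∑ y ∈ t, ∑ z ∈ t, u y z * e z * b y := by
              refine Finset.sum_congr rfl fun y hy => ?_
              rw [← Finset.sum_mul, he y hy, one_mul]
          _ = ∑ z ∈ t, ∑ y ∈ t, u z y * b y * e z := by
              rw [Finset.sum_comm]
              refine Finset.sum_congr rfl fun z _ => Finset.sum_congr rfl fun y _ => ?_
              rw [h.symm y z]
              ring
          _ = ∑ z ∈ t, u x z * e z := by
              refine Finset.sum_congr rfl fun z hz => ?_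
              rw [← Finset.sum_mul, hb z (Finset.mem_insert_of_mem hz), h.symm z x]
          _ ≤ 1 := hex
      have hbx := hb x (Finset.mem_insert_self _ _)
      have hpos := h.diag_pos x hxJ
      by_cases hall : ∀ y ∈ t, b y = 0
      · rw [Finset.sum_eq_zero fun y hy => by rw [hall y hy, mul_zero]] at hbx
        linarith
      · push Not at hall
        obtain ⟨y₀, hy₀, hne⟩ := hall
        have hlt' : ∑ y ∈ t, u x y * b y < ∑ y ∈ t, u x x * b y := by
          refine Finset.sum_lt_sum (fun y hy => mul_le_mul_of_nonneg_right
            (h.lt_diag x hxJ y (htJ hy) (hlt y hy)).le (hb0 y hy)) ⟨y₀, hy₀, ?_⟩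
          exact mul_lt_mul_of_pos_right (h.lt_diag x hxJ y₀ (htJ hy₀) (hlt y₀ hy₀))
            (lt_of_le_of_ne (hb0 y₀ hy₀) hne.symm)
        rw [← Finset.mul_sum] at hlt'
        nlinarith

open Matrix

variable {ι : Type*} [Fintype ι] [DecidableEq ι] {x : ι → ℝ} (hx : Function.Injective x)
  (hxJ : ∀ i, x i ∈ J)
include hx hxJ

omit h [DecidableEq ι] in
lemma _root_.IsDominatedBy.mulVec_le {s : ℝ → ℝ} (hs : IsDominatedBy u J s) {a : ι → ℝ}
    (ha : ∀ i, 0 < a i → ((Matrix.of fun i j => u (x i) (x j)) *ᵥ a) i ≤ s (x i)) (i : ι) :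
    ((Matrix.of fun i j => u (x i) (x j)) *ᵥ a) i ≤ s (x i) := by
  classical
  have hext : ∀ z, ∑ y ∈ Finset.univ.image x, u z y * Function.extend x a 0 y =
      ∑ j, u z (x j) * a j := fun z => by
    rw [Finset.sum_image fun i _ j _ hij => hx hij]
    simp [hx.extend_apply]
  have := hs (Finset.univ.image x) (by intro y hy; simp at hy; obtain ⟨i, rfl⟩ := hy; exact hxJ i)
    (Function.extend x a 0) (fun y hy hpos => by
      simp only [Finset.mem_image, Finset.mem_univ, true_and] at hy
      obtain ⟨j, rfl⟩ := hy
      rw [hx.extend_apply] at hpos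
      rw [hext]
      exact ha j hpos) (x i) (hxJ i)
  rwa [hext] at this

lemma isUnit_det : IsUnit (Matrix.of fun i j => u (x i) (x j)).det := by
  rw [← Matrix.isUnit_iff_isUnit_det, ← Matrix.mulVec_injective_iff_isUnit]
  refine (injective_iff_map_eq_zero (Matrix.mulVecLin _)).2 fun a ha => ?_
  ext i
  have hext : ∀ z, ∑ y ∈ Finset.univ.image x, u z y * Function.extend x a 0 y =
      ∑ j, u z (x j) * a j := fun z => by
    rw [Finset.sum_image fun i _ j _ hij => hx hij]
    simp [hx.extend_apply]
  have := h.charge_eq_zero (Finset.univ.image x)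
    (by intro y hy; simp at hy; obtain ⟨i, rfl⟩ := hy; exact hxJ i) (Function.extend x a 0)
    (fun y hy => by
      simp only [Finset.mem_image, Finset.mem_univ, true_and] at hy
      obtain ⟨j, rfl⟩ := hy
      rw [hext]
      exact congrFun ha j) (x i) (by simp)
  rwa [hx.extend_apply] at this

/-- This is the perturbation argument of `charge_nonneg` in matrix form. It serves for the majorants
`f`, `g` and 1. -/
lemma inv_mulVec_nonneg {s : ℝ → ℝ} (hs : IsDominatedBy u J s) (i : ι) :
    0 ≤ ((Matrix.of fun i j => u (x i) (x j))⁻¹ *ᵥ fun j => s (x j)) i := by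
  set U : Matrix ι ι ℝ := Matrix.of fun i j => u (x i) (x j) with hU
  have hUu := h.isUnit_det hx hxJ
  by_contra hneg
  rw [not_le] at hneg
  set b := U⁻¹ *ᵥ fun j => s (x j) with hb
  set c := U⁻¹ *ᵥ Pi.single i 1 with hc
  obtain ⟨ε, hε, hεi⟩ : ∃ ε > 0, b i + ε * c i ≤ 0 := by
    refine ⟨-b i / (|c i| + 1), by have := abs_nonneg (c i); apply div_pos <;> linarith, ?_⟩
    have h1 : -b i / (|c i| + 1) * c i ≤ -b i := by
      rw [div_mul_eq_mul_div, div_le_iff₀ (by positivity)]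
      nlinarith [le_abs_self (c i)]
    linarith
  have hpot : U *ᵥ (b + ε • c) = (fun j => s (x j)) + ε • Pi.single i 1 := by
    rw [mulVec_add, mulVec_smul, hb, hc, mulVec_mulVec, mulVec_mulVec, mul_nonsing_inv _ hUu,
      one_mulVec, one_mulVec]
  have := hs.mulVec_le hx hxJ (a := b + ε • c) (fun j hpos => ?_) i
  · rw [← hU, hpot] at this
    simp at this
    linarith
  · have hji : j ≠ i := by
      rintro rfl
      exact absurd hpos (not_lt.2 (by simpa using hεi))
    rw [← hU, hpot]
    simp [hji]

/-- If A_ij were positive, the charge A(δ_i - M δ_j) with M = |A_ii| / A_ij would be nonpositive at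
`i`, and its potential would be 1 at `i` and nonpositive elsewhere. This contradicts domination by
0. -/
lemma inv_offDiag_nonpos {i j : ι} (hij : i ≠ j) :
    (Matrix.of fun i j => u (x i) (x j))⁻¹ i j ≤ 0 := by
  set U : Matrix ι ι ℝ := Matrix.of fun i j => u (x i) (x j) with hU
  have hUu := h.isUnit_det hx hxJ
  by_contra hneg
  rw [not_le] at hneg
  set M := |U⁻¹ i i| / U⁻¹ i j with hM
  have hM0 : 0 ≤ M := div_nonneg (abs_nonneg _) hneg.le
  have hpot : U *ᵥ (U⁻¹ *ᵥ (Pi.single i 1 - M • Pi.single j 1)) =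
      Pi.single i 1 - M • Pi.single j 1 := by
    rw [mulVec_mulVec, mul_nonsing_inv _ hUu, one_mulVec]
  have := h.dominatedBy_zero.mulVec_le hx hxJ
    (a := U⁻¹ *ᵥ (Pi.single i 1 - M • Pi.single j 1)) (fun l hpos => ?_) i
  · rw [← hU, hpot] at this
    simp [hij] at this
    linarith
  · have hli : l ≠ i := by
      rintro rfl
      refine absurd hpos (not_lt.2 ?_)
      rw [mulVec_sub, mulVec_smul]
      simp only [Pi.sub_apply, Pi.smul_apply, smul_eq_mul, mulVec_single_one, Matrix.col_apply]
      rw [hM, div_mul_cancel₀ _ hneg.ne']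
      linarith [le_abs_self (U⁻¹ l l)]
    rw [← hU, hpot]
    by_cases hlj : l = j
    · subst hlj
      simpa [hli] using hM0
    · simp [hli, hlj]

/-- The covariance matrix of a domination kernel is an inverse M-matrix. -/
theorem isInverseMPair
    (hpsd : (Matrix.of fun i j => u (x i) (x j)).PosSemidef) :
    IsInverseMPair (Matrix.of fun i j => u (x i) (x j))
      (Matrix.of fun i j => u (x i) (x j))⁻¹ where
  mul_eq_one := nonsing_inv_mul _ (h.isUnit_det hx hxJ)
  symm := by
    ext i j
    simp [h.symm (x i) (x j)]
  nonneg i j := h.nonneg _ (hxJ i) _ (hxJ j)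
  off_diag i j hij := h.inv_offDiag_nonpos hx hxJ hij
  det_pos s := hpsd.det_one_add_mul_diagonal_pos s

end IsDominationKernel

end

noncomputable section

/-! ### Laplace transforms of squares of Gaussian vectors -/

section GaussianSquares

open Matrix WithLp
open scoped RealInnerProductSpace MatrixOrder

variable {ι κ : Type*} [Fintype ι] [DecidableEq ι] [Fintype κ] [DecidableEq κ]

lemma integral_exp_neg_mul_sq_gaussianReal {l : ℝ} (hl : 0 ≤ l) :
    ∫ x, Real.exp (-(l * x ^ 2 / 2)) ∂(gaussianReal 0 1) = (1 + l) ^ (-(1 / 2) : ℝ) := by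
  rw [integral_gaussianReal_eq_integral_smul one_ne_zero]
  have h1 : ∀ x : ℝ, gaussianPDFReal 0 1 x • Real.exp (-(l * x ^ 2 / 2)) =
      (√(2 * Real.pi))⁻¹ * Real.exp (-((1 + l) / 2) * x ^ 2) := by
    intro x
    rw [gaussianPDFReal, smul_eq_mul, mul_assoc, ← Real.exp_add]
    congr 2
    · simp
    · simp
      ring
  simp_rw [h1]
  rw [integral_const_mul, integral_gaussian, ← Real.sqrt_inv, ← Real.sqrt_mul (by positivity),
    Real.rpow_neg (by positivity), ← Real.sqrt_eq_rpow, ← Real.sqrt_inv]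
  congr 1
  field_simp

/-- The characteristic polynomial is evaluated at -1. -/
lemma Matrix.IsHermitian.det_one_add {M : Matrix ι ι ℝ} (hM : M.IsHermitian) :
    (1 + M).det = ∏ i, (1 + hM.eigenvalues i) := by
  have h1 := congrArg (Polynomial.eval (-1)) hM.charpoly_eq
  rw [Matrix.eval_charpoly, Polynomial.eval_prod] at h1
  have h2 : Matrix.scalar ι (-1 : ℝ) - M = -(1 + M) := by
    rw [neg_add, sub_eq_add_neg, map_neg, map_one]
  rw [h2, Matrix.det_neg] at h1
  have h3 : ∏ i, Polynomial.eval (-1) (Polynomial.X - Polynomial.C ((hM.eigenvalues i : ℝ))) =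
      (-1) ^ Fintype.card ι * ∏ i, (1 + hM.eigenvalues i) := by
    rw [← Finset.card_univ, ← Finset.prod_const, ← Finset.prod_mul_distrib]
    refine Finset.prod_congr rfl fun i _ => ?_
    simp
    ring
  erw [h3] at h1
  exact mul_left_cancel₀ (pow_ne_zero _ (by norm_num)) h1

/-- The standard Gaussian has independent coordinates in the eigenbasis of `M`, so the integral
factors into one-dimensional ones. -/
lemma integral_exp_neg_quadForm_stdGaussian {M : Matrix ι ι ℝ} (hM : M.PosSemidef) :
    ∫ x, Real.exp (-(⟪x, toEuclideanCLM (𝕜 := ℝ) M x⟫ / 2)) ∂(stdGaussian (EuclideanSpace ℝ ι)) =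
      (1 + M).det ^ (-(1 / 2) : ℝ) := by
  have hH := hM.isHermitian
  rw [stdGaussian_eq_map_pi_orthonormalBasis hH.eigenvectorBasis,
    integral_map (Measurable.aemeasurable (by fun_prop)) (by fun_prop)]
  have h1 : ∀ x : ι → ℝ, Real.exp (-(⟪∑ i, x i • hH.eigenvectorBasis i,
      toEuclideanCLM (𝕜 := ℝ) M (∑ i, x i • hH.eigenvectorBasis i)⟫ / 2)) =
      ∏ i, Real.exp (-(hH.eigenvalues i * x i ^ 2 / 2)) := by
    intro x
    have hb : ∀ i, toEuclideanCLM (𝕜 := ℝ) M (hH.eigenvectorBasis i) =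
        hH.eigenvalues i • hH.eigenvectorBasis i := by
      intro i
      ext j
      have := congrFun (hH.mulVec_eigenvectorBasis i) j
      simpa using this
    simp only [map_sum, map_smul, hb, smul_smul]
    rw [hH.eigenvectorBasis.orthonormal.inner_sum, ← Real.exp_sum, Finset.sum_neg_distrib,
      ← Finset.sum_div]
    congr 3
    refine Finset.sum_congr rfl fun i _ => ?_
    simp
    ring
  simp_rw [h1]
  rw [integral_fintype_prod_eq_prod (f := fun i x => Real.exp (-(hH.eigenvalues i * x ^ 2 / 2)))]
  simp_rw [integral_exp_neg_mul_sq_gaussianReal (hM.eigenvalues_nonneg _)]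
  rw [hH.det_one_add, Real.finsetProd_rpow]
  intro i _
  have := hM.eigenvalues_nonneg i
  positivity

/-- The vector is √V applied to a standard one, and det(1 + √V S √V) = det(1 + V S). -/
lemma integral_exp_neg_sum_sq_multivariateGaussian {V : Matrix ι ι ℝ} (hV : V.PosSemidef)
    (s : ι → ℝ≥0) :
    ∫ z, Real.exp (-∑ j, (s j : ℝ) * (z j ^ 2 / 2)) ∂(multivariateGaussian 0 V) =
      (1 + V * diagonal fun i => (s i : ℝ)).det ^ (-(1 / 2) : ℝ) := by
  set R := CFC.sqrt V with hR
  have hRR : R * R = V := CFC.sqrt_mul_sqrt_self _ hV.nonneg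
  have hRsa : Rᴴ = R := (CFC.sqrt_nonneg V).isSelfAdjoint
  set D : Matrix ι ι ℝ := diagonal fun i => (s i : ℝ) with hD
  have hDp : D.PosSemidef := PosSemidef.diagonal fun i => NNReal.coe_nonneg _
  have hM : (R * D * R).PosSemidef := by
    have := hDp.mul_mul_conjTranspose_same R
    rwa [hRsa] at this
  rw [multivariateGaussian, integral_map (by fun_prop) (by fun_prop), ← hRR, Matrix.mul_assoc,
    det_one_add_mul_comm, ← integral_exp_neg_quadForm_stdGaussian hM, hRR]
  congr 1
  ext x
  congr 2
  rw [map_mul, map_mul, mul_apply_eq_comp, mul_apply_eq_comp]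
  have h2 : ∀ y, ⟪x, toEuclideanCLM (𝕜 := ℝ) R y⟫ = ⟪toEuclideanCLM (𝕜 := ℝ) R x, y⟫ := by
    intro y
    have h3 : IsSelfAdjoint (toEuclideanCLM (n := ι) (𝕜 := ℝ) R) :=
      (CFC.sqrt_nonneg V).isSelfAdjoint.map _
    rw [← ContinuousLinearMap.adjoint_inner_left, h3.adjoint_eq]
  rw [h2, zero_add, PiLp.inner_apply, Finset.sum_div]
  refine Finset.sum_congr rfl fun j _ => ?_
  simp [hD, mulVec_diagonal]
  ring

lemma map_mulVec_multivariateGaussian {V : Matrix ι ι ℝ} (hV : V.PosSemidef) (B : Matrix κ ι ℝ) :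
    (multivariateGaussian 0 V).map (fun z => toLp 2 (B *ᵥ ofLp z)) =
      multivariateGaussian 0 (B * V * Bᵀ) := by
  have hBV : (B * V * Bᵀ).PosSemidef := by
    have := hV.mul_mul_conjTranspose_same B
    rwa [conjTranspose_eq_transpose_of_trivial] at this
  have hm : Measurable fun z : EuclideanSpace ℝ ι => toLp 2 (B *ᵥ ofLp z) :=
    (Continuous.comp (by fun_prop) (Continuous.matrix_mulVec continuous_const
      (by fun_prop))).measurable
  have : IsProbabilityMeasure ((multivariateGaussian 0 V).map
      (fun z => toLp 2 (B *ᵥ ofLp z))) := Measure.isProbabilityMeasure_map hm.aemeasurable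
  refine Measure.ext_of_charFun (funext fun t => ?_)
  rw [charFun_multivariateGaussian hBV, charFun_apply, integral_map hm.aemeasurable (by fun_prop)]
  have h1 : ∀ z : EuclideanSpace ℝ ι, ⟪toLp 2 (B *ᵥ ofLp z), t⟫ = ⟪z, toLp 2 (Bᵀ *ᵥ ofLp t)⟫ := by
    intro z
    rw [EuclideanSpace.inner_eq_star_dotProduct, EuclideanSpace.inner_eq_star_dotProduct]
    simp [dotProduct_mulVec, vecMul_transpose, dotProduct_comm]
  simp_rw [h1]
  rw [← charFun_apply, charFun_multivariateGaussian hV]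
  rw [← mulVec_mulVec, ← mulVec_mulVec, dotProduct_mulVec (ofLp t) B, ← mulVec_transpose]
  simp

/-- The law of half the sum of the squares of `k` independent centered Gaussian vectors with
covariance matrix `V`. -/
def gaussianSquares (V : Matrix ι ι ℝ) (k : ℕ) : Measure (ι → ℝ≥0) :=
  (Measure.pi fun _ : Fin k => multivariateGaussian 0 V).map
    fun z j => ∑ i, Real.toNNReal ((z i) j ^ 2 / 2)

omit [Fintype ι] [DecidableEq ι] in
lemma measurable_sum_sq (k : ℕ) : Measurable fun (z : Fin k → EuclideanSpace ℝ ι) (j : ι) =>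
    ∑ i, Real.toNNReal (z i j ^ 2 / 2) := by
  fun_prop

instance isProbabilityMeasure_gaussianSquares (V : Matrix ι ι ℝ) (k : ℕ) :
    IsProbabilityMeasure (gaussianSquares V k) :=
  Measure.isProbabilityMeasure_map (measurable_sum_sq k).aemeasurable

lemma laplace_gaussianSquares {V : Matrix ι ι ℝ} (hV : V.PosSemidef) (k : ℕ) (s : ι → ℝ≥0) :
    laplace (gaussianSquares V k) s =
      ENNReal.ofReal ((1 + V * diagonal fun i => (s i : ℝ)).det ^ (-((k : ℝ) / 2))) := by
  have hdet : 0 ≤ (1 + V * diagonal fun i => (s i : ℝ)).det :=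
    (hV.det_one_add_mul_diagonal_pos s).le
  rw [laplace, gaussianSquares, lintegral_map (measurable_laplace_kernel s) (measurable_sum_sq k)]
  have h1 : ∀ z : Fin k → EuclideanSpace ℝ ι,
      Real.exp (-∑ j, (s j : ℝ) * ((∑ i, Real.toNNReal (z i j ^ 2 / 2) : ℝ≥0) : ℝ)) =
        ∏ i, Real.exp (-∑ j, (s j : ℝ) * (z i j ^ 2 / 2)) := by
    intro z
    rw [← Real.exp_sum, Finset.sum_neg_distrib, Finset.sum_comm]
    congr 2
    refine Finset.sum_congr rfl fun j _ => ?_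
    rw [← Finset.mul_sum]
    congr 1
    rw [NNReal.coe_sum]
    exact Finset.sum_congr rfl fun i _ => Real.coe_toNNReal _ (by positivity)
  simp_rw [h1]
  rw [← ofReal_integral_eq_lintegral_ofReal, integral_fintype_prod_eq_pow
      (f := fun z : EuclideanSpace ℝ ι => Real.exp (-∑ j, (s j : ℝ) * (z j ^ 2 / 2))),
    integral_exp_neg_sum_sq_multivariateGaussian hV, Fintype.card_fin, ← Real.rpow_mul_natCast hdet]
  · congr 2
    ring
  · refine Integrable.of_bound (Measurable.aestronglyMeasurable (by fun_prop)) 1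
      (ae_of_all _ fun z => ?_)
    rw [Real.norm_of_nonneg (by positivity)]
    refine Finset.prod_le_one (fun _ _ => by positivity) fun i _ => ?_
    rw [Real.exp_le_one_iff, neg_nonpos]
    exact Finset.sum_nonneg fun j _ => by positivity
  · exact ae_of_all _ fun z => by positivity

/-- Rotation invariance of independent copies of a centered Gaussian vector. -/
lemma map_sum_smul_pi_multivariateGaussian {V : Matrix ι ι ℝ} (hV : V.PosSemidef) {k : ℕ}
    (c : Fin k → ℝ) :
    (Measure.pi fun _ : Fin k => multivariateGaussian 0 V).map (fun w => ∑ i, c i • w i) =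
      (multivariateGaussian 0 V).map (fun w => √(∑ i, c i ^ 2) • w) := by
  have hm : Measurable fun w : Fin k → EuclideanSpace ℝ ι => ∑ i, c i • w i := by fun_prop
  have := Measure.isProbabilityMeasure_map (μ := Measure.pi fun _ : Fin k =>
    multivariateGaussian 0 V) hm.aemeasurable
  have hm' : Measurable fun w : EuclideanSpace ℝ ι => √(∑ i, c i ^ 2) • w := by fun_prop
  have := Measure.isProbabilityMeasure_map (μ := multivariateGaussian 0 V) hm'.aemeasurable
  refine Measure.ext_of_charFun (funext fun t => ?_)
  rw [charFun_map_smul, charFun_apply, integral_map hm.aemeasurable (by fun_prop)]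
  simp_rw [sum_inner, Complex.ofReal_sum, Finset.sum_mul, Complex.exp_sum]
  rw [integral_fintype_prod_eq_prod
    (f := fun i (w : EuclideanSpace ℝ ι) => Complex.exp (⟪c i • w, t⟫ * Complex.I))]
  have h1 : ∀ i (w : EuclideanSpace ℝ ι), ⟪c i • w, t⟫ = ⟪w, c i • t⟫ := fun i w => by
    rw [real_inner_smul_left, real_inner_smul_right]
  simp_rw [h1, ← charFun_apply, charFun_multivariateGaussian hV]
  rw [← Complex.exp_sum]
  have h2 : ∀ r : ℝ, ((ofLp (r • t) ⬝ᵥ V *ᵥ ofLp (r • t) : ℝ) : ℂ) =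
      ((r ^ 2 : ℝ) : ℂ) * ((ofLp t ⬝ᵥ V *ᵥ ofLp t : ℝ) : ℂ) := fun r => by
    rw [← Complex.ofReal_mul]
    congr 1
    simp [mulVec_smul]
    ring
  simp_rw [h2]
  rw [Real.sq_sqrt (Finset.sum_nonneg fun i _ => sq_nonneg _)]
  congr 1
  simp [Finset.sum_mul, Finset.sum_div]

/-- The matrix of the residuals of the regression of a vector with covariance matrix `V` on its
`o`-th coordinate. -/
def residualMatrix (V : Matrix ι ι ℝ) (o : ι) : Matrix ι ι ℝ :=
  1 - Matrix.of fun j l => if l = o then V j o / V o o else 0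

lemma residualMatrix_mulVec (V : Matrix ι ι ℝ) (o : ι) (z : ι → ℝ) (j : ι) :
    (residualMatrix V o *ᵥ z) j = z j - V j o / V o o * z o := by
  rw [residualMatrix, sub_mulVec, one_mulVec, Pi.sub_apply]
  simp [mulVec, dotProduct]

/-- The covariance matrix of the residuals. -/
def residualCov (V : Matrix ι ι ℝ) (o : ι) : Matrix ι ι ℝ :=
  residualMatrix V o * V * (residualMatrix V o)ᵀ

lemma posSemidef_residualCov {V : Matrix ι ι ℝ} (hV : V.PosSemidef) (o : ι) :
    (residualCov V o).PosSemidef := by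
  have := hV.mul_mul_conjTranspose_same (residualMatrix V o)
  rwa [conjTranspose_eq_transpose_of_trivial] at this

lemma measurable_residual (V : Matrix ι ι ℝ) (o : ι) :
    Measurable fun z : EuclideanSpace ℝ ι => toLp 2 (residualMatrix V o *ᵥ ofLp z) :=
  (Continuous.comp (by fun_prop) (Continuous.matrix_mulVec continuous_const
    (by fun_prop))).measurable

/-- The residuals are uncorrelated with the `o`-th coordinate and jointly Gaussian with it, hence
independent of it. -/
lemma map_prodMk_residual {V : Matrix ι ι ℝ} (hV : V.PosSemidef) {o : ι} (ho : V o o ≠ 0) :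
    (multivariateGaussian 0 V).map
        (fun z => (z o, toLp 2 (residualMatrix V o *ᵥ ofLp z))) =
      (gaussianReal 0 (V o o).toNNReal).prod (multivariateGaussian 0 (residualCov V o)) := by
  have h1 : (multivariateGaussian 0 V).map (fun z => z o) = gaussianReal 0 (V o o).toNNReal :=
    (measurePreserving_eval_multivariateGaussian hV).map_eq
  have h2 : (multivariateGaussian 0 V).map
      (fun z => toLp 2 (residualMatrix V o *ᵥ ofLp z)) = multivariateGaussian 0 (residualCov V o) :=
    map_mulVec_multivariateGaussian hV _
  rw [← h1, ← h2]
  have hind : IndepFun (fun (z : EuclideanSpace ℝ ι) (_ : Unit) => z o)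
      (fun (z : EuclideanSpace ℝ ι) j => z j - V j o / V o o * z o) (multivariateGaussian 0 V) := by
    refine HasGaussianLaw.indepFun_of_covariance_eval (X := fun (_ : Unit) (z : EuclideanSpace ℝ ι) => z o)
      (Y := fun j (z : EuclideanSpace ℝ ι) => z j - V j o / V o o * z o) ?_ fun _ j => ?_
    · let L : EuclideanSpace ℝ ι →ₗ[ℝ] (Unit → ℝ) × (ι → ℝ) :=
        { toFun := fun z => (fun _ => z o, fun j => z j - V j o / V o o * z o)
          map_add' := fun x y => by
            ext <;> simp
            ring
          map_smul' := fun c x => by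
            ext <;> simp
            ring }
      have := (IsGaussian.hasGaussianLaw_id (μ := multivariateGaussian 0 V)).map_fun
        (LinearMap.toContinuousLinearMap L)
      exact this
    · have hL : ∀ i, MemLp (fun z : EuclideanSpace ℝ ι => z i) 2 (multivariateGaussian 0 V) :=
        fun i => IsGaussian.memLp_two_id.eval_piLp i
      rw [covariance_fun_sub_right (hL o) (hL j) ((hL o).const_mul _),
        covariance_const_mul_right, covariance_eval_multivariateGaussian hV,
        covariance_eval_multivariateGaussian hV]
      have hs : V o j = V j o := by simpa using hV.isHermitian.apply j o
      rw [hs]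
      field_simp
      ring
  have hind' : IndepFun (fun z : EuclideanSpace ℝ ι => z o)
      (fun z => toLp 2 (residualMatrix V o *ᵥ ofLp z)) (multivariateGaussian 0 V) := by
    have hm : Measurable fun x : Unit → ℝ => x () := measurable_pi_apply ()
    have h : (fun z : EuclideanSpace ℝ ι => toLp 2 (residualMatrix V o *ᵥ ofLp z)) =
        fun z => toLp 2 fun j => z j - V j o / V o o * z o := by
      funext z
      ext l
      exact residualMatrix_mulVec V o (ofLp z) l
    rw [h]
    exact hind.comp (ψ := fun y : ι → ℝ => toLp 2 y) hm (by fun_prop)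
  exact (indepFun_iff_map_prod_eq_prod_map_map (by fun_prop)
    (measurable_residual V o).aemeasurable).1 hind'

lemma map_pi_prodMk_residual {V : Matrix ι ι ℝ} (hV : V.PosSemidef) {o : ι} (ho : V o o ≠ 0)
    (k : ℕ) :
    (Measure.pi fun _ : Fin k => multivariateGaussian 0 V).map
        (fun z => (fun i => z i o, fun i => toLp 2 (residualMatrix V o *ᵥ ofLp (z i)))) =
      (Measure.pi fun _ : Fin k => gaussianReal 0 (V o o).toNNReal).prod
        (Measure.pi fun _ : Fin k => multivariateGaussian 0 (residualCov V o)) := by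
  have hm : Measurable fun z : EuclideanSpace ℝ ι => (z o, toLp 2 (residualMatrix V o *ᵥ ofLp z)) :=
    Measurable.prodMk (by fun_prop) (measurable_residual V o)
  rw [← (measurePreserving_arrowProdEquivProdArrow ℝ (EuclideanSpace ℝ ι) (Fin k)
    (fun _ => gaussianReal 0 (V o o).toNNReal)
    (fun _ => multivariateGaussian 0 (residualCov V o))).map_eq, ← map_prodMk_residual hV ho]
  have : ∀ _ : Fin k, SigmaFinite ((multivariateGaussian 0 V).map
      (fun z => (z o, toLp 2 (residualMatrix V o *ᵥ ofLp z)))) := by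
    intro _
    have := Measure.isProbabilityMeasure_map (μ := multivariateGaussian 0 V) hm.aemeasurable
    infer_instance
  rw [← Measure.pi_map_pi (fun _ => hm.aemeasurable), Measure.map_map
    (MeasurableEquiv.measurable _) (by fun_prop)]
  rfl

omit [Fintype ι] [DecidableEq ι] in
lemma measurableSet_exists_mem_le [Finite ι] {α : Type*} [MeasurableSpace α] (J : Set ι)
    {F G : ι → α → ℝ} (hF : ∀ j, Measurable (F j)) (hG : ∀ j, Measurable (G j)) :
    MeasurableSet {a | ∃ j ∈ J, F j a ≤ G j a} := by
  have : {a | ∃ j ∈ J, F j a ≤ G j a} = ⋃ j ∈ J, {a | F j a ≤ G j a} := by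
    ext
    simp
  rw [this]
  exact MeasurableSet.biUnion (to_countable J) fun j _ => measurableSet_le (hF j) (hG j)

/-- The residuals are large when the increments are large and the reference coordinate is not. -/
lemma measure_increment_le_residual {V : Matrix ι ι ℝ} (hV : V.PosSemidef) {o : ι}
    {J : Set ι} {den : ι → ℝ} {ε R : ℝ} (hρ : ∀ j ∈ J, |V j o / V o o - 1| * R ≤ ε * den j) :
    multivariateGaussian 0 V {z | ∃ j ∈ J, (1 - ε) * den j ≤ z j - z o} ≤
      multivariateGaussian 0 (residualCov V o) {w | ∃ j ∈ J, (1 - 2 * ε) * den j ≤ w j} +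
        gaussianReal 0 (V o o).toNNReal {x | R < |x|} := by
  have hmW := map_mulVec_multivariateGaussian hV (residualMatrix V o)
  have hmo := (measurePreserving_eval_multivariateGaussian (μ := 0) hV (i := o)).map_eq
  have hWm : MeasurableSet {w : EuclideanSpace ℝ ι | ∃ j ∈ J, (1 - 2 * ε) * den j ≤ w j} :=
    measurableSet_exists_mem_le J (by fun_prop) (by fun_prop)
  have hRm : MeasurableSet {x : ℝ | R < |x|} := measurableSet_lt measurable_const (by fun_prop)
  have hmo' : (multivariateGaussian 0 V).map (fun z => z o) = gaussianReal 0 (V o o).toNNReal := hmo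
  rw [residualCov, ← hmW, ← hmo', Measure.map_apply (measurable_residual V o) hWm,
    Measure.map_apply (by fun_prop) hRm]
  refine (measure_mono ?_).trans (measure_union_le _ _)
  rintro z ⟨j, hj, hz⟩
  by_cases hR : R < |z o|
  · exact Or.inr hR
  · refine Or.inl ⟨j, hj, ?_⟩
    have h1 : (residualMatrix V o *ᵥ ofLp z) j = z j - z o - (V j o / V o o - 1) * z o := by
      rw [residualMatrix_mulVec]
      ring
    have h2 : (V j o / V o o - 1) * z o ≤ ε * den j := by
      calc (V j o / V o o - 1) * z o ≤ |V j o / V o o - 1| * |z o| := by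
            rw [← abs_mul]
            exact le_abs_self _
        _ ≤ |V j o / V o o - 1| * R := by gcongr; exact not_lt.1 hR
        _ ≤ _ := hρ j hj
    change (1 - 2 * ε) * den j ≤ (residualMatrix V o *ᵥ ofLp z) j
    rw [h1]
    linarith

/-- One has (z_j² - z_o²)/2 ≥ z_o(z_j - z_o), and z_j - z_o differs from the residual by (V_jo/V_oo
- 1) z_o, which is absorbed in ε. Given the coordinates at `o`, independence and rotation invariance
make Σ_i z_io w_i distributed as √(Σ_i z_io²) = √(2 y_o) times one residual vector. -/
lemma measure_residual_le_gaussianSquares {V : Matrix ι ι ℝ} (hV : V.PosSemidef) {o : ι}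
    (ho : V o o ≠ 0) (k : ℕ) {J : Set ι} {den : ι → ℝ} {c ε R : ℝ}
    (hρ : ∀ j ∈ J, |V j o / V o o - 1| * R ≤ ε * den j) :
    (Measure.pi fun _ : Fin k => gaussianReal 0 (V o o).toNNReal) {x | ∑ i, x i ^ 2 ≤ R} *
        multivariateGaussian 0 (residualCov V o) {w | ∃ j ∈ J, c * den j ≤ w j} ≤
      gaussianSquares V k
        {y | ∃ j ∈ J, (c * √(2 * y o) - ε) * den j ≤ (y j : ℝ) - y o} := by
  have hW := posSemidef_residualCov hV o
  set S : Set ((Fin k → ℝ) × (Fin k → EuclideanSpace ℝ ι)) :=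
    {p | ∑ i, p.1 i ^ 2 ≤ R} ∩
      {p | ∃ j ∈ J, c * √(∑ i, p.1 i ^ 2) * den j ≤ (∑ i, p.1 i • p.2 i) j} with hS
  have hSm : MeasurableSet S := by
    refine (measurableSet_le (by fun_prop) measurable_const).inter
      (measurableSet_exists_mem_le J ?_ ?_)
    · fun_prop
    · fun_prop
  have hB : MeasurableSet {x : Fin k → ℝ | ∑ i, x i ^ 2 ≤ R} :=
    measurableSet_le (by fun_prop) measurable_const
  rw [gaussianSquares, Measure.map_apply (measurable_sum_sq k) (measurableSet_exists_mem_le J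
    (by fun_prop) (by fun_prop))]
  calc _ ≤ ((Measure.pi fun _ : Fin k => gaussianReal 0 (V o o).toNNReal).prod
        (Measure.pi fun _ : Fin k => multivariateGaussian 0 (residualCov V o))) S := by
        rw [Measure.prod_apply hSm, mul_comm, ← setLIntegral_const,
          ← lintegral_indicator hB]
        refine lintegral_mono fun x => ?_
        by_cases hx : ∑ i, x i ^ 2 ≤ R
        swap
        · simp [indicator, hx]
        rw [indicator_of_mem (by exact hx)]
        set r := √(∑ i, x i ^ 2)
        set C : Set (EuclideanSpace ℝ ι) := {v | ∃ j ∈ J, c * r * den j ≤ v j}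
        have hC : MeasurableSet C := measurableSet_exists_mem_le J (by fun_prop) (by fun_prop)
        have h1 : Prod.mk x ⁻¹' S = (fun w : Fin k → EuclideanSpace ℝ ι => ∑ i, x i • w i) ⁻¹' C := by
          ext w
          simp only [hS, mem_preimage, mem_inter_iff, mem_ofPred_eq, hx, true_and, C, r]
        rw [h1, ← Measure.map_apply (by fun_prop) hC, map_sum_smul_pi_multivariateGaussian hW,
          Measure.map_apply (by fun_prop) hC]
        refine measure_mono ?_
        rintro w ⟨j, hj, hw⟩
        refine ⟨j, hj, ?_⟩
        have : r * (c * den j) ≤ r * w j := by gcongr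
        simp only [PiLp.smul_apply, smul_eq_mul]
        linarith
    _ ≤ _ := by
        rw [← map_pi_prodMk_residual hV ho, Measure.map_apply ?_ hSm]
        · refine measure_mono ?_
          rintro z ⟨hzR, j, hj, hz⟩
          refine ⟨j, hj, ?_⟩
          have hy : ∀ l, ((∑ i, Real.toNNReal (z i l ^ 2 / 2) : ℝ≥0) : ℝ) = ∑ i, z i l ^ 2 / 2 :=
            fun l => by
              rw [NNReal.coe_sum]
              exact Finset.sum_congr rfl fun i _ => Real.coe_toNNReal _ (by positivity)
          have hw : ∀ i, (toLp 2 (residualMatrix V o *ᵥ ofLp (z i)) : EuclideanSpace ℝ ι) j =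
              z i j - V j o / V o o * z i o := fun i => residualMatrix_mulVec V o _ j
          have hz' : c * √(∑ i, z i o ^ 2) * den j ≤
              ∑ i, z i o * (z i j - V j o / V o o * z i o) := by
            have : (∑ i, z i o • (toLp 2 (residualMatrix V o *ᵥ ofLp (z i)) :
                EuclideanSpace ℝ ι)) j = ∑ i, z i o * (z i j - V j o / V o o * z i o) := by
              rw [WithLp.ofLp_sum, Finset.sum_apply]
              exact Finset.sum_congr rfl fun i _ => by
                rw [PiLp.smul_apply, hw, smul_eq_mul]
            rw [← this]
            exact hz
          have h3 : ∑ i, z i o * (z i j - V j o / V o o * z i o) ≤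
              ∑ i, z i j ^ 2 / 2 - ∑ i, z i o ^ 2 / 2 -
                (V j o / V o o - 1) * ∑ i, z i o ^ 2 := by
            rw [← Finset.sum_sub_distrib, Finset.mul_sum, ← Finset.sum_sub_distrib]
            refine Finset.sum_le_sum fun i _ => ?_
            nlinarith [sq_nonneg (z i j - z i o)]
          have h4 : -((V j o / V o o - 1) * ∑ i, z i o ^ 2) ≤ ε * den j := by
            have h5 : 0 ≤ ∑ i, z i o ^ 2 := Finset.sum_nonneg fun i _ => sq_nonneg _
            calc -((V j o / V o o - 1) * ∑ i, z i o ^ 2) ≤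
                |V j o / V o o - 1| * ∑ i, z i o ^ 2 := by
                  rw [← neg_mul]
                  gcongr
                  exact neg_le_abs _
              _ ≤ |V j o / V o o - 1| * R := by gcongr; exact hzR
              _ ≤ _ := hρ j hj
          have h6 : 2 * ∑ i, z i o ^ 2 / 2 = ∑ i, z i o ^ 2 := by
            rw [← Finset.sum_div]
            ring
          change (c * √(2 * ((∑ i, Real.toNNReal (z i o ^ 2 / 2) : ℝ≥0) : ℝ)) - ε) * den j ≤
            ((∑ i, Real.toNNReal (z i j ^ 2 / 2) : ℝ≥0) : ℝ) -
              ((∑ i, Real.toNNReal (z i o ^ 2 / 2) : ℝ≥0) : ℝ)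
          rw [hy, hy, h6]
          linarith
        · exact Measurable.prodMk (by fun_prop) (measurable_pi_lambda _ fun i =>
            (measurable_residual V o).comp (measurable_pi_apply i))

end GaussianSquares

end

noncomputable section

/-! ### Comparison of permanental vectors with squares of Gaussian vectors -/

section MatrixEstimates

open Matrix

variable {ι : Type*} [Fintype ι] [DecidableEq ι]

omit [DecidableEq ι] in
lemma _root_.Matrix.PosSemidef.add_const {V : ι → ι → ℝ}
    (hV : (Matrix.of fun i j => V i j).PosSemidef) {c : ℝ} (hc : 0 ≤ c) :
    (Matrix.of fun i j => V i j + c).PosSemidef := by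
  have h1 : (vecMulVec (fun _ : ι => √c) (star fun _ : ι => √c)).PosSemidef :=
    posSemidef_vecMulVec_self_star _
  convert hV.add h1 using 1
  ext i j
  simp [vecMulVec_apply, Real.mul_self_sqrt hc]

namespace IsInverseMPair

variable {U A : Matrix ι ι ℝ} (h : IsInverseMPair U A)
include h

lemma mulVec_mulVec_inv (v : ι → ℝ) : U *ᵥ (A *ᵥ v) = v := by
  rw [mulVec_mulVec, h.mul_eq_one', one_mulVec]

/-- Off the diagonal |A_ij| = -A_ij, and on it σ² = 0. The sum is therefore 2 tr(AU) - 2 Σ_i U_ii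
(A1)_i, whose last term has a favourable sign. -/
lemma sum_abs_mul_incVar_le (h1 : ∀ i, 0 ≤ (A *ᵥ fun _ => 1) i) :
    ∑ i, ∑ j, |A i j| * (U i i + U j j - 2 * U i j) ≤ 2 * Fintype.card ι := by
  have hUs : ∀ i j, U i j = U j i := fun i j => h.symm.apply j i
  have hAs : ∀ i j, A i j = A j i := fun i j => h.symm_inv.apply j i
  have hAU : ∀ i, ∑ j, A i j * U i j = 1 := fun i => by
    have := congrFun (congrFun h.mul_eq_one i) i
    rw [mul_apply, one_apply_eq] at this
    rw [← this]
    exact Finset.sum_congr rfl fun j _ => by rw [hUs]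
  have hsum : ∀ i, (A *ᵥ fun _ => (1 : ℝ)) i = ∑ j, A i j := fun i => by
    simp [mulVec, dotProduct]
  have hnn : 0 ≤ ∑ i, ∑ j, A i j * U i i := by
    refine Finset.sum_nonneg fun i _ => ?_
    rw [← Finset.sum_mul, ← hsum]
    exact mul_nonneg (h1 i) (h.nonneg i i)
  have hnn' : ∑ i, ∑ j, A i j * U j j = ∑ i, ∑ j, A i j * U i i := by
    rw [Finset.sum_comm]
    exact Finset.sum_congr rfl fun i _ => Finset.sum_congr rfl fun j _ => by rw [hAs]
  have habs : ∀ i j, |A i j| * (U i i + U j j - 2 * U i j) =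
      2 * (A i j * U i j) - A i j * U i i - A i j * U j j := by
    intro i j
    by_cases hij : i = j
    · subst hij
      ring
    · rw [abs_of_nonpos (h.off_diag i j hij)]
      ring
  simp_rw [habs, Finset.sum_sub_distrib, ← Finset.mul_sum, hAU]
  simp only [Finset.sum_const, Finset.card_univ, nsmul_eq_mul, mul_one]
  rw [hnn'] at *
  have h3 : ∑ i, U i i * ∑ j, A i j = ∑ i, ∑ j, A i j * U i i :=
    Finset.sum_congr rfl fun i _ => by rw [Finset.mul_sum]; simp_rw [mul_comm]
  linarith

/-- With e = A1, (Av)_i = e_i v_i + Σ_j A_ij (v_j - v_i). The second part is bounded by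
`sum_abs_mul_incVar_le`. The first is bounded by the mass of `e`, which is at most 1/r because
(Ue)_o = 1 and U_oi ≥ r. -/
lemma sum_abs_mulVec_le (h1 : ∀ i, 0 ≤ (A *ᵥ fun _ => 1) i) {v : ι → ℝ} {τ τ' r : ℝ}
    (hτ : ∀ i j, |v i - v j| ≤ τ * (U i i + U j j - 2 * U i j)) (hτ0 : 0 ≤ τ)
    (hτ' : ∀ i, |v i| ≤ τ') (hτ0' : 0 ≤ τ') (hr : 0 < r) {o : ι} (hU : ∀ i, r ≤ U o i) :
    ∑ i, |(A *ᵥ v) i| ≤ τ' / r + τ * (2 * Fintype.card ι) := by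
  set e := A *ᵥ fun _ => (1 : ℝ) with he
  have hsum : ∀ i, e i = ∑ j, A i j := fun i => by simp [he, mulVec, dotProduct]
  have he1 : ∑ i, e i ≤ 1 / r := by
    rw [le_div_iff₀ hr, Finset.sum_mul]
    have := congrFun (h.mulVec_mulVec_inv fun _ => 1) o
    calc ∑ i, e i * r ≤ ∑ i, U o i * e i := Finset.sum_le_sum fun i _ => by
          rw [mul_comm]
          exact mul_le_mul_of_nonneg_right (hU i) (h1 i)
      _ = 1 := this
  calc ∑ i, |(A *ᵥ v) i| ≤ ∑ i, (e i * τ' + ∑ j, τ * (|A i j| * (U i i + U j j - 2 * U i j))) := by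
        refine Finset.sum_le_sum fun i _ => ?_
        have h2 : (A *ᵥ v) i = e i * v i + ∑ j, A i j * (v j - v i) := by
          rw [hsum, Finset.sum_mul, ← Finset.sum_add_distrib]
          simp only [mulVec, dotProduct]
          exact Finset.sum_congr rfl fun j _ => by ring
        rw [h2]
        refine (abs_add_le _ _).trans (add_le_add ?_ ((Finset.abs_sum_le_sum_abs _ _).trans
          (Finset.sum_le_sum fun j _ => ?_)))
        · rw [abs_mul, abs_of_nonneg (h1 i)]
          exact mul_le_mul_of_nonneg_left (hτ' i) (h1 i)
        · rw [abs_mul, abs_sub_comm, mul_left_comm]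
          exact mul_le_mul_of_nonneg_left (hτ i j) (abs_nonneg _)
    _ = τ' * ∑ i, e i + τ * ∑ i, ∑ j, |A i j| * (U i i + U j j - 2 * U i j) := by
        simp_rw [Finset.sum_add_distrib, Finset.mul_sum]
        congr 1
        exact Finset.sum_congr rfl fun i _ => mul_comm _ _
    _ ≤ τ' * (1 / r) + τ * (2 * Fintype.card ι) := by
        gcongr
        exact h.sum_abs_mul_incVar_le h1
    _ = _ := by ring

end IsInverseMPair

namespace IsDominationKernel

variable {u : ℝ → ℝ → ℝ} {J : Set ℝ} (h : IsDominationKernel u J)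
include h

/-- The charge 1/u(y, y) at `y` has potential 1 there, hence at most 1 everywhere on `J`. -/
lemma le_diag {x y : ℝ} (hx : x ∈ J) (hy : y ∈ J) : u x y ≤ u y y := by
  have hp := h.diag_pos y hy
  have := h.dominatedBy_one {y} (by simpa using hy) (fun _ => 1 / u y y) (fun z hz _ => by
    rw [Finset.mem_singleton] at hz
    subst hz
    simp [hp.ne']) x hx
  rw [Finset.sum_singleton, mul_one_div, div_le_one hp] at this
  exact this

/-- A permanental vector with kernel `u (x, y) + g (x) f (y)` is close to the squares of a Gaussian
vector with covariance `u (x, y) + f (o) g (o)` when `f` and `g` vary little. -/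
theorem gaussianSquares_le_add {x : ι → ℝ} (hx : Function.Injective x) (hxJ : ∀ i, x i ∈ J)
    (hpsd : (Matrix.of fun i j => u (x i) (x j)).PosSemidef) {f g : ℝ → ℝ}
    (hf : IsDominatedBy u J f) (hg : IsDominatedBy u J g) {o : ι} (hf0 : 0 ≤ f (x o))
    (hg0 : 0 ≤ g (x o)) {k : ℕ} (hk : 0 < k) {r τ τ' G : ℝ} (hr : 0 < r)
    (hru : ∀ i, r ≤ u (x o) (x i)) (hτ : 0 ≤ τ)
    (hfτ : ∀ i j, |f (x i) - f (x j)| ≤ τ * incVar u (x i) (x j))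
    (hgτ : ∀ i j, |g (x i) - g (x j)| ≤ τ * incVar u (x i) (x j))
    (hfτ' : ∀ i, |f (x i) - f (x o)| ≤ τ') (hgτ' : ∀ i, |g (x i) - g (x o)| ≤ τ')
    (hfG : f (x o) ≤ G) (hgG : ∀ i, g (x i) ≤ G)
    {μ : Measure (ι → ℝ≥0)} [IsProbabilityMeasure μ]
    (hμ : ∀ s : ι → ℝ≥0, (∀ i, 0 < s i) → laplace μ s = ENNReal.ofReal
      (1 / (1 + (Matrix.of fun i j => u (x i) (x j) + g (x i) * f (x j)) *
        diagonal fun i => (s i : ℝ)).det ^ ((k : ℝ) / 2))) (B : Set (ι → ℝ≥0)) :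
    gaussianSquares (Matrix.of fun i j => u (x i) (x j) + f (x o) * g (x o)) k B ≤ μ B +
      ENNReal.ofReal
        (1 - (1 + 2 * G * (τ' / r + τ * (2 * Fintype.card ι))) ^ (-((k : ℝ) / 2))) := by
  set U : Matrix ι ι ℝ := Matrix.of fun i j => u (x i) (x j) with hU
  set A := U⁻¹ with hA
  have hM : IsInverseMPair U A := h.isInverseMPair hx hxJ hpsd
  set a := A *ᵥ fun i => f (x i) with ha
  set b := A *ᵥ fun i => g (x i) with hb
  set e := A *ᵥ fun _ => (1 : ℝ) with he
  have ha0 : ∀ i, 0 ≤ a i := h.inv_mulVec_nonneg hx hxJ hf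
  have hb0 : ∀ i, 0 ≤ b i := h.inv_mulVec_nonneg hx hxJ hg
  have he0 : ∀ i, 0 ≤ e i := h.inv_mulVec_nonneg hx hxJ h.dominatedBy_one
  have hUa : U *ᵥ a = fun i => f (x i) := hM.mulVec_mulVec_inv _
  have hUb : U *ᵥ b = fun i => g (x i) := hM.mulVec_mulVec_inv _
  have hUe : U *ᵥ e = fun _ => 1 := hM.mulVec_mulVec_inv _
  have hG : 0 ≤ G := hf0.trans hfG
  have hτ0' : 0 ≤ τ' := (abs_nonneg _).trans (hfτ' o)
  have hα : 0 < (k : ℝ) / 2 := by positivity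
  have hpsd' : (Matrix.of fun i j => u (x i) (x j) + f (x o) * g (x o)).PosSemidef :=
    hpsd.add_const (mul_nonneg hf0 hg0)
  have hD : IsLaplace fun s : ι → ℝ≥0 =>
      ENNReal.ofReal ((1 + U * diagonal fun i => (s i : ℝ)).det ^ (-((k : ℝ) / 2))) :=
    ⟨gaussianSquares U k, inferInstance, laplace_gaussianSquares hpsd k⟩
  have hK : (U + Matrix.of fun i j => (U *ᵥ b) i * (U *ᵥ a) j) =
      Matrix.of fun i j => u (x i) (x j) + g (x i) * f (x j) := by
    rw [hUa, hUb]
    rfl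
  -- A constant is the potential of a multiple of the equilibrium charge `e`, so the frozen kernel
  -- is a rank one perturbation of the same form.
  have hK' : (U + Matrix.of fun i j => (U *ᵥ (g (x o) • e)) i * (U *ᵥ (f (x o) • e)) j) =
      Matrix.of fun i j => u (x i) (x j) + f (x o) * g (x o) := by
    rw [mulVec_smul, mulVec_smul, hUe]
    ext i j
    simp [hU, mul_comm]
  have key := hM.measure_le_add_of_laplace hα hD (a := f (x o) • e) (b := g (x o) • e)
    (a' := a) (b' := b) (fun i => mul_nonneg hf0 (he0 i)) (fun i => mul_nonneg hg0 (he0 i)) ha0 hb0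
    (μ := gaussianSquares (Matrix.of fun i j => u (x i) (x j) + f (x o) * g (x o)) k) (μ' := μ)
    (fun s _ => by rw [hK']; exact laplace_gaussianSquares hpsd' k s)
    (fun s hs => by
      have hpos := hM.det_rank_one_pos ha0 hb0 s
      rw [hμ s hs, hK, Real.rpow_neg, one_div]
      rw [hK] at hpos
      exact hpos.le) B
  have hdiff : ∀ (v : ℝ → ℝ), (∀ i j, |v (x i) - v (x j)| ≤ τ * incVar u (x i) (x j)) →
      (∀ i, |v (x i) - v (x o)| ≤ τ') →
      ∑ i, |v (x o) * e i - (A *ᵥ fun i => v (x i)) i| ≤ τ' / r + τ * (2 * Fintype.card ι) := by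
    intro v hv hv'
    have := hM.sum_abs_mulVec_le he0 (v := fun i => v (x i) - v (x o)) (τ := τ) (τ' := τ')
      (fun i j => by
        rw [sub_sub_sub_cancel_right]
        exact hv i j) hτ hv' hτ0' hr hru
    refine le_trans (le_of_eq (Finset.sum_congr rfl fun i _ => ?_)) this
    rw [abs_sub_comm]
    congr 1
    have : (fun i => v (x i) - v (x o)) = (fun i => v (x i)) - v (x o) • fun _ : ι => (1 : ℝ) := by
      ext
      simp
    rw [this, mulVec_sub, mulVec_smul]
    rfl
  have hsymm : ∀ i j, U i j = U j i := fun i j => h.symm _ _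
  have herr : ∑ i, ∑ j, |(f (x o) • e) i * (g (x o) • e) j - a i * b j| * U i j ≤
      2 * G * (τ' / r + τ * (2 * Fintype.card ι)) := by
    -- The difference of products is split so that in each term one charge can be summed against
    -- `U`, producing g(x_i) or f(o). Only the one-index differences of charges remain.
    calc ∑ i, ∑ j, |(f (x o) • e) i * (g (x o) • e) j - a i * b j| * U i j ≤
        ∑ i, ∑ j, (|f (x o) * e i - a i| * (U i j * b j) +
          |g (x o) * e j - b j| * (U j i * (f (x o) * e i))) := by
          refine Finset.sum_le_sum fun i _ => Finset.sum_le_sum fun j _ => ?_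
          have h1 : (f (x o) • e) i * (g (x o) • e) j - a i * b j =
              (f (x o) * e i - a i) * b j + f (x o) * e i * (g (x o) * e j - b j) := by
            simp only [Pi.smul_apply, smul_eq_mul]
            ring
          rw [h1, hsymm j i]
          calc _ ≤ (|f (x o) * e i - a i| * b j + f (x o) * e i * |g (x o) * e j - b j|) * U i j := by
                refine mul_le_mul_of_nonneg_right ((abs_add_le _ _).trans_eq ?_) (hM.nonneg i j)
                rw [abs_mul, abs_mul, abs_of_nonneg (hb0 j), abs_of_nonneg (mul_nonneg hf0 (he0 i))]
            _ = _ := by ring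
      _ = ∑ i, |f (x o) * e i - a i| * g (x i) + ∑ j, |g (x o) * e j - b j| * f (x o) := by
          simp_rw [Finset.sum_add_distrib, ← Finset.mul_sum]
          congr 1
          · refine Finset.sum_congr rfl fun i _ => ?_
            congr 1
            exact congrFun hUb i
          · rw [Finset.sum_comm]
            refine Finset.sum_congr rfl fun j _ => ?_
            rw [← Finset.mul_sum]
            congr 1
            have := congrFun hUe j
            simp only [mulVec, dotProduct] at this
            simp_rw [mul_left_comm _ (f (x o)), ← Finset.mul_sum, this, mul_one]
      _ ≤ ∑ i, |f (x o) * e i - a i| * G + ∑ j, |g (x o) * e j - b j| * G := by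
          gcongr with i _
          exact hgG i
      _ ≤ _ := by
          rw [← Finset.sum_mul, ← Finset.sum_mul]
          nlinarith [hdiff f hfτ hfτ', hdiff g hgτ hgτ']
  refine key.trans (add_le_add le_rfl (ENNReal.ofReal_le_ofReal (sub_le_sub_left ?_ _)))
  refine Real.rpow_le_rpow_of_nonpos ?_ (by linarith) (by linarith)
  have : 0 ≤ ∑ i, ∑ j, |(f (x o) • e) i * (g (x o) • e) j - a i * b j| * U i j :=
    Finset.sum_nonneg fun i _ => Finset.sum_nonneg fun j _ =>
      mul_nonneg (abs_nonneg _) (hM.nonneg i j)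
  linarith

end IsDominationKernel

end MatrixEstimates

end

noncomputable section

/-! ### Finite-dimensional laws of a centered Gaussian process -/

section GaussianProcess

open Matrix WithLp
open scoped RealInnerProductSpace

variable {Ω : Type*} [MeasurableSpace Ω] {η : ℝ → Ω → ℝ} {μ : Measure Ω} {u : ℝ → ℝ → ℝ}

namespace IsCenteredGaussianWithCov

variable (hη : IsCenteredGaussianWithCov η μ u)
include hη

lemma symm (x y : ℝ) : u x y = u y x := by
  rw [← hη.2.2, ← hη.2.2]
  simp_rw [mul_comm]

lemma memLp_two (x : ℝ) : MemLp (η x) 2 μ := (hη.1.hasGaussianLaw_eval x).memLp_two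

variable {ι : Type*} [Fintype ι]

lemma integral_sum_sq (x : ι → ℝ) (t : ι → ℝ) :
    ∫ ω, (∑ i, t i * η (x i) ω) ^ 2 ∂μ = t ⬝ᵥ (Matrix.of fun i j => u (x i) (x j)) *ᵥ t := by
  have h1 : ∀ ω, (∑ i, t i * η (x i) ω) ^ 2 =
      ∑ i, ∑ j, t i * t j * (η (x i) ω * η (x j) ω) := fun ω => by
    rw [sq, Finset.sum_mul_sum]
    exact Finset.sum_congr rfl fun i _ => Finset.sum_congr rfl fun j _ => by ring
  have hint : ∀ i j, Integrable (fun ω => η (x i) ω * η (x j) ω) μ := fun i j =>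
    (hη.memLp_two (x i)).integrable_mul (hη.memLp_two (x j))
  simp_rw [h1]
  rw [integral_finsetSum _ fun i _ => integrable_finsetSum _ fun j _ => (hint i j).const_mul _]
  simp_rw [dotProduct, mulVec, dotProduct, Finset.mul_sum]
  refine Finset.sum_congr rfl fun i _ => ?_
  rw [integral_finsetSum _ fun j _ => (hint i j).const_mul _]
  refine Finset.sum_congr rfl fun j _ => ?_
  rw [integral_const_mul, hη.2.2, Matrix.of_apply]
  ring

lemma posSemidef (x : ι → ℝ) : (Matrix.of fun i j => u (x i) (x j)).PosSemidef := by
  refine Matrix.PosSemidef.of_dotProduct_mulVec_nonneg ?_ fun t => ?_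
  · ext i j
    simp [hη.symm (x i) (x j)]
  · rw [star_trivial, ← hη.integral_sum_sq]
    exact integral_nonneg fun ω => sq_nonneg _

/-- A tuple, possibly with repeated points, is a linear image of the restriction of the process to a
finite set. -/
lemma hasGaussianLaw_pi (x : ι → ℝ) : HasGaussianLaw (fun ω i => η (x i) ω) μ := by
  classical
  let L : (↥(Finset.univ.image x) → ℝ) →L[ℝ] (ι → ℝ) :=
    ContinuousLinearMap.pi fun i => ContinuousLinearMap.proj
      (⟨x i, Finset.mem_image_of_mem x (Finset.mem_univ i)⟩ : ↥(Finset.univ.image x))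
  exact (hη.1.hasGaussianLaw (Finset.univ.image x)).map_fun L

variable [DecidableEq ι]

lemma map_eq_multivariateGaussian (x : ι → ℝ) :
    μ.map (fun ω => toLp 2 fun i => η (x i) ω) =
      multivariateGaussian 0 (Matrix.of fun i j => u (x i) (x j)) := by
  have hL : HasGaussianLaw (fun ω => toLp 2 fun i => η (x i) ω) μ :=
    (hη.hasGaussianLaw_pi x).toLp_pi 2
  have := hL.isProbabilityMeasure
  have := Measure.isProbabilityMeasure_map hL.aemeasurable
  refine Measure.ext_of_charFun (funext fun t => ?_)
  have hinner : (fun ω => ⟪t, toLp 2 fun i => η (x i) ω⟫) = fun ω => ∑ i, t i * η (x i) ω := by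
    ext ω
    rw [PiLp.inner_apply]
    exact Finset.sum_congr rfl fun i _ => by simp [mul_comm]
  have hmean : ∫ ω, ∑ i, t i * η (x i) ω ∂μ = 0 := by
    rw [integral_finsetSum _ fun i _ =>
      ((hη.memLp_two (x i)).integrable (by norm_num)).const_mul _]
    simp [integral_const_mul, hη.2.1]
  have hvar : Var[fun ω => ∑ i, t i * η (x i) ω; μ] =
      ofLp t ⬝ᵥ (Matrix.of fun i j => u (x i) (x j)) *ᵥ ofLp t := by
    rw [variance_eq_integral (by
      have h1 : ∀ i, AEMeasurable (η (x i)) μ := fun i => (hη.memLp_two (x i)).aemeasurable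
      fun_prop), hmean, ← hη.integral_sum_sq]
    simp
  rw [hL.charFun_map_eq, charFun_multivariateGaussian (hη.posSemidef x), hinner, hmean, hvar]
  simp

/-- The increments from a reference point are not affected by adding a constant to the
covariance. -/
lemma measure_increment_eq (x : ι → ℝ) {c : ℝ} (hc : 0 ≤ c) (o : ι) (J : Set ι) (r : ι → ℝ) :
    μ {ω | ∃ j ∈ J, r j ≤ η (x j) ω - η (x o) ω} =
      multivariateGaussian 0 (Matrix.of fun i j => u (x i) (x j) + c)
        {z | ∃ j ∈ J, r j ≤ z j - z o} := by
  -- The residual matrix of the all-ones covariance subtracts the `o`-th coordinate. It annihilates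
  -- constants, so `c` drops out of B V Bᵀ.
  set B : Matrix ι ι ℝ := residualMatrix (Matrix.of fun _ _ => 1) o with hB
  have hBz : ∀ (z : ι → ℝ) j, (B *ᵥ z) j = z j - z o := fun z j => by
    simp [hB, residualMatrix_mulVec]
  have hS : MeasurableSet {z : EuclideanSpace ℝ ι | ∃ j ∈ J, r j ≤ z j} :=
    measurableSet_exists_mem_le J (by fun_prop) (by fun_prop)
  have hpre : ∀ V : Matrix ι ι ℝ, V.PosSemidef →
      multivariateGaussian 0 V {z | ∃ j ∈ J, r j ≤ z j - z o} =
        multivariateGaussian 0 (B * V * Bᵀ) {z | ∃ j ∈ J, r j ≤ z j} := fun V hV => by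
    rw [← map_mulVec_multivariateGaussian hV, Measure.map_apply (measurable_residual _ o) hS]
    congr 1
    ext z
    refine exists_congr fun j => and_congr_right fun _ => ?_
    change _ ↔ r j ≤ (B *ᵥ ofLp z) j
    rw [hBz]
  have hU := hη.posSemidef x
  have hS' : MeasurableSet {z : EuclideanSpace ℝ ι | ∃ j ∈ J, r j ≤ z j - z o} :=
    measurableSet_exists_mem_le J (by fun_prop) (by fun_prop)
  have h1 : μ {ω | ∃ j ∈ J, r j ≤ η (x j) ω - η (x o) ω} =
      multivariateGaussian 0 (Matrix.of fun i j => u (x i) (x j))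
        {z | ∃ j ∈ J, r j ≤ z j - z o} := by
    rw [← hη.map_eq_multivariateGaussian x, Measure.map_apply_of_aemeasurable
      ((hη.hasGaussianLaw_pi x).toLp_pi 2).aemeasurable hS']
    rfl
  rw [h1, hpre _ hU, hpre _ (hU.add_const hc)]
  congr 2
  have h2 : (Matrix.of fun i j => u (x i) (x j) + c) =
      (Matrix.of fun i j => u (x i) (x j)) + Matrix.of fun _ _ => c := by
    ext
    simp
  have h3 : B * (Matrix.of fun _ _ => c : Matrix ι ι ℝ) = 0 := by
    ext i j
    have := hBz (fun _ => c) i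
    simpa [Matrix.mul_apply, mulVec, dotProduct] using this
  rw [h2, Matrix.mul_add, h3, add_zero]

end IsCenteredGaussianWithCov

end GaussianProcess

end

noncomputable section

/-! ### The mesh -/

section Mesh

variable {θ q : ℝ}

lemma floor_rpow_le (hq₀ : 0 < q) (hq₁ : q < 1) (n : ℕ) : ⌊(n : ℝ) ^ q⌋₊ ≤ n := by
  rcases Nat.eq_zero_or_pos n with rfl | hn
  · simp [Real.zero_rpow hq₀.ne']
  · refine Nat.floor_le_of_le ?_
    have h1 : (1 : ℝ) ≤ n := by exact_mod_cast hn
    exact (Real.rpow_le_rpow_of_exponent_le h1 hq₁.le).trans_eq (Real.rpow_one _)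

lemma meshLen_pos (hq₀ : 0 < q) (hq₁ : q < 1) (n : ℕ) : 1 ≤ meshLen q n := by
  have := floor_rpow_le hq₀ hq₁ n
  unfold meshLen
  omega

lemma meshLen_le (q : ℝ) (n : ℕ) : meshLen q n ≤ n + 1 := Nat.sub_le _ _

lemma meshPt_pos (hθ₀ : 0 < θ) (n : ℕ) {j : ℕ} (hj : j ≠ 0) : 0 < meshPt θ n j := by
  rw [meshPt, if_neg hj]
  positivity

@[simp]
lemma meshPt_zero_right (θ : ℝ) (n : ℕ) : meshPt θ n 0 = 0 := if_pos rfl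

lemma meshPt_nonneg (hθ₀ : 0 < θ) (n j : ℕ) : 0 ≤ meshPt θ n j := by
  rcases eq_or_ne j 0 with rfl | hj
  · simp
  · exact (meshPt_pos hθ₀ n hj).le

/-- For j ≤ m(n) the exponent n + 1 - j is at least ⌊n^q⌋. Stopping the mesh at m(n) thus keeps it
in a rapidly shrinking neighbourhood of 0. -/
lemma meshPt_le (hθ₀ : 0 < θ) (hθ₁ : θ < 1) (hq₀ : 0 < q) (hq₁ : q < 1) {n j : ℕ}
    (hj : j ≤ meshLen q n) : meshPt θ n j ≤ θ ^ ⌊(n : ℝ) ^ q⌋₊ := by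
  rcases eq_or_ne j 0 with rfl | hj0
  · simp only [meshPt_zero_right]
    positivity
  · rw [meshPt, if_neg hj0]
    refine pow_le_pow_of_le_one hθ₀.le hθ₁.le ?_
    have := floor_rpow_le hq₀ hq₁ n
    unfold meshLen at hj
    omega

lemma meshPt_injOn (hθ₀ : 0 < θ) (hθ₁ : θ < 1) (n : ℕ) :
    Set.InjOn (meshPt θ n) (Set.Iic (n + 1)) := by
  intro i hi j hj hij
  rw [mem_Iic] at hi hj
  rcases eq_or_ne i 0 with rfl | hi0 <;> rcases eq_or_ne j 0 with rfl | hj0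
  · rfl
  · simp only [meshPt_zero_right] at hij
    exact absurd hij (meshPt_pos hθ₀ n hj0).ne
  · simp only [meshPt_zero_right] at hij
    exact absurd hij (meshPt_pos hθ₀ n hi0).ne'
  · rw [meshPt, meshPt, if_neg hi0, if_neg hj0] at hij
    have := (pow_right_strictAnti₀ hθ₀ hθ₁).injective hij
    omega

lemma tendsto_natCast_rpow_atTop (hq₀ : 0 < q) :
    Tendsto (fun n : ℕ => (n : ℝ) ^ q) atTop atTop :=
  (tendsto_rpow_atTop hq₀).comp tendsto_natCast_atTop_atTop

lemma tendsto_pow_floor_rpow (hθ₀ : 0 < θ) (hθ₁ : θ < 1) (hq₀ : 0 < q) :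
    Tendsto (fun n : ℕ => θ ^ ⌊(n : ℝ) ^ q⌋₊) atTop (𝓝 0) :=
  (tendsto_pow_atTop_nhds_zero_of_lt_one hθ₀.le hθ₁).comp
    (tendsto_nat_floor_atTop.comp (tendsto_natCast_rpow_atTop hq₀))

/-- In terms of x = n^q the factor n is x^{1/q}, a power beaten by θ^x. The integer part costs a
factor θ⁻¹. -/
lemma tendsto_pow_floor_rpow_mul (hθ₀ : 0 < θ) (hθ₁ : θ < 1) (hq₀ : 0 < q) :
    Tendsto (fun n : ℕ => θ ^ ⌊(n : ℝ) ^ q⌋₊ * n) atTop (𝓝 0) := by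
  have hlog : 0 < -Real.log θ := neg_pos.2 (Real.log_neg hθ₀ hθ₁)
  have h1 := ((tendsto_rpow_mul_exp_neg_mul_atTop_nhds_zero (1 / q) _ hlog).comp
    (tendsto_natCast_rpow_atTop hq₀)).const_mul θ⁻¹
  rw [mul_zero] at h1
  refine squeeze_zero (fun n => by positivity) (fun n => ?_) h1
  have h2 : ((n : ℝ) ^ q) ^ (1 / q) = n := by
    rw [← Real.rpow_mul (Nat.cast_nonneg n), mul_one_div_cancel hq₀.ne', Real.rpow_one]
  have h3 : Real.exp (-(-Real.log θ) * (n : ℝ) ^ q) = θ ^ ((n : ℝ) ^ q) := by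
    rw [neg_neg, Real.rpow_def_of_pos hθ₀]
  simp only [Function.comp_apply, h2, h3]
  have h4 : θ ^ ⌊(n : ℝ) ^ q⌋₊ ≤ θ⁻¹ * θ ^ ((n : ℝ) ^ q) := by
    rw [← Real.rpow_neg_one, ← Real.rpow_add hθ₀, ← Real.rpow_natCast]
    refine Real.rpow_le_rpow_of_exponent_ge hθ₀ hθ₁.le ?_
    have := Nat.lt_floor_add_one ((n : ℝ) ^ q)
    linarith
  calc θ ^ ⌊(n : ℝ) ^ q⌋₊ * n ≤ θ⁻¹ * θ ^ ((n : ℝ) ^ q) * n := by gcongr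
    _ = _ := by ring

lemma eventually_meshPt_lt (hθ₀ : 0 < θ) (hθ₁ : θ < 1) (hq₀ : 0 < q) (hq₁ : q < 1) {r : ℝ}
    (hr : 0 < r) : ∀ᶠ n : ℕ in atTop, ∀ j ≤ meshLen q n, meshPt θ n j < r := by
  filter_upwards [(tendsto_pow_floor_rpow hθ₀ hθ₁ hq₀).eventually_lt_const hr] with n hn j hj
  exact (meshPt_le hθ₀ hθ₁ hq₀ hq₁ hj).trans_lt hn

/-- The oscillation of `f` on the mesh around `d` is `o (φ / m (n))`, uniformly. -/
def IsSmallOnMesh (φ f : ℝ → ℝ) (d e θ q : ℝ) : Prop :=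
  ∃ τ : ℕ → ℝ, (∀ n, 0 ≤ τ n) ∧
    Tendsto (fun n => τ n * (meshLen q n + 1)) atTop (𝓝 0) ∧
    ∀ᶠ n : ℕ in atTop, ∀ i ≤ meshLen q n, ∀ j ≤ meshLen q n,
      |f (d + e * meshPt θ n i) - f (d + e * meshPt θ n j)| ≤
        τ n * φ |meshPt θ n i - meshPt θ n j|

variable {φ f : ℝ → ℝ} {d e : ℝ}

/-- A gauge function dominates the identity near `0`. -/
lemma exists_le_mul_of_isBigO (hφ : (fun x : ℝ => x) =O[𝓝[>] 0] φ)
    (hmono : MonotoneOn φ (Ici 0)) (h0 : φ 0 = 0) :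
    ∃ K > 0, ∃ r > 0, ∀ x, 0 ≤ x → x < r → x ≤ K * φ x := by
  obtain ⟨K, hK, hb⟩ := hφ.exists_pos
  obtain ⟨r, hr, hr'⟩ := mem_nhdsGT_iff_exists_Ioo_subset.1 hb.bound
  refine ⟨K, hK, r, hr, fun x hx hxr => ?_⟩
  have hφ0 : 0 ≤ φ x := h0 ▸ hmono (mem_Ici.2 le_rfl) (mem_Ici.2 hx) hx
  rcases hx.eq_or_lt with rfl | hx
  · positivity
  · have := hr' ⟨hx, hxr⟩
    simpa [abs_of_pos hx, abs_of_nonneg hφ0] using this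

/-- The bound x ≤ Kφ(x) gives positivity near 0, and monotonicity propagates it. -/
lemma pos_of_isBigO_of_monotoneOn (hφ : (fun x : ℝ => x) =O[𝓝[>] 0] φ) (hmono : MonotoneOn φ (Ici 0))
    (h0 : φ 0 = 0) {x : ℝ} (hx : 0 < x) : 0 < φ x := by
  obtain ⟨K, hK, r, hr, h⟩ := exists_le_mul_of_isBigO hφ hmono h0
  have hy : 0 < min x (r / 2) := lt_min hx (by linarith)
  have h1 := h _ hy.le ((min_le_right _ _).trans_lt (by linarith))
  have h2 : 0 < φ (min x (r / 2)) := pos_of_mul_pos_right (hy.trans_le h1) hK.le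
  exact h2.trans_le (hmono (mem_Ici.2 hy.le) (mem_Ici.2 hx.le) (min_le_left _ _))

lemma abs_sub_meshPt_lt (hθ₀ : 0 < θ) {n i j : ℕ} {r : ℝ} (hi : meshPt θ n i < r)
    (hj : meshPt θ n j < r) : |meshPt θ n i - meshPt θ n j| < r := by
  have := meshPt_nonneg hθ₀ n i
  have := meshPt_nonneg hθ₀ n j
  rw [abs_lt]
  constructor <;> linarith

/-- Near `d` the function is Lipschitz with some constant K, and the mesh condition bounds |t_i -
t_j| by s_n φ/m(n) with s_n → 0. This dictates τ_n = K s_n / m(n). -/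
lemma isSmallOnMesh_of_meshCondition (hθ₀ : 0 < θ) (hθ₁ : θ < 1) (hq₀ : 0 < q) (hq₁ : q < 1)
    (he : |e| = 1) (hf : ContDiffAt ℝ 1 f d) (hφ : (fun x : ℝ => x) =O[𝓝[>] 0] φ)
    (hmono : MonotoneOn φ (Ici 0)) (h0 : φ 0 = 0) (h : MeshCondition φ θ q) :
    IsSmallOnMesh φ f d e θ q := by
  obtain ⟨K, t, ht, hK⟩ := hf.exists_lipschitzOnWith
  obtain ⟨r, hr, hrt⟩ := Metric.mem_nhds_iff.1 ht
  set s : ℕ → ℝ := fun n => ⨆ p : {p : Fin (meshLen q n + 1) × Fin (meshLen q n + 1) // p.1 ≠ p.2},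
      (meshLen q n : ℝ) * |meshPt θ n p.1.2 - meshPt θ n p.1.1| /
        φ |meshPt θ n p.1.2 - meshPt θ n p.1.1| with hs
  have hφ0 : ∀ x, 0 ≤ x → 0 ≤ φ x := fun x hx => h0 ▸ hmono (mem_Ici.2 le_rfl) (mem_Ici.2 hx) hx
  have hs0 : ∀ n, 0 ≤ s n := fun n => Real.iSup_nonneg fun p =>
    div_nonneg (by positivity) (hφ0 _ (abs_nonneg _))
  have hm : ∀ n, (1 : ℝ) ≤ meshLen q n := fun n => by exact_mod_cast meshLen_pos hq₀ hq₁ n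
  refine ⟨fun n => K * s n / meshLen q n, fun n => by have := hs0 n; positivity, ?_, ?_⟩
  · have h1 : Tendsto (fun n => 2 * K * s n) atTop (𝓝 0) := by
      simpa using Tendsto.const_mul (2 * (K : ℝ)) h
    refine squeeze_zero (fun n => by have := hs0 n; positivity) (fun n => ?_) h1
    have h2 := hm n
    rw [div_mul_eq_mul_div, div_le_iff₀ (by linarith)]
    have : 0 ≤ K * s n := mul_nonneg K.2 (hs0 n)
    nlinarith
  · filter_upwards [eventually_meshPt_lt hθ₀ hθ₁ hq₀ hq₁ hr] with n hn i hi j hj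
    have hmem : ∀ j ≤ meshLen q n, d + e * meshPt θ n j ∈ t := fun j hj => hrt (by
      rw [Metric.mem_ball, Real.dist_eq, add_sub_cancel_left, abs_mul, he, one_mul,
        abs_of_nonneg (meshPt_nonneg hθ₀ n j)]
      exact hn j hj)
    have h1 := hK.dist_le_mul _ (hmem i hi) _ (hmem j hj)
    rw [Real.dist_eq, Real.dist_eq, add_sub_add_left_eq_sub, ← mul_sub, abs_mul, he, one_mul] at h1
    refine h1.trans ?_
    by_cases hij : i = j
    · subst hij
      simp [h0]
    · have hne : meshPt θ n i ≠ meshPt θ n j := fun h' =>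
        hij (meshPt_injOn hθ₀ hθ₁ n (hi.trans (meshLen_le q n)) (hj.trans (meshLen_le q n)) h')
      have hpos : 0 < φ |meshPt θ n i - meshPt θ n j| :=
        pos_of_isBigO_of_monotoneOn hφ hmono h0 (abs_pos.2 (sub_ne_zero.2 hne))
      have h2 := le_ciSup (f := fun p : {p : Fin (meshLen q n + 1) × Fin (meshLen q n + 1) //
          p.1 ≠ p.2} => (meshLen q n : ℝ) * |meshPt θ n p.1.2 - meshPt θ n p.1.1| /
        φ |meshPt θ n p.1.2 - meshPt θ n p.1.1|) (Set.finite_range _).bddAbove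
        ⟨(⟨j, by omega⟩, ⟨i, by omega⟩), by simpa using Ne.symm hij⟩
      have h3 : (meshLen q n : ℝ) * |meshPt θ n i - meshPt θ n j| /
        φ |meshPt θ n i - meshPt θ n j| ≤ s n := h2
      rw [div_le_iff₀ hpos] at h3
      have hm' := hm n
      calc (K : ℝ) * |meshPt θ n i - meshPt θ n j|
          = K * (meshLen q n * |meshPt θ n i - meshPt θ n j|) / meshLen q n := by
            field_simp
        _ ≤ K * (s n * φ |meshPt θ n i - meshPt θ n j|) / meshLen q n := by gcongr
        _ = _ := by ring

/-- The derivative is Lipschitz near `d` and vanishes at `d`, so it is at most Kρ within distance ρ.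
-/
lemma exists_abs_sub_le_of_deriv_eq_zero (hf : ContDiffAt ℝ 2 f d) (hd : deriv f d = 0) :
    ∃ K : ℝ, 0 ≤ K ∧ ∃ r > 0, ∀ ρ < r, ∀ x ∈ Icc (d - ρ) (d + ρ), ∀ y ∈ Icc (d - ρ) (d + ρ),
      |f x - f y| ≤ K * ρ * |x - y| := by
  have h1 : ContDiffAt ℝ 1 (deriv f) d := by
    have := hf.derivWithin (m := 1) (by norm_num)
    simpa using this
  obtain ⟨K, t, ht, hK⟩ := h1.exists_lipschitzOnWith
  have h2 : ∀ᶠ x in 𝓝 d, DifferentiableAt ℝ f x := by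
    filter_upwards [hf.eventually (by simp)] with x hx
    exact hx.differentiableAt (by simp)
  obtain ⟨r, hr, hrt⟩ := Metric.mem_nhds_iff.1 (inter_mem ht h2)
  refine ⟨K, K.2, r, hr, fun ρ hρ x hx y hy => ?_⟩
  have hsub : ∀ z ∈ Icc (d - ρ) (d + ρ), |z - d| ≤ ρ := fun z hz =>
    abs_le.2 ⟨by linarith [hz.1], by linarith [hz.2]⟩
  have hmem : ∀ z ∈ Icc (d - ρ) (d + ρ), z ∈ t ∧ DifferentiableAt ℝ f z := fun z hz =>
    hrt (by
      rw [Metric.mem_ball, Real.dist_eq]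
      exact (hsub z hz).trans_lt hρ)
  have := (convex_Icc (d - ρ) (d + ρ)).norm_image_sub_le_of_norm_deriv_le (f := f) (C := K * ρ)
    (fun z hz => (hmem z hz).2) (fun z hz => by
      have h3 := hK.dist_le_mul _ (hmem z hz).1 _ (mem_of_mem_nhds ht)
      rw [Real.dist_eq, Real.dist_eq, hd, sub_zero] at h3
      exact h3.trans (mul_le_mul_of_nonneg_left (hsub z hz) K.2)) hy hx
  simpa [Real.norm_eq_abs] using this

/-- The mesh has radius at most θ^⌊n^q⌋, which bounds the derivative up to a constant and beats m(n)
≤ n + 1. The remaining |t_i - t_j| is O(φ). -/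
lemma isSmallOnMesh_of_deriv_eq_zero (hθ₀ : 0 < θ) (hθ₁ : θ < 1) (hq₀ : 0 < q) (hq₁ : q < 1)
    (he : |e| = 1) (hf : ContDiffAt ℝ 2 f d) (hd : deriv f d = 0)
    (hφ : (fun x : ℝ => x) =O[𝓝[>] 0] φ) (hmono : MonotoneOn φ (Ici 0)) (h0 : φ 0 = 0) :
    IsSmallOnMesh φ f d e θ q := by
  obtain ⟨K, hK0, r, hr, hK⟩ := exists_abs_sub_le_of_deriv_eq_zero hf hd
  obtain ⟨C, hC, r', hr', hCφ⟩ := exists_le_mul_of_isBigO hφ hmono h0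
  refine ⟨fun n => K * θ ^ ⌊(n : ℝ) ^ q⌋₊ * C, fun n => by positivity, ?_, ?_⟩
  · have h1 : Tendsto (fun n : ℕ => K * C * (θ ^ ⌊(n : ℝ) ^ q⌋₊ * n + 2 * θ ^ ⌊(n : ℝ) ^ q⌋₊)) atTop
        (𝓝 0) := by
      simpa using ((tendsto_pow_floor_rpow_mul hθ₀ hθ₁ hq₀).add
        ((tendsto_pow_floor_rpow hθ₀ hθ₁ hq₀).const_mul 2)).const_mul (K * C)
    refine squeeze_zero (fun n => by positivity) (fun n => ?_) h1
    have h2 : (meshLen q n : ℝ) ≤ n + 1 := by exact_mod_cast meshLen_le q n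
    have h3 : 0 ≤ K * C * θ ^ ⌊(n : ℝ) ^ q⌋₊ := by positivity
    nlinarith
  · filter_upwards [eventually_meshPt_lt hθ₀ hθ₁ hq₀ hq₁ hr',
      (tendsto_pow_floor_rpow hθ₀ hθ₁ hq₀).eventually_lt_const hr] with n hn hn' i hi j hj
    have hmem : ∀ j ≤ meshLen q n, d + e * meshPt θ n j ∈
        Icc (d - θ ^ ⌊(n : ℝ) ^ q⌋₊) (d + θ ^ ⌊(n : ℝ) ^ q⌋₊) := fun j hj => by
      have h1 : |e * meshPt θ n j| ≤ θ ^ ⌊(n : ℝ) ^ q⌋₊ := by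
        rw [abs_mul, he, one_mul, abs_of_nonneg (meshPt_nonneg hθ₀ n j)]
        exact meshPt_le hθ₀ hθ₁ hq₀ hq₁ hj
      have := abs_le.1 h1
      constructor <;> linarith
    have h1 := hK _ hn' _ (hmem i hi) _ (hmem j hj)
    rw [add_sub_add_left_eq_sub, ← mul_sub, abs_mul, he, one_mul] at h1
    refine h1.trans ?_
    rw [mul_assoc _ C]
    gcongr
    exact hCφ _ (abs_nonneg _) (abs_sub_meshPt_lt hθ₀ (hn i hi) (hn j hj))

end Mesh

end

noncomputable section

/-! ### The law of the iterated logarithm along the mesh -/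

/-- The finite-dimensional laws of a permanental process, in terms of Laplace transforms. -/
lemma IsPermanentalProcess.laplace_map {Ω : Type*} [MeasurableSpace Ω] {T : Set ℝ}
    {K : ℝ → ℝ → ℝ} {α : ℝ} {X : ℝ → Ω → ℝ} {μ : Measure Ω} [IsProbabilityMeasure μ]
    (hX : IsPermanentalProcess T K α X μ) {n : ℕ} {t : Fin n → ℝ} (ht : ∀ i, t i ∈ T)
    {s : Fin n → ℝ≥0} (hs : ∀ i, 0 < s i) :
    laplace (μ.map fun ω i => (X (t i) ω).toNNReal) s = ENNReal.ofReal
      (1 / (1 + Matrix.of (fun i j => K (t i) (t j)) *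
        Matrix.diagonal fun i => (s i : ℝ)).det ^ α) := by
  have hm : ∀ i, Measurable (X (t i)) := fun i => hX.1 _ (ht i)
  have hpos : ∀ᵐ ω ∂μ, ∀ i, 0 ≤ X (t i) ω := ae_all_iff.2 fun i => hX.2.1 _ (ht i)
  rw [← hX.2.2 n t (fun i => s i) ht fun i => by exact_mod_cast hs i, laplace,
    lintegral_map (measurable_laplace_kernel s) (by fun_prop),
    ofReal_integral_eq_lintegral_ofReal]
  · refine lintegral_congr_ae ?_
    filter_upwards [hpos] with ω hω
    simp only [Real.coe_toNNReal _ (hω _)]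
  · refine Integrable.of_bound (Measurable.aestronglyMeasurable (by fun_prop)) 1 ?_
    filter_upwards [hpos] with ω hω
    rw [Real.norm_of_nonneg (Real.exp_pos _).le, Real.exp_le_one_iff, neg_nonpos]
    exact Finset.sum_nonneg fun i _ => mul_nonneg (NNReal.coe_nonneg _) (hω i)
  · exact ae_of_all _ fun ω => (Real.exp_pos _).le

lemma exists_forall_measure_lt_le {α : Type*} [MeasurableSpace α] (ν : Measure α)
    [IsFiniteMeasure ν] {F : α → ℝ} (hF : Measurable F) {ε : ℝ} (hε : 0 < ε) :
    ∃ R₀ : ℝ, ∀ R, R₀ ≤ R → ν {x | R < F x} ≤ ENNReal.ofReal ε := by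
  have h1 : Tendsto (fun n : ℕ => ν {x | (n : ℝ) < F x}) atTop (𝓝 (ν (⋂ n : ℕ, {x | (n : ℝ) < F x}))) := by
    refine tendsto_measure_iInter_atTop
      (fun n => (measurableSet_lt measurable_const hF).nullMeasurableSet) ?_
      ⟨0, measure_ne_top _ _⟩
    intro i j hij x hx
    have : (i : ℝ) ≤ j := by exact_mod_cast hij
    exact this.trans_lt hx
  have h2 : (⋂ n : ℕ, {x | (n : ℝ) < F x}) = ∅ := by
    ext x
    obtain ⟨n, hn⟩ := exists_nat_ge (F x)
    simp only [mem_iInter, mem_ofPred_eq, mem_empty_iff_false, iff_false, not_forall, not_lt]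
    exact ⟨n, hn⟩
  rw [h2, measure_empty] at h1
  obtain ⟨n, hn⟩ := (h1.eventually_le_const (ENNReal.ofReal_pos.2 hε)).exists
  exact ⟨n, fun R hR => (measure_mono fun x (hx : R < F x) => hR.trans_lt hx).trans hn⟩

section Mesh

variable {θ q d e : ℝ}

lemma eventually_forall_meshPt_of_nhds (hθ₀ : 0 < θ) (hθ₁ : θ < 1) (hq₀ : 0 < q) (hq₁ : q < 1)
    (he : |e| = 1) {p : ℝ → Prop} (hp : ∀ᶠ x in 𝓝 d, p x) :
    ∀ᶠ n : ℕ in atTop, ∀ j ≤ meshLen q n, p (d + e * meshPt θ n j) := by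
  obtain ⟨r, hr, hrp⟩ := Metric.eventually_nhds_iff.1 hp
  filter_upwards [eventually_meshPt_lt hθ₀ hθ₁ hq₀ hq₁ hr] with n hn j hj
  refine hrp ?_
  rw [Real.dist_eq, add_sub_cancel_left, abs_mul, he, one_mul,
    abs_of_nonneg (meshPt_nonneg hθ₀ n j)]
  exact hn j hj

lemma eventually_forall_meshPt_of_nhdsGT (hθ₀ : 0 < θ) (hθ₁ : θ < 1) (hq₀ : 0 < q) (hq₁ : q < 1)
    {p : ℝ → Prop} (hp : ∀ᶠ t in 𝓝[>] 0, p t) :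
    ∀ᶠ n : ℕ in atTop, ∀ j ≤ meshLen q n, j ≠ 0 → p (meshPt θ n j) := by
  obtain ⟨r, hr, hrp⟩ := mem_nhdsGT_iff_exists_Ioo_subset.1 hp
  filter_upwards [eventually_meshPt_lt hθ₀ hθ₁ hq₀ hq₁ hr] with n hn j hj hj0
  exact hrp ⟨meshPt_pos hθ₀ n hj0, hn j hj⟩

end Mesh

/-- The normalization of the increments of a process at `d` in the direction `e`. -/
def lilDen (u : ℝ → ℝ → ℝ) (d e t : ℝ) : ℝ :=
  √(2 * incVar u (d + e * t) d * Real.log (Real.log (1 / t)))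

section Normalization

variable {u : ℝ → ℝ → ℝ} {J : Set ℝ} {d e : ℝ} {φ : ℝ → ℝ}

lemma tendsto_log_log_one_div : Tendsto (fun t : ℝ => Real.log (Real.log (1 / t))) (𝓝[>] 0) atTop :=
  Real.tendsto_log_atTop.comp (Real.tendsto_log_atTop.comp 
    (tendsto_inv_nhdsGT_zero.congr fun t => (one_div t).symm))

lemma IsRegularAt.eventually_incVar_pos (hφ : IsRegularAt u d φ) (he : |e| = 1) :
    ∀ᶠ t in 𝓝[>] 0, 0 < incVar u (d + e * t) d := by
  obtain ⟨δ, hδ, c₁, hc₁, c₂, hc₂, c₃, hc₃, h1, h2⟩ := hφ.comparable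
  filter_upwards [Ioo_mem_nhdsGT hδ] with t ht
  have ht' : |e * t| = t := by rw [abs_mul, he, one_mul, abs_of_pos ht.1]
  have hmem : d + e * t ∈ Icc (d - δ) (d + δ) := by
    have := abs_le.1 (ht'.trans_le ht.2.le)
    constructor <;> linarith
  refine lt_of_lt_of_le ?_ (h1 _ hmem d ⟨by linarith, by linarith⟩).1
  rw [add_sub_cancel_left, ht']
  exact mul_pos hc₂ (pos_of_isBigO_of_monotoneOn hφ.isBigO hφ.monotoneOn hφ.map_zero ht.1)

lemma eventually_lilDen_pos (hφ : IsRegularAt u d φ) (he : |e| = 1) :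
    ∀ᶠ t in 𝓝[>] 0, 0 < lilDen u d e t := by
  filter_upwards [hφ.eventually_incVar_pos he, tendsto_log_log_one_div.eventually_ge_atTop 1]
    with t h1 h2
  unfold lilDen
  positivity

/-- By `le_diag`, σ²(x, d) is the sum of the nonnegative terms u(d,d) - u(x,d) and u(x,x) - u(x,d).
So the regression coefficient differs from 1 by at most σ²/u(d,d) = o(σ), while the normalization is
at least σ once the iterated logarithm exceeds 1. -/
lemma eventually_regression_le (h : IsDominationKernel u J) (hJ : J ∈ 𝓝 d)
    (huc : Continuous fun p : ℝ × ℝ => u p.1 p.2) {c : ℝ} (hc : 0 ≤ c) (R : ℝ) {ε : ℝ}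
    (hε : 0 < ε) :
    ∀ᶠ t in 𝓝[>] 0, |(u (d + e * t) d + c) / (u d d + c) - 1| * R ≤ ε * lilDen u d e t := by
  have hd := mem_of_mem_nhds hJ
  have hud := h.diag_pos d hd
  have hdt : Tendsto (fun t : ℝ => d + e * t) (𝓝[>] 0) (𝓝 d) := by
    have : Continuous fun t : ℝ => d + e * t := by fun_prop
    simpa using (this.tendsto 0).mono_left nhdsWithin_le_nhds
  have hinc : Tendsto (fun t : ℝ => √(incVar u (d + e * t) d)) (𝓝[>] 0) (𝓝 0) := by
    have h1 : Continuous fun x : ℝ => √(incVar u x d) := by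
      unfold incVar
      have h2 : Continuous fun x => u x x := huc.comp (continuous_id.prodMk continuous_id)
      have h3 : Continuous fun x => u x d := huc.comp (continuous_id.prodMk continuous_const)
      fun_prop
    have h2 := (h1.tendsto d).comp hdt
    have h3 : √(incVar u d d) = 0 := by
      rw [incVar, Real.sqrt_eq_zero']
      linarith
    rwa [h3] at h2
  have hR : 0 < ε * u d d / (|R| + 1) := by positivity
  filter_upwards [hdt.eventually hJ, hinc.eventually_lt_const hR,
    tendsto_log_log_one_div.eventually_ge_atTop 1] with t hx hσ hlog
  set x := d + e * t with hxdef
  have h1 : u x d ≤ u d d := h.le_diag hx hd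
  have h2 : u d x ≤ u x x := h.le_diag hd hx
  rw [h.symm d x] at h2
  have h3 : |(u x d + c) / (u d d + c) - 1| ≤ incVar u x d / u d d := by
    have h4 : (u x d + c) / (u d d + c) - 1 = -((u d d - u x d) / (u d d + c)) := by
      field_simp
      ring
    rw [h4, abs_neg, abs_of_nonneg (div_nonneg (by linarith) (by linarith))]
    unfold incVar
    exact div_le_div₀ (by linarith) (by linarith) hud (by linarith)
  have h5 : 0 ≤ incVar u x d := by unfold incVar; linarith
  calc |(u x d + c) / (u d d + c) - 1| * R ≤ incVar u x d / u d d * (|R| + 1) := by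
        have := le_abs_self R
        have := abs_nonneg R
        refine (mul_le_mul_of_nonneg_left (by linarith : R ≤ |R| + 1) (abs_nonneg _)).trans ?_
        gcongr
    _ = √(incVar u x d) * (√(incVar u x d) * (|R| + 1) / u d d) := by
        rw [mul_div_assoc, ← mul_assoc, Real.mul_self_sqrt h5]
        ring
    _ ≤ √(incVar u x d) * ε := by
        gcongr
        rw [div_le_iff₀ hud]
        rw [lt_div_iff₀ (by positivity)] at hσ
        exact hσ.le
    _ ≤ ε * lilDen u d e t := by
        rw [mul_comm]
        unfold lilDen
        gcongr
        nlinarith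

end Normalization

end

noncomputable section

/-! ### Large increments of the permanental process along the mesh -/

section LargeIncrements

variable {u : ℝ → ℝ → ℝ} {J : Set ℝ} {d e θ q : ℝ} {φ : ℝ → ℝ}

/-- The approximation error in the comparison with squares of Gaussian vectors vanishes with the
oscillation of the excessive functions. -/
lemma exists_forall_one_sub_rpow_le (k : ℕ) {ε : ℝ} (hε : 0 < ε) :
    ∃ y₀ > 0, ∀ y, 0 ≤ y → y ≤ y₀ → 1 - (1 + y) ^ (-((k : ℝ) / 2)) ≤ ε := by
  have h1 : ContinuousAt (fun y : ℝ => 1 - (1 + y) ^ (-((k : ℝ) / 2))) 0 := by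
    refine continuousAt_const.sub (ContinuousAt.rpow_const (by fun_prop) (Or.inl (by norm_num)))
  have h2 := h1.tendsto.eventually_le_const (u := ε) (by simpa using hε)
  obtain ⟨r, hr, hrp⟩ := Metric.eventually_nhds_iff.1 h2
  refine ⟨r / 2, by positivity, fun y hy hyr => hrp ?_⟩
  rw [Real.dist_eq, sub_zero, abs_of_nonneg hy]
  linarith

/-- The supremum over the finite nonempty index set is attained, and the normalization is positive
on the mesh for large n. -/
lemma eventually_le_measure_increment {Ω : Type*} [MeasurableSpace Ω] {η : ℝ → Ω → ℝ}
    {P : Measure Ω} [IsProbabilityMeasure P] (hθ₀ : 0 < θ) (hθ₁ : θ < 1) (hq₀ : 0 < q) (hq₁ : q < 1)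
    (he : |e| = 1) (hφ : IsRegularAt u d φ) (hL : LILAlongMesh η P u d θ q e) {ε : ℝ}
    (hε : 0 < ε) :
    ∀ᶠ n : ℕ in atTop, ENNReal.ofReal (1 - ε) ≤ P {ω | ∃ j ∈ {j : Fin (meshLen q n + 1) | j ≠ 0},
      (1 - ε) * lilDen u d e (meshPt θ n j) ≤ η (d + e * meshPt θ n j) ω - η d ω} := by
  filter_upwards [hL ε hε, eventually_forall_meshPt_of_nhdsGT hθ₀ hθ₁ hq₀ hq₁
    (eventually_lilDen_pos hφ he)] with n hn hden
  refine (ENNReal.ofReal_le_of_le_toReal hn).trans (measure_mono ?_)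
  intro ω hω
  have : Nonempty (Finset.Icc 1 (meshLen q n)) :=
    ⟨⟨1, Finset.mem_Icc.2 ⟨le_rfl, meshLen_pos hq₀ hq₁ n⟩⟩⟩
  obtain ⟨⟨j, hj⟩, hj'⟩ := exists_eq_ciSup_of_finite
    (f := fun j : Finset.Icc 1 (meshLen q n) => (η (d + e * meshPt θ n j) ω - η d ω) /
      √(2 * incVar u (d + e * meshPt θ n j) d * Real.log (Real.log (1 / meshPt θ n j))))
  rw [Finset.mem_Icc] at hj
  refine ⟨⟨j, by omega⟩, fun h0 => ?_, ?_⟩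
  · have := congrArg Fin.val h0
    simp at this
    omega
  · rw [mem_ofPred_eq, ← hj'] at hω
    exact (le_div_iff₀ (hden j hj.2 (by omega))).1 hω

theorem eventually_le_measure_permanental_increment (hθ₀ : 0 < θ) (hθ₁ : θ < 1) (hq₀ : 0 < q)
    (hq₁ : q < 1) (he : |e| = 1) (h : IsDominationKernel u J) (hJ : J ∈ 𝓝 d)
    (huc : Continuous fun p : ℝ × ℝ => u p.1 p.2) (hφ : IsRegularAt u d φ)
    {Ω₂ : Type*} [MeasurableSpace Ω₂] {P₂ : Measure Ω₂} [IsProbabilityMeasure P₂]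
    {η : ℝ → Ω₂ → ℝ} (hη : IsCenteredGaussianWithCov η P₂ u) (hL : LILAlongMesh η P₂ u d θ q e)
    {f g : ℝ → ℝ} (hf : IsDominatedBy u J f) (hg : IsDominatedBy u J g) (hf0 : 0 ≤ f d)
    (hg0 : 0 ≤ g d) (hfc : ContinuousAt f d) (hgc : ContinuousAt g d)
    (hfs : IsSmallOnMesh φ f d e θ q) (hgs : IsSmallOnMesh φ g d e θ q)
    {T : Set ℝ} (hJT : J ⊆ T) {k : ℕ} (hk : 0 < k)
    {Ω₃ : Type*} [MeasurableSpace Ω₃] {P₃ : Measure Ω₃} [IsProbabilityMeasure P₃]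
    {X : ℝ → Ω₃ → ℝ}
    (hX : IsPermanentalProcess T (fun x y => u x y + g x * f y) ((k : ℝ) / 2) X P₃)
    {ε : ℝ} (hε : 0 < ε) (hε1 : ε ≤ 1) :
    ∀ᶠ n : ℕ in atTop, ENNReal.ofReal (1 - ε) ≤ P₃ {ω | ∃ j ∈ {j : Fin (meshLen q n + 1) | j ≠ 0},
      ((1 - ε) * √(2 * X d ω) - ε) * lilDen u d e (meshPt θ n j) ≤
        X (d + e * meshPt θ n j) ω - X d ω} := by
  classical
  have hd := mem_of_mem_nhds hJ
  have hud := h.diag_pos d hd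
  set c := f d * g d with hc
  have hc0 : 0 ≤ c := mul_nonneg hf0 hg0
  -- The losses are ε₁ for the ball of radius² `R`, 2ε₁ for the residuals and ε₁ for the comparison
  -- of laws, at most 4ε₁ in all.
  set ε₁ := ε / 8 with hε₁
  have hε₁0 : 0 < ε₁ := by positivity
  set γ := gaussianReal 0 (u d d + c).toNNReal
  obtain ⟨R₁, hR₁⟩ := exists_forall_measure_lt_le γ (F := fun x => |x|) (by fun_prop) hε₁0
  obtain ⟨R₂, hR₂⟩ := exists_forall_measure_lt_le (Measure.pi fun _ : Fin k => γ)
    (F := fun x => ∑ i, x i ^ 2) (by fun_prop) hε₁0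
  set R := max R₁ R₂
  obtain ⟨y₀, hy₀, hy⟩ := exists_forall_one_sub_rpow_le k hε₁0
  obtain ⟨δ, hδ, c₁, hc₁, c₂, hc₂, c₃, hc₃, hreg, -⟩ := hφ.comparable
  -- The added 1 leaves room for g(x_i) ≤ g(d) + τ', since τ' ≤ 1.
  set G := max (f d) (g d) + 1 with hG
  have hG1 : 0 < G := by
    have := le_max_left (f d) (g d)
    linarith
  set r := u d d / 2 with hr
  have hr0 : 0 < r := by positivity
  -- The two parts of the comparison error are each made at most y₀/(4G), so that the prefactor 2G
  -- yields y₀.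
  set τ' := min 1 (r * y₀ / (4 * G)) with hτ'
  have hτ'0 : 0 < τ' := lt_min one_pos (by positivity)
  obtain ⟨τf, hτf0, hτf, hfτ⟩ := hfs
  obtain ⟨τg, hτg0, hτg, hgτ⟩ := hgs
  have hu2 : ∀ᶠ x in 𝓝 d, r ≤ u d x := by
    have : Continuous fun x => u d x := huc.comp (continuous_const.prodMk continuous_id)
    exact (this.tendsto d).eventually_const_le (by simp only [hr]; linarith)
  have hosc : ∀ v : ℝ → ℝ, ContinuousAt v d → ∀ᶠ x in 𝓝 d, |v x - v d| ≤ τ' := fun v hv => by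
    filter_upwards [Metric.continuousAt_iff'.1 hv τ' hτ'0] with x hx
    exact hx.le
  have hsmall : ∀ᶠ n : ℕ in atTop,
      (τf n + τg n) * (meshLen q n + 1) < c₂ * y₀ / (8 * G) := by
    have := hτf.add hτg
    simp_rw [← add_mul] at this
    rw [add_zero] at this
    exact this.eventually_lt_const (by positivity)
  filter_upwards [hfτ, hgτ, hsmall, eventually_forall_meshPt_of_nhds hθ₀ hθ₁ hq₀ hq₁ he hJ,
    eventually_forall_meshPt_of_nhds hθ₀ hθ₁ hq₀ hq₁ he hu2,
    eventually_forall_meshPt_of_nhds hθ₀ hθ₁ hq₀ hq₁ he (hosc f hfc),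
    eventually_forall_meshPt_of_nhds hθ₀ hθ₁ hq₀ hq₁ he (hosc g hgc),
    eventually_forall_meshPt_of_nhds hθ₀ hθ₁ hq₀ hq₁ he
      (Icc_mem_nhds (by linarith : d - δ < d) (by linarith : d < d + δ)),
    eventually_forall_meshPt_of_nhdsGT hθ₀ hθ₁ hq₀ hq₁
      (eventually_regression_le (e := e) h hJ huc hc0 R hε₁0),
    eventually_forall_meshPt_of_nhdsGT hθ₀ hθ₁ hq₀ hq₁ (eventually_lilDen_pos hφ he),
    eventually_le_measure_increment hθ₀ hθ₁ hq₀ hq₁ he hφ hL hε₁0]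
    with n hfn hgn hsn hJn hun hfo hgo hδn hρn hden hLn
  have hle : ∀ i : Fin (meshLen q n + 1), (i : ℕ) ≤ meshLen q n := fun i => by omega
  set x : Fin (meshLen q n + 1) → ℝ := fun i => d + e * meshPt θ n i with hxdef
  have hx0 : x 0 = d := by simp [hxdef]
  have hxJ : ∀ i, x i ∈ J := fun i => hJn i (hle i)
  have he0 : e ≠ 0 := fun h0 => by simp [h0] at he
  have hxinj : Function.Injective x := fun i j hij => by
    have h1 : meshPt θ n i = meshPt θ n j := by simpa [hxdef, he0] using hij
    exact Fin.ext (meshPt_injOn hθ₀ hθ₁ n ((hle i).trans (meshLen_le q n))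
      ((hle j).trans (meshLen_le q n)) h1)
  have hpsd := hη.posSemidef x
  set V : Matrix (Fin (meshLen q n + 1)) (Fin (meshLen q n + 1)) ℝ :=
    Matrix.of fun i j => u (x i) (x j) + c with hV
  have hVpsd : V.PosSemidef := hpsd.add_const hc0
  have hV0 : ∀ i, V i 0 = u (x i) d + c := fun i => by simp [hV, hx0]
  have hV00 : V 0 0 = u d d + c := by rw [hV0, hx0]
  have hV00' : V 0 0 ≠ 0 := by
    rw [hV00]
    positivity
  set S : Set (Fin (meshLen q n + 1)) := {j | j ≠ 0} with hS
  have hS0 : ∀ j ∈ S, (j : ℕ) ≠ 0 := fun j hj h0 => hj (Fin.ext (by simpa using h0))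
  set den : Fin (meshLen q n + 1) → ℝ := fun j => lilDen u d e (meshPt θ n j) with hdendef
  have hρ : ∀ j ∈ S, |V j 0 / V 0 0 - 1| * R ≤ ε₁ * den j := fun j hj => by
    rw [hV0, hV00]
    exact hρn j (hle j) (hS0 j hj)
  have hγ : gaussianReal 0 (V 0 0).toNNReal = γ := by rw [hV00]
  -- the Gaussian lower bound
  have hW : ENNReal.ofReal (1 - 2 * ε₁) ≤ multivariateGaussian 0 (residualCov V 0)
      {w | ∃ j ∈ S, (1 - 2 * ε₁) * den j ≤ w j} := by
    have h1 := measure_increment_le_residual hVpsd hρ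
    rw [hγ, ← hη.measure_increment_eq x hc0, hx0] at h1
    have h2 := (hLn.trans h1).trans (add_le_add le_rfl (hR₁ R (le_max_left _ _)))
    rw [← tsub_le_iff_right, ← ENNReal.ofReal_sub _ hε₁0.le] at h2
    refine le_trans (ENNReal.ofReal_le_ofReal ?_) h2
    linarith
  have hball : ENNReal.ofReal (1 - ε₁) ≤ (Measure.pi fun _ : Fin k => γ) {x | ∑ i, x i ^ 2 ≤ R} := by
    have h1 : (1 : ℝ≥0∞) ≤ (Measure.pi fun _ : Fin k => γ) {x | ∑ i, x i ^ 2 ≤ R} +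
        (Measure.pi fun _ : Fin k => γ) {x | R < ∑ i, x i ^ 2} := by
      rw [← measure_univ (μ := Measure.pi fun _ : Fin k => γ)]
      refine (measure_mono fun x _ => ?_).trans (measure_union_le _ _)
      exact le_or_gt (∑ i, x i ^ 2) R
    have h2 := h1.trans (add_le_add le_rfl (hR₂ R (le_max_right _ _)))
    rwa [← tsub_le_iff_right, ← ENNReal.ofReal_one, ← ENNReal.ofReal_sub _ hε₁0.le] at h2
  set B : Set (Fin (meshLen q n + 1) → ℝ≥0) :=
    {y | ∃ j ∈ S, ((1 - 2 * ε₁) * √(2 * y 0) - ε₁) * den j ≤ (y j : ℝ) - y 0} with hB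
  have hBm : MeasurableSet B := measurableSet_exists_mem_le S (by fun_prop) (by fun_prop)
  have hgs : ENNReal.ofReal ((1 - ε₁) * (1 - 2 * ε₁)) ≤ gaussianSquares V k B := by
    rw [ENNReal.ofReal_mul (by simp only [hε₁]; linarith)]
    refine le_trans ?_ (measure_residual_le_gaussianSquares hVpsd hV00' k hρ)
    rw [hγ]
    gcongr
  -- comparison
  have hxT : ∀ i, x i ∈ T := fun i => hJT (hxJ i)
  have hXm : Measurable fun ω i => (X (x i) ω).toNNReal := by
    have : ∀ i, Measurable (X (x i)) := fun i => hX.1 _ (hxT i)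
    fun_prop
  have := Measure.isProbabilityMeasure_map (μ := P₃) hXm.aemeasurable
  -- The bound σ² ≥ c₂ φ converts oscillation bounds in `φ` into bounds in σ², whence the division
  -- by `c₂` below.
  have hinc : ∀ i j : Fin (meshLen q n + 1), φ |meshPt θ n i - meshPt θ n j| ≤ incVar u (x i) (x j) / c₂ := fun i j => by
    have h1 := (hreg _ (hδn i (hle i)) _ (hδn j (hle j))).1
    rw [add_sub_add_left_eq_sub, ← mul_sub, abs_mul, he, one_mul] at h1
    rw [le_div_iff₀ hc₂, mul_comm]
    exact h1
  have hinc0 : ∀ i j, 0 ≤ incVar u (x i) (x j) := fun i j => by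
    have h1 : φ 0 ≤ φ |meshPt θ n i - meshPt θ n j| :=
      hφ.monotoneOn (mem_Ici.2 le_rfl) (mem_Ici.2 (abs_nonneg _)) (abs_nonneg _)
    rw [hφ.map_zero] at h1
    have h2 := mul_nonneg (h1.trans (hinc i j)) hc₂.le
    rwa [div_mul_cancel₀ _ hc₂.ne'] at h2
  have hcomp := h.gaussianSquares_le_add hxinj hxJ hpsd hf hg (o := 0) (by rw [hx0]; exact hf0)
    (by rw [hx0]; exact hg0) hk hr0 (fun i => by rw [hx0]; exact hun i (hle i))
    (τ := (τf n + τg n) / c₂) (τ' := τ') (G := G)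
    (div_nonneg (add_nonneg (hτf0 n) (hτg0 n)) hc₂.le)
    (fun i j => by
      refine (hfn i (hle i) j (hle j)).trans ((mul_le_mul_of_nonneg_left (hinc i j)
        (hτf0 n)).trans ?_)
      rw [mul_div_assoc', ← div_mul_eq_mul_div]
      have := hτg0 n
      have := hinc0 i j
      gcongr
      linarith)
    (fun i j => by
      refine (hgn i (hle i) j (hle j)).trans ((mul_le_mul_of_nonneg_left (hinc i j)
        (hτg0 n)).trans ?_)
      rw [mul_div_assoc', ← div_mul_eq_mul_div]
      have := hτf0 n
      have := hinc0 i j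
      gcongr
      linarith)
    (fun i => by rw [hx0]; exact hfo i (hle i)) (fun i => by rw [hx0]; exact hgo i (hle i))
    (by
      rw [hx0]
      have := le_max_left (f d) (g d)
      linarith)
    (fun i => by
      have h1 := (abs_le.1 (hgo i (hle i))).2
      have h2 := le_max_right (f d) (g d)
      have h3 : τ' ≤ 1 := min_le_left _ _
      simp only [hxdef]
      linarith)
    (fun s hs => hX.laplace_map hxT hs) B
  rw [hx0] at hcomp
  have herr : 1 - (1 + 2 * G * (τ' / r + (τf n + τg n) / c₂ *
      (2 * Fintype.card (Fin (meshLen q n + 1))))) ^ (-((k : ℝ) / 2)) ≤ ε₁ := by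
    refine hy _ (by have := hτf0 n; have := hτg0 n; positivity) ?_
    rw [Fintype.card_fin]
    push_cast
    have h1 : τ' / r ≤ y₀ / (4 * G) := by
      rw [div_le_iff₀ hr0]
      exact (min_le_right _ _).trans_eq (by ring)
    have h2 : (τf n + τg n) / c₂ * (2 * ((meshLen q n : ℝ) + 1)) ≤ y₀ / (4 * G) := by
      calc (τf n + τg n) / c₂ * (2 * ((meshLen q n : ℝ) + 1)) =
          2 / c₂ * ((τf n + τg n) * (meshLen q n + 1)) := by ring
        _ ≤ 2 / c₂ * (c₂ * y₀ / (8 * G)) := by gcongr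
        _ = y₀ / (4 * G) := by
          field_simp
          norm_num
    calc _ ≤ 2 * G * (y₀ / (4 * G) + y₀ / (4 * G)) := by gcongr
      _ = y₀ := by
        field_simp
        norm_num
  have hfin : ENNReal.ofReal (1 - ε) ≤ P₃.map (fun ω i => (X (x i) ω).toNNReal) B := by
    have h1 := (hgs.trans hcomp).trans (add_le_add le_rfl (ENNReal.ofReal_le_ofReal herr))
    rw [← tsub_le_iff_right, ← ENNReal.ofReal_sub _ hε₁0.le] at h1
    refine (ENNReal.ofReal_le_ofReal ?_).trans h1
    simp only [hε₁]
    nlinarith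
  rw [Measure.map_apply hXm hBm] at hfin
  refine hfin.trans (measure_mono_ae ?_)
  have hpos : ∀ᵐ ω ∂P₃, ∀ i, 0 ≤ X (x i) ω := ae_all_iff.2 fun i => hX.2.1 _ (hxT i)
  filter_upwards [hpos] with ω hω
  rintro ⟨j, hj, hj'⟩
  refine ⟨j, hj, le_trans ?_ (hj'.trans_eq ?_)⟩
  · have h1 : ((X (x 0) ω).toNNReal : ℝ) = X d ω := by rw [Real.coe_toNNReal _ (hω 0), hx0]
    rw [h1]
    refine mul_le_mul_of_nonneg_right ?_ (hden j (hle j) (hS0 j hj)).le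
    have := Real.sqrt_nonneg (2 * X d ω)
    simp only [hε₁]
    nlinarith
  · rw [Real.coe_toNNReal _ (hω 0), Real.coe_toNNReal _ (hω j), hx0]

end LargeIncrements

end

noncomputable section

/-! ### The law of the iterated logarithm -/

section LIL

variable {u : ℝ → ℝ → ℝ} {J : Set ℝ} {d e θ q : ℝ} {φ : ℝ → ℝ}

/-- The convergence half of Borel–Cantelli suffices, and it needs no independence: the mesh index
may be chosen separately for each accuracy 2⁻ⁱ, making the exceptional probabilities summable. The
filter `l` allows both sides of `d` to be treated at once. -/
theorem ae_le_limsup_of_LILAlongMesh (hθ₀ : 0 < θ) (hθ₁ : θ < 1) (hq₀ : 0 < q)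
    (hq₁ : q < 1) (he : |e| = 1) (h : IsDominationKernel u J) (hJ : J ∈ 𝓝 d)
    (huc : Continuous fun p : ℝ × ℝ => u p.1 p.2) (hφ : IsRegularAt u d φ)
    {Ω₂ : Type*} [MeasurableSpace Ω₂] {P₂ : Measure Ω₂} [IsProbabilityMeasure P₂]
    {η : ℝ → Ω₂ → ℝ} (hη : IsCenteredGaussianWithCov η P₂ u) (hL : LILAlongMesh η P₂ u d θ q e)
    {f g : ℝ → ℝ} (hf : IsDominatedBy u J f) (hg : IsDominatedBy u J g) (hf0 : 0 ≤ f d)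
    (hg0 : 0 ≤ g d) (hfc : ContinuousAt f d) (hgc : ContinuousAt g d)
    (hfs : IsSmallOnMesh φ f d e θ q) (hgs : IsSmallOnMesh φ g d e θ q)
    {T : Set ℝ} (hJT : J ⊆ T) {k : ℕ} (hk : 0 < k)
    {Ω₃ : Type*} [MeasurableSpace Ω₃] {P₃ : Measure Ω₃} [IsProbabilityMeasure P₃]
    {X : ℝ → Ω₃ → ℝ}
    (hX : IsPermanentalProcess T (fun x y => u x y + g x * f y) ((k : ℝ) / 2) X P₃)
    {l : Filter ℝ} (hl : Tendsto (fun t => e * t) (𝓝[>] 0) l) :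
    ∀ᵐ ω ∂P₃, ((√2 * √(X d ω) : ℝ) : EReal) ≤
      limsup (fun t : ℝ => ((|X (d + t) ω - X d ω| /
        √(2 * incVar u (d + t) d * Real.log (Real.log (1 / |t|))) : ℝ) : EReal)) l := by
  set ε : ℕ → ℝ := fun i => (1 / 2) ^ i with hεdef
  have hε0 : ∀ i, 0 < ε i := fun i => by positivity
  have hε1 : ∀ i, ε i ≤ 1 := fun i => pow_le_one₀ (by norm_num) (by norm_num)
  have hεlim : Tendsto ε atTop (𝓝 0) :=
    tendsto_pow_atTop_nhds_zero_of_lt_one (by norm_num) (by norm_num)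
  have key : ∀ i : ℕ, ∃ F : Set Ω₃, P₃ Fᶜ ≤ ENNReal.ofReal (ε i) ∧ ∀ ω ∈ F, ∃ t, 0 < t ∧ t < ε i ∧
      (1 - ε i) * √(2 * X d ω) - ε i ≤ |X (d + e * t) ω - X d ω| / lilDen u d e t := by
    intro i
    obtain ⟨n, hn, hnJ, hnt, hnd⟩ :=
      ((eventually_le_measure_permanental_increment hθ₀ hθ₁ hq₀ hq₁ he h hJ huc hφ hη hL hf hg hf0
        hg0 hfc hgc hfs hgs hJT hk hX (hε0 i) (hε1 i)).and
      ((eventually_forall_meshPt_of_nhds hθ₀ hθ₁ hq₀ hq₁ he hJ).and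
      ((eventually_meshPt_lt hθ₀ hθ₁ hq₀ hq₁ (hε0 i)).and
      (eventually_forall_meshPt_of_nhdsGT hθ₀ hθ₁ hq₀ hq₁ (eventually_lilDen_pos hφ he))))).exists
    have hle : ∀ j : Fin (meshLen q n + 1), (j : ℕ) ≤ meshLen q n := fun j => by omega
    have hXm : ∀ j : Fin (meshLen q n + 1), Measurable (X (d + e * meshPt θ n j)) := fun j =>
      hX.1 _ (hJT (hnJ j (hle j)))
    have hXd : Measurable (X d) := hX.1 _ (hJT (mem_of_mem_nhds hJ))
    refine ⟨{ω | ∃ j ∈ {j : Fin (meshLen q n + 1) | j ≠ 0},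
        ((1 - ε i) * √(2 * X d ω) - ε i) * lilDen u d e (meshPt θ n j) ≤
          X (d + e * meshPt θ n j) ω - X d ω}, ?_, fun ω hω => ?_⟩
    · rw [prob_compl_eq_one_sub (measurableSet_exists_mem_le _ (by fun_prop) (by fun_prop)),
        tsub_le_iff_right, ← ENNReal.ofReal_one]
      refine le_trans ?_ (add_le_add le_rfl hn)
      rw [← ENNReal.ofReal_add (hε0 i).le (by linarith [hε1 i])]
      exact ENNReal.ofReal_le_ofReal (by linarith)
    · obtain ⟨j, hj, hj'⟩ := hω
      have hj0 : (j : ℕ) ≠ 0 := fun h0 => hj (Fin.ext (by simpa using h0))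
      refine ⟨meshPt θ n j, meshPt_pos hθ₀ n hj0, hnt j (hle j), ?_⟩
      rw [le_div_iff₀ (hnd j (hle j) hj0)]
      exact hj'.trans (le_abs_self _)
  choose F hF hFt using key
  have hsum : ∑' i, P₃ (F i)ᶜ ≠ ⊤ := by
    refine ne_top_of_le_ne_top ?_ (ENNReal.tsum_le_tsum hF)
    rw [← ENNReal.ofReal_tsum_of_nonneg (fun i => (hε0 i).le) summable_geometric_two]
    exact ENNReal.ofReal_ne_top
  filter_upwards [ae_eventually_notMem hsum] with ω hω
  rw [← EReal.ge_of_forall_gt_iff_ge]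
  intro z hz
  rw [EReal.coe_lt_coe_iff, ← Real.sqrt_mul (by norm_num)] at hz
  refine le_limsup_of_frequently_le' (hl.frequently ?_)
  have hlim : Tendsto (fun i => (1 - ε i) * √(2 * X d ω) - ε i) atTop (𝓝 (√(2 * X d ω))) := by
    have := ((hεlim.const_sub 1).mul_const (√(2 * X d ω))).sub hεlim
    simpa using this
  rw [frequently_iff]
  intro U hU
  obtain ⟨r, hr, hrU⟩ := mem_nhdsGT_iff_exists_Ioo_subset.1 hU
  obtain ⟨i, hi, hi', hir⟩ := (hω.and ((hlim.eventually_const_lt hz).and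
    (hεlim.eventually_lt_const hr))).exists
  obtain ⟨t, ht0, hti, ht⟩ := hFt i ω (not_not.1 hi)
  refine ⟨t, hrU ⟨ht0, hti.trans hir⟩, ?_⟩
  rw [EReal.coe_le_coe_iff, abs_mul, he, one_mul, abs_of_pos ht0]
  exact hi'.le.trans ht

end LIL

end

/-! ### Assembly of the two one-sided statements -/

theorem mainTheorem6
    -- the symmetric Borel right process and its potential density
    (T : Set ℝ) (hT : T = Set.univ ∨ T = {0}ᶜ)
    {Ω₁ : Type*} [MeasurableSpace Ω₁] (𝒴 : BorelRightProcess T Ω₁)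
    (m : Measure T) [IsFiniteMeasureOnCompacts m] (h_symm : 𝒴.IsSymmetric m)
    (u : ℝ → ℝ → ℝ) (hu_cont : Continuous fun p : ℝ × ℝ => u p.1 p.2)
    (hu : 𝒴.HasPotentialDensity m fun x y => u x y)
    -- the associated Gaussian process
    {Ω₂ : Type*} [MeasurableSpace Ω₂] (P₂ : Measure Ω₂) [IsProbabilityMeasure P₂]
    (η : ℝ → Ω₂ → ℝ) (hη : IsCenteredGaussianWithCov η P₂ u)
    -- the excessive functions
    (f g : ℝ → ℝ) (hf : 𝒴.IsFiniteExcessive fun x => f x)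
    (hg : 𝒴.IsFiniteExcessive fun x => g x)
    -- the permanental process
    (k : ℕ) (hk : 1 ≤ k)
    {Ω₃ : Type*} [MeasurableSpace Ω₃] (P₃ : Measure Ω₃) [IsProbabilityMeasure P₃]
    (X : ℝ → Ω₃ → ℝ)
    (hX : IsPermanentalProcess T (fun x y => u x y + g x * f y) ((k : ℝ) / 2) X P₃)
    -- the point `d` and the regularity conditions
    (d : ℝ) (hd : d ∈ T) (hud : 0 < u d d)
    (hfg : ∃ δ > 0, ContDiffOn ℝ 1 f (Icc (d - δ) (d + δ)) ∧
      ContDiffOn ℝ 1 g (Icc (d - δ) (d + δ)))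
    (φ : ℝ → ℝ) (hφ : IsRegularAt u d φ)
    (θ q : ℝ) (hθ₀ : 0 < θ) (hθ₁ : θ < 1) (hq₀ : 0 < q) (hq₁ : q < 1)
    (h_cond : MeshCondition φ θ q ∨
      ((∃ δ > 0, ContDiffOn ℝ 2 f (Icc (d - δ) (d + δ)) ∧
        ContDiffOn ℝ 2 g (Icc (d - δ) (d + δ))) ∧ deriv f d = 0 ∧ deriv g d = 0)) :
    (LILAlongMesh η P₂ u d θ q 1 →
      ∀ᵐ ω ∂P₃, ((√2 * √(X d ω) : ℝ) : EReal) ≤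
        limsup (fun t : ℝ => ((|X (d + t) ω - X d ω| /
          √(2 * incVar u (d + t) d * Real.log (Real.log (1 / |t|))) : ℝ) : EReal)) (𝓝[>] 0)) ∧
    (LILAlongMesh η P₂ u d θ q (-1) →
      ∀ᵐ ω ∂P₃, ((√2 * √(X d ω) : ℝ) : EReal) ≤
        limsup (fun t : ℝ => ((|X (d + t) ω - X d ω| /
          √(2 * incVar u (d + t) d * Real.log (Real.log (1 / |t|))) : ℝ) : EReal)) (𝓝[<] 0)) := by
  have hTo : IsOpen T := by
    rcases hT with rfl | rfl
    · exact isOpen_univ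
    · exact isOpen_compl_singleton
  obtain ⟨δ₁, hδ₁, hf1, hg1⟩ := hfg
  have hnhds : ∀ δ > 0, Icc (d - δ) (d + δ) ∈ 𝓝 d := fun δ hδ =>
    Icc_mem_nhds (by linarith) (by linarith)
  have hfd : ContDiffAt ℝ 1 f d := hf1.contDiffAt (hnhds δ₁ hδ₁)
  have hgd : ContDiffAt ℝ 1 g d := hg1.contDiffAt (hnhds δ₁ hδ₁)
  obtain ⟨δ, hδ, c₁, hc₁, c₂, hc₂, c₃, hc₃, -, hreg⟩ := hφ.comparable
  -- The set `J` collects the points where the local hypotheses of the domination arguments hold. It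
  -- is a neighbourhood of `d`, so it contains the mesh for all large n.
  set J : Set ℝ := {x | x ∈ T ∧ x ∈ Icc (d - δ) (d + δ) ∧ ContinuousAt f x ∧ ContinuousAt g x ∧
    0 < u x x} with hJdef
  have hJ : J ∈ 𝓝 d := by
    have h1 : Continuous fun x => u x x := hu_cont.comp (continuous_id.prodMk continuous_id)
    filter_upwards [hTo.mem_nhds hd, hnhds δ hδ, hfd.eventually (by simp), hgd.eventually (by simp),
      (h1.tendsto d).eventually_const_lt hud] with x hx1 hx2 hx3 hx4 hx5
    exact ⟨hx1, hx2, hx3.continuousAt, hx4.continuousAt, hx5⟩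
  have hJT : J ⊆ T := fun x hx => hx.1
  have hfJ : IsDominatedBy u J f := 𝒴.isDominatedBy hTo hu hu_cont hJT (fun y => hf.1 y)
    (hf.isSupermedian 𝒴) fun x hx => hx.2.2.1
  have hgJ : IsDominatedBy u J g := 𝒴.isDominatedBy hTo hu hu_cont hJT (fun y => hg.1 y)
    (hg.isSupermedian 𝒴) fun x hx => hx.2.2.2.1
  have hconst : ∀ c : ℝ, 0 ≤ c → IsDominatedBy u J fun _ => c := fun c hc =>
    𝒴.isDominatedBy hTo hu hu_cont hJT (fun _ => hc)
      (BorelRightProcess.IsSupermedian.const (𝒴 := 𝒴) _) fun _ _ => continuousAt_const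
  have hdom : IsDominationKernel u J :=
    { symm := hη.symm
      nonneg := fun x hx y hy => hu.1 ⟨x, hx.1⟩ ⟨y, hy.1⟩
      diag_pos := fun x hx => hx.2.2.2.2
      -- The one-sided lower bound with `c₁` enters here, giving the strict inequality behind the
      -- invertibility of the covariance matrices.
      lt_diag := fun x hx y hy hyx => by
        have h1 := hreg x hx.2.1 y hy.2.1 hyx.le
        have h2 := pos_of_isBigO_of_monotoneOn hφ.isBigO hφ.monotoneOn hφ.map_zero
          (abs_pos.2 (sub_ne_zero.2 hyx.ne'))
        have h3 := mul_pos hc₁ h2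
        linarith
      dominatedBy_zero := hconst 0 le_rfl
      dominatedBy_one := hconst 1 zero_le_one }
  have hsmall : ∀ e : ℝ, |e| = 1 → IsSmallOnMesh φ f d e θ q ∧ IsSmallOnMesh φ g d e θ q := by
    intro e he
    rcases h_cond with h | ⟨⟨δ₂, hδ₂, hf2, hg2⟩, hf', hg'⟩
    · exact ⟨isSmallOnMesh_of_meshCondition hθ₀ hθ₁ hq₀ hq₁ he hfd hφ.isBigO hφ.monotoneOn
          hφ.map_zero h,
        isSmallOnMesh_of_meshCondition hθ₀ hθ₁ hq₀ hq₁ he hgd hφ.isBigO hφ.monotoneOn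
          hφ.map_zero h⟩
    · exact ⟨isSmallOnMesh_of_deriv_eq_zero hθ₀ hθ₁ hq₀ hq₁ he
          (hf2.contDiffAt (hnhds δ₂ hδ₂)) hf' hφ.isBigO hφ.monotoneOn hφ.map_zero,
        isSmallOnMesh_of_deriv_eq_zero hθ₀ hθ₁ hq₀ hq₁ he
          (hg2.contDiffAt (hnhds δ₂ hδ₂)) hg' hφ.isBigO hφ.monotoneOn hφ.map_zero⟩
  have key : ∀ (e : ℝ) (l : Filter ℝ), |e| = 1 → Tendsto (fun t => e * t) (𝓝[>] 0) l →
      LILAlongMesh η P₂ u d θ q e → ∀ᵐ ω ∂P₃, ((√2 * √(X d ω) : ℝ) : EReal) ≤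
        limsup (fun t : ℝ => ((|X (d + t) ω - X d ω| /
          √(2 * incVar u (d + t) d * Real.log (Real.log (1 / |t|))) : ℝ) : EReal)) l :=
    fun e l he hl hL => ae_le_limsup_of_LILAlongMesh hθ₀ hθ₁ hq₀ hq₁ he hdom hJ hu_cont hφ hη hL
      hfJ hgJ (hf.1 ⟨d, hd⟩) (hg.1 ⟨d, hd⟩) hfd.continuousAt hgd.continuousAt (hsmall e he).1
      (hsmall e he).2 hJT hk hX hl
  refine ⟨key 1 _ (by simp) ?_, key (-1) _ (by simp) ?_⟩
  · simp only [one_mul]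
    exact tendsto_id
  · simpa using tendsto_neg_nhdsGT (a := (0 : ℝ))
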